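/- Let $\mathbb{S}=\mathrm{Res}_{\mathbb{C}/\mathbb{R}}\mathbb{G}_m$. A pure Shimura datum $(G,X)$ (in the sense of Deligne) consists of a connected reductive $\mathbb{Q}$-group $G$ and a $G(\mathbb{R})$-conjugacy class $X$ of homomorphisms $h:\mathbb{S}\to G_{\mathbb{R}}$ such that, for every $h\in X$: the Hodge structure defined by $\mathrm{Ad}\circ h$ on $\mathrm{Lie}(G_{\mathbb{R}})$ is of type $\{(-1,1),(0,0),(1,-1)\}$; $\mathrm{Int}\,h(i)$ is a Cartan involution of $G^{\mathrm{ad}}_{\mathbb{R}}$; and $G^{\mathrm{ad}}$ has no nontrivial factor defined over $\mathbb{Q}$ on which the projection of $h$ is trivial. A morphism $(G,X)\to(G',X')$ of pure Shimura data is a homomorphism $f:G\to G'$ of $\mathbb{Q}$-groups such that $f_{\mathbb{R}}\circ h\in X'$ for all $h\in X$. For $h\in X$ let $\mu_h:\mathbb{G}_{m,\mathbb{C}}\to G_{\mathbb{C}}$, $t\mapsto h_{\mathbb{C}}(t,1)$, where $\mathbb{S}_{\mathbb{C}}=\mathbb{G}_m\times\mathbb{G}_m$ via $z\mapsto(z,\bar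 z)$. The reflex field $E(G,X)\subset\mathbb{C}$ is the field of definition of the $G(\mathbb{C})$-conjugacy class of $\mu_h$, i.e. the fixed field of the stabilizer of this class in $\mathrm{Aut}(\mathbb{C}/\mathbb{Q})$, acting on $\mathrm{Hom}(\mathbb{G}_{m,\mathbb{C}},G_{\mathbb{C}})$; it does not depend on $h\in X$. Let $f:(G,X)\to(G',X')$ be a morphism of pure Shimura data such that the image $f(G)$ is normal in $G'$, and such that the neutral components of $\mathrm{Ker}(f)$ and of $\mathrm{Cok}(f)=G'/f(G)$ are split $\mathbb{Q}$-tori (possibly trivial). Then $E(G,X)=E(G',X')$. -/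

import Mathlib

open scoped TensorProduct LaurentPolynomial
open WithConv
universe u u' v

noncomputable section

/-! ### The Deligne torus -/

/-- The coordinate ring `ℝ[x, y, d] / ((x² + y²) d - 1)` of the Deligne torus `𝕊 = Res_{ℂ/ℝ} 𝔾ₘ`;
the point `(x, y, d)` of `𝕊(R)` corresponds to the unit `x + iy` of `ℂ ⊗ R`, of norm `d⁻¹`. -/
def DeligneTorus : Type :=
  MvPolynomial (Fin 3) ℝ ⧸ Ideal.span
    {((MvPolynomial.X 0 ^ 2 + MvPolynomial.X 1 ^ 2) * MvPolynomial.X 2 - 1 :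
      MvPolynomial (Fin 3) ℝ)}

namespace DeligneTorus

instance : CommRing DeligneTorus := inferInstanceAs (CommRing (MvPolynomial (Fin 3) ℝ ⧸ _))
instance : Algebra ℝ DeligneTorus := inferInstanceAs (Algebra ℝ (MvPolynomial (Fin 3) ℝ ⧸ _))

/-- The quotient map. -/
def mk : MvPolynomial (Fin 3) ℝ →ₐ[ℝ] DeligneTorus := Ideal.Quotient.mkₐ ℝ _

/-- The coordinate functions `x`, `y` and `d = 1 / (x² + y²)`. -/
def x : DeligneTorus := mk (MvPolynomial.X 0)
def y : DeligneTorus := mk (MvPolynomial.X 1)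
def d : DeligneTorus := mk (MvPolynomial.X 2)

theorem rel : (x ^ 2 + y ^ 2) * d = 1 := by
  have h : mk ((MvPolynomial.X 0 ^ 2 + MvPolynomial.X 1 ^ 2) * MvPolynomial.X 2 - 1) = 0 :=
    Ideal.Quotient.eq_zero_iff_mem.mpr (Ideal.subset_span rfl)
  simpa [x, y, d, sub_eq_zero] using h

/-- The point `(a, b, c)` of `𝕊(R)`. -/
def lift {R : Type*} [CommRing R] [Algebra ℝ R] (a b c : R) (h : (a ^ 2 + b ^ 2) * c = 1) :
    DeligneTorus →ₐ[ℝ] R :=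
  Ideal.Quotient.liftₐ _ (MvPolynomial.aeval ![a, b, c]) (by
    intro p hp
    have : Ideal.span {((MvPolynomial.X 0 ^ 2 + MvPolynomial.X 1 ^ 2) * MvPolynomial.X 2 - 1 :
      MvPolynomial (Fin 3) ℝ)} ≤ RingHom.ker (MvPolynomial.aeval (R := ℝ) ![a, b, c]) := by
      rw [Ideal.span_le, Set.singleton_subset_iff]
      simp [RingHom.mem_ker, h]
    exact this hp)

section
variable {R : Type*} [CommRing R] [Algebra ℝ R] (a b c : R) (h : (a ^ 2 + b ^ 2) * c = 1)
@[simp] theorem lift_x : lift a b c h x = a := by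
  change MvPolynomial.aeval (R := ℝ) ![a, b, c] (MvPolynomial.X 0) = a
  simp
@[simp] theorem lift_y : lift a b c h y = b := by
  change MvPolynomial.aeval (R := ℝ) ![a, b, c] (MvPolynomial.X 1) = b
  simp
@[simp] theorem lift_d : lift a b c h d = c := by
  change MvPolynomial.aeval (R := ℝ) ![a, b, c] (MvPolynomial.X 2) = c
  simp
end

@[ext] theorem algHom_ext {R : Type*} [CommRing R] [Algebra ℝ R] {f g : DeligneTorus →ₐ[ℝ] R}
    (hx : f x = g x) (hy : f y = g y) : f = g := by
  have hd : f d = g d := by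
    have hf : (f x ^ 2 + f y ^ 2) * f d = 1 := by simpa using congrArg f rel
    have hg : (f x ^ 2 + f y ^ 2) * g d = 1 := by
      rw [hx, hy]; simpa using congrArg g rel
    calc f d = f d * ((f x ^ 2 + f y ^ 2) * g d) := by rw [hg, mul_one]
      _ = ((f x ^ 2 + f y ^ 2) * f d) * g d := by ring
      _ = g d := by rw [hf, one_mul]
  have h : f.comp mk = g.comp mk := by
    apply MvPolynomial.algHom_ext
    intro i
    fin_cases i
    · exact hx
    · exact hy
    · exact hd
  apply AlgHom.ext
  intro p
  obtain ⟨q, rfl⟩ : ∃ q, mk q = p := Ideal.Quotient.mk_surjective p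
  exact DFunLike.congr_fun h q

/-- `(x + iy)(x' + iy') = (xx' - yy') + i(xy' + yx')`. -/
def comulHom : DeligneTorus →ₐ[ℝ] DeligneTorus ⊗[ℝ] DeligneTorus :=
  lift (x ⊗ₜ x - y ⊗ₜ y) (x ⊗ₜ y + y ⊗ₜ x) (d ⊗ₜ d) (by
    have h : ((x ^ 2 + y ^ 2) * d) ⊗ₜ[ℝ] ((x ^ 2 + y ^ 2) * d) = 1 := by rw [rel]; rfl
    have e (a b : DeligneTorus) : a ⊗ₜ[ℝ] b = Algebra.TensorProduct.includeLeft (S := ℝ) a *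
      Algebra.TensorProduct.includeRight b := by simp
    simp only [e, map_mul, map_add, map_pow] at h ⊢
    linear_combination h)

/-- The identity is `1 = 1 + 0 i`. -/
def counitHom : DeligneTorus →ₐ[ℝ] ℝ := lift 1 0 1 (by norm_num)

/-- `(x + iy)⁻¹ = (x - iy) d`. -/
def antipodeHom : DeligneTorus →ₐ[ℝ] DeligneTorus :=
  lift (x * d) (-(y * d)) (x ^ 2 + y ^ 2) (by
    have h := rel
    linear_combination ((x ^ 2 + y ^ 2) * d + 1) * h)

instance : Bialgebra ℝ DeligneTorus :=
  Bialgebra.ofAlgHom comulHom counitHom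
    (by
      ext <;> simp [comulHom, TensorProduct.tmul_sub, TensorProduct.sub_tmul,
        TensorProduct.tmul_add, TensorProduct.add_tmul] <;> abel)
    (by ext <;> simp [comulHom, counitHom])
    (by ext <;> simp [comulHom, counitHom])

instance : HopfAlgebra ℝ DeligneTorus :=
  HopfAlgebra.ofAlgHom antipodeHom
    (by
      have h := rel
      ext <;> simp only [AlgHom.comp_apply, Bialgebra.comulAlgHom_apply]
      · change Algebra.TensorProduct.lift _ _ _ (comulHom x) = algebraMap ℝ DeligneTorus (counitHom x)
        simp [comulHom, counitHom, antipodeHom]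
        linear_combination h
      · change Algebra.TensorProduct.lift _ _ _ (comulHom y) = algebraMap ℝ DeligneTorus (counitHom y)
        simp [comulHom, counitHom, antipodeHom]
        ring)
    (by
      have h := rel
      ext <;> simp only [AlgHom.comp_apply, Bialgebra.comulAlgHom_apply]
      · change Algebra.TensorProduct.lift _ _ _ (comulHom x) = algebraMap ℝ DeligneTorus (counitHom x)
        simp [comulHom, counitHom, antipodeHom]
        linear_combination h
      · change Algebra.TensorProduct.lift _ _ _ (comulHom y) = algebraMap ℝ DeligneTorus (counitHom y)
        simp [comulHom, counitHom, antipodeHom]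
        ring)

instance : Algebra ℚ DeligneTorus := inferInstanceAs (Algebra ℚ (MvPolynomial (Fin 3) ℝ ⧸ _))
instance : IsScalarTower ℚ ℝ DeligneTorus :=
  inferInstanceAs (IsScalarTower ℚ ℝ (MvPolynomial (Fin 3) ℝ ⧸ _))
end DeligneTorus

/-! ### Affine group schemes as commutative Hopf algebras

An affine group scheme `G` over a field `k` is represented by its commutative Hopf algebra
`A = 𝒪(G)`. Homomorphisms `G → G'` are the bialgebra homomorphisms `𝒪(G') → 𝒪(G)`, closed subgroup
schemes are the Hopf ideals of `A`, and `K ⊗[k] A` represents the base change `G_K`. -/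

/-- The group `G(R)` of `R`-points of `G`; the group law is convolution. -/
abbrev Points (k A R : Type*) [Field k] [CommRing A] [HopfAlgebra k A] [CommRing R]
    [Algebra k R] : Type _ :=
  WithConv (A →ₐ[k] R)

instance Points.instGroup {k A R : Type*} [Field k] [CommRing A] [HopfAlgebra k A] [CommRing R]
    [Algebra k R] : Group (Points k A R) where
  inv g := toConv (g.ofConv.comp (HopfAlgebra.antipodeAlgHom k A))
  inv_mul_cancel g := by
    have h := AlgHom.comp_convMul_distrib g.ofConv
      (toConv (HopfAlgebra.antipodeAlgHom k A)) (toConv (AlgHom.id k A))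
    rw [AlgHom.antipode_id_cancel] at h
    apply WithConv.ofConv_injective
    refine Eq.trans h.symm ?_
    apply AlgHom.ext
    intro a
    exact g.ofConv.commutes _

/-- The map `G(R) → G(S)` induced by a homomorphism of `k`-algebras `R → S`. -/
def Points.map {k A R S : Type*} [Field k] [CommRing A] [HopfAlgebra k A] [CommRing R]
    [Algebra k R] [CommRing S] [Algebra k S] (φ : R →ₐ[k] S) (g : Points k A R) :
    Points k A S :=
  toConv (φ.comp g.ofConv)

section Groups

variable (k : Type v) [Field k]

/-- The closed subscheme of `G` given by the ideal `I` is stable under conjugation by `G`: for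
every `k`-algebra `R`, every `g ∈ G(R)` and every `n ∈ G(R)` which factors through `I`, also
`g n g⁻¹` factors through `I`. -/
def IsNormalIdeal {A : Type u} [CommRing A] [HopfAlgebra k A] (I : Ideal A) : Prop :=
  ∀ (R : Type u) [CommRing R] [Algebra k R] (g n : Points k A R),
    (∀ a ∈ I, n a = 0) → ∀ a ∈ I, (g * n * g⁻¹) a = 0

/-- `H = Spec B` is unipotent: for some `n` it is isomorphic to a closed subgroup of the group
of upper unitriangular `n × n` matrices; the entries of `a` are the matrix coefficients. -/
def IsUnipotentGroup (B : Type*) [CommRing B] [HopfAlgebra k B] : Prop :=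
  ∃ (n : ℕ) (a : Matrix (Fin n) (Fin n) B),
    (∀ i j, Coalgebra.comul (R := k) (a i j) = ∑ l, a i l ⊗ₜ[k] a l j) ∧
    (∀ i j, Coalgebra.counit (R := k) (a i j) = if i = j then 1 else 0) ∧
    (∀ i, a i i = 1) ∧ (∀ i j, j < i → a i j = 0) ∧
    Algebra.adjoin k (Set.range fun p : Fin n × Fin n => a p.1 p.2) = ⊤

/-- `G = Spec A` is a (connected) reductive algebraic group over `k`: it is smooth (in particular
of finite type), affine, connected, and over an algebraic closure of `k` every smooth connected
unipotent normal closed subgroup is trivial. -/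
structure IsReductiveGroup (A : Type u) [CommRing A] [HopfAlgebra k A] : Prop where
  smooth : Algebra.Smooth k A
  connected : ConnectedSpace (PrimeSpectrum A)
  unipotentRadical_trivial : ∀ (I : Ideal (AlgebraicClosure k ⊗[k] A))
    [I.IsHopfIdeal (AlgebraicClosure k)],
    IsNormalIdeal (AlgebraicClosure k) I →
    Algebra.Smooth (AlgebraicClosure k) ((AlgebraicClosure k ⊗[k] A) ⧸ I) →
    ConnectedSpace (PrimeSpectrum ((AlgebraicClosure k ⊗[k] A) ⧸ I)) →
    IsUnipotentGroup (AlgebraicClosure k) ((AlgebraicClosure k ⊗[k] A) ⧸ I) →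
    I = RingHom.ker (Bialgebra.counitAlgHom (AlgebraicClosure k) (AlgebraicClosure k ⊗[k] A))

/-- The ideal of the neutral component `H°` of `H = Spec B`, the connected component of the
identity: it is generated by the idempotents of `B` which vanish at the identity. -/
def neutralIdeal (B : Type*) [CommRing B] [HopfAlgebra k B] : Ideal B :=
  Ideal.span {e | IsIdempotentElem e ∧ Coalgebra.counit (R := k) e = 0}

/-- The neutral component of `H = Spec B` is a split `k`-torus: there is a closed immersion of
groups `𝔾ₘⁿ → H`, where `𝒪(𝔾ₘⁿ) = k[ℤⁿ]`, whose image is `H°`. -/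
def NeutralComponentIsSplitTorus (B : Type*) [CommRing B] [HopfAlgebra k B] : Prop :=
  ∃ (n : ℕ) (φ : B →ₐc[k] AddMonoidAlgebra k (Fin n → ℤ)),
    Function.Surjective φ ∧ RingHom.ker φ = neutralIdeal k B

variable {k}
variable {A : Type u} {A' : Type u'} [CommRing A] [HopfAlgebra k A] [CommRing A']
  [HopfAlgebra k A']

/-- The ideal of `Ker f` for the homomorphism `f : G = Spec A → G' = Spec A'`: it is generated by
the image of the augmentation ideal of `A'`. -/
def kerIdeal (f : A' →ₐc[k] A) : Ideal A :=
  (RingHom.ker (Bialgebra.counitAlgHom k A')).map f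

theorem mk_kerIdeal (f : A' →ₐc[k] A) (a : A') :
    Ideal.Quotient.mk (kerIdeal f) (f a) =
      algebraMap k (A ⧸ kerIdeal f) (Coalgebra.counit (R := k) a) := by
  rw [← sub_eq_zero, IsScalarTower.algebraMap_apply k A (A ⧸ kerIdeal f),
    Ideal.Quotient.algebraMap_eq, ← map_sub, Ideal.Quotient.eq_zero_iff_mem]
  have h : a - algebraMap k A' (Coalgebra.counit (R := k) a) ∈
      RingHom.ker (Bialgebra.counitAlgHom k A') := by
    simp [RingHom.mem_ker]
  have h2 := Ideal.mem_map_of_mem f h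
  rwa [map_sub, show f (algebraMap k A' _) = _ from AlgHomClass.commutes f _] at h2

theorem antipode_bialgHom (f : A' →ₐc[k] A) (a : A') :
    HopfAlgebra.antipode k (f a) = f (HopfAlgebra.antipode k a) := by
  have h := AlgHom.convMul_comp_bialgHom_distrib (toConv (HopfAlgebra.antipodeAlgHom k A))
    (toConv (AlgHom.id k A)) f
  rw [AlgHom.antipode_id_cancel] at h
  have h1 : (toConv ((HopfAlgebra.antipodeAlgHom k A).comp (f : A' →ₐ[k] A)) : Points k A' A) *
      toConv (f : A' →ₐ[k] A) = 1 := by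
    apply WithConv.ofConv_injective
    refine Eq.trans h.symm ?_
    apply AlgHom.ext
    intro b
    simp
  have h2 := eq_inv_of_mul_eq_one_left h1
  exact DFunLike.congr_fun (congrArg WithConv.ofConv h2) a

instance kerIdeal.instIsHopfIdeal (f : A' →ₐc[k] A) : (kerIdeal f).IsHopfIdeal k where
  counit_eq_zero := by
    have h : kerIdeal f ≤ RingHom.ker (Bialgebra.counitAlgHom k A) := by
      rw [kerIdeal, Ideal.map_le_iff_le_comap]
      intro a ha
      simpa [RingHom.mem_ker] using! ha
    intro x hx
    exact h hx
  map_mkQ_comul_eq_zero := by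
    let φ : A →ₐ[k] (A ⧸ kerIdeal f) ⊗[k] (A ⧸ kerIdeal f) :=
      (Algebra.TensorProduct.map (Ideal.Quotient.mkₐ k _) (Ideal.Quotient.mkₐ k _)).comp
        (Bialgebra.comulAlgHom k A)
    have hφ : φ.comp (f : A' →ₐ[k] A) = (Algebra.ofId k _).comp (Bialgebra.counitAlgHom k A') := by
      have h1 : φ.comp (f : A' →ₐ[k] A) = (Algebra.TensorProduct.map
          ((Ideal.Quotient.mkₐ k (kerIdeal f)).comp (f : A' →ₐ[k] A))
          ((Ideal.Quotient.mkₐ k (kerIdeal f)).comp (f : A' →ₐ[k] A))).comp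
            (Bialgebra.comulAlgHom k A') := by
        rw [Algebra.TensorProduct.map_comp, AlgHom.comp_assoc]
        exact congrArg (AlgHom.comp _) (BialgHomClass.map_comp_comulAlgHom f).symm
      have h2 : (Ideal.Quotient.mkₐ k (kerIdeal f)).comp (f : A' →ₐ[k] A) =
          (Algebra.ofId k _).comp (Bialgebra.counitAlgHom k A') :=
        AlgHom.ext (mk_kerIdeal f)
      rw [h1, h2, Algebra.TensorProduct.map_comp, AlgHom.comp_assoc]
      have h3 : (Algebra.TensorProduct.map (Bialgebra.counitAlgHom k A')
          (Bialgebra.counitAlgHom k A')).comp (Bialgebra.comulAlgHom k A') =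
          (Algebra.ofId k _).comp (Bialgebra.counitAlgHom k A') := by
        refine (BialgHomClass.map_comp_comulAlgHom (Bialgebra.counitBialgHom k A')).trans ?_
        exact congrArg (AlgHom.comp · (Bialgebra.counitAlgHom k A'))
          (AlgHom.ext fun r => (Bialgebra.comulAlgHom k k).commutes r)
      rw [h3, ← AlgHom.comp_assoc]
      congr 1
      ext
    have h : kerIdeal f ≤ RingHom.ker φ := by
      refine Ideal.map_le_iff_le_comap.mpr ?_
      intro a ha
      have := DFunLike.congr_fun hφ a
      have ha : Coalgebra.counit (R := k) a = 0 := ha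
      simpa [ha, RingHom.mem_ker] using! this
    intro x hx
    exact h hx
  antipode_mem := by
    have h : kerIdeal f ≤ (kerIdeal f).comap (HopfAlgebra.antipodeAlgHom k A) := by
      refine Ideal.map_le_iff_le_comap.mpr ?_
      intro a ha
      have ha : Coalgebra.counit (R := k) a = 0 := ha
      rw [Ideal.mem_comap, Ideal.mem_comap, HopfAlgebra.antipodeAlgHom_apply, antipode_bialgHom]
      refine Ideal.mem_map_of_mem f ?_
      simp [ha]
    intro x hx
    exact h hx

/-- The functions `a` on `G'` with `a (g' · f g) = a g'`. -/
def coinvariants (f : A' →ₐc[k] A) : Subalgebra k A' :=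
  AlgHom.equalizer
    ((Algebra.TensorProduct.map (AlgHom.id k A') (f : A' →ₐ[k] A)).comp
      (Bialgebra.comulAlgHom k A'))
    Algebra.TensorProduct.includeLeft

/-- `q : G' → Spec C` is the cokernel `G' → G' / f(G)` of `f : G → G'` (where `f(G)` is normal in
`G'`): it identifies `C` with the ring of the functions on `G'` that are invariant under `f(G)`. -/
def IsCokernel (f : A' →ₐc[k] A) {C : Type*} [CommRing C] [HopfAlgebra k C] (q : C →ₐc[k] A') :
    Prop :=
  Function.Injective q ∧ (q : C →ₐ[k] A').range = coinvariants f

/-- The neutral component of `Cok f = G' / f(G)` is a split `k`-torus. -/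
def CokernelIsSplitTorus (f : A' →ₐc[k] A) : Prop :=
  ∃ (C : Type u') (_ : CommRing C) (_ : HopfAlgebra k C) (q : C →ₐc[k] A'),
    IsCokernel f q ∧ NeutralComponentIsSplitTorus k C

end Groups

/-! ### Homomorphisms into a base change, up to conjugation -/

section Conjugation

variable {A : Type*} [CommRing A] [HopfAlgebra ℚ A]
variable {K B : Type*} [Field K] [Algebra ℚ K] [CommRing B] [HopfAlgebra K B] [Algebra ℚ B]
  [IsScalarTower ℚ K B]

/-- A homomorphism of `K`-groups `H = Spec B → G_K`, viewed as a point of `G(B)`. -/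
def universalPoint (φ : K ⊗[ℚ] A →ₐc[K] B) : Points ℚ A B :=
  toConv (((φ : K ⊗[ℚ] A →ₐ[K] B).restrictScalars ℚ).comp Algebra.TensorProduct.includeRight)

theorem counit_universalPoint (φ : K ⊗[ℚ] A →ₐc[K] B) (a : A) :
    Coalgebra.counit (R := K) (universalPoint φ a) = algebraMap ℚ K (Coalgebra.counit a) := by
  have h := DFunLike.congr_fun (BialgHomClass.counitAlgHom_comp φ) (1 ⊗ₜ a)
  refine h.trans ?_
  simp only [Bialgebra.counitAlgHom_apply, TensorProduct.counit_tmul]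
  simp [← Algebra.algebraMap_eq_smul_one]

theorem comul_universalPoint (φ : K ⊗[ℚ] A →ₐc[K] B) (a : A) :
    Coalgebra.comul (R := K) (universalPoint φ a) =
      Algebra.TensorProduct.productMap
        ((Algebra.TensorProduct.includeLeft (R := K) (S := ℚ) (B := B)).comp
          (universalPoint φ).ofConv)
        (((Algebra.TensorProduct.includeRight (R := K) (A := B)).restrictScalars ℚ).comp
          (universalPoint φ).ofConv)
        (Coalgebra.comul (R := ℚ) a) := by
  have h := DFunLike.congr_fun (BialgHomClass.map_comp_comulAlgHom φ) (1 ⊗ₜ a)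
  refine h.symm.trans ?_
  have h := (Coalgebra.Repr.arbitrary ℚ a).eq
  simp [← h, TensorProduct.tmul_sum, -BialgHomClass.map_comp_comulAlgHom,
    -CoalgHomClass.map_comp_comul_apply]
  rfl

/-- `ψ = g φ g⁻¹`, for homomorphisms of `K`-groups `φ, ψ : H → G_K` and `g ∈ G(K)`. -/
def IsConjugateBy (g : Points ℚ A K) (φ ψ : K ⊗[ℚ] A →ₐc[K] B) : Prop :=
  universalPoint ψ =
    Points.map (IsScalarTower.toAlgHom ℚ K B) g * universalPoint φ *
      (Points.map (IsScalarTower.toAlgHom ℚ K B) g)⁻¹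

end Conjugation

/-! ### Cocharacters and the action of `Aut(ℂ)` -/

section Cocharacters

variable (A : Type u) [CommRing A] [HopfAlgebra ℚ A]

/-- `X^∨_G(ℂ)`: the homomorphisms `𝔾ₘ → G` over `ℂ`, where `𝒪(𝔾ₘ) = ℂ[T;T⁻¹]`. -/
def Cocharacter : Type u := ℂ ⊗[ℚ] A →ₐc[ℂ] ℂ[T;T⁻¹]

variable {A}

/-- The point of `G(ℂ[T;T⁻¹])` defined by a cocharacter. -/
def Cocharacter.point (μ : Cocharacter A) : Points ℚ A ℂ[T;T⁻¹] :=
  universalPoint (K := ℂ) μ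

theorem Cocharacter.ext {μ ν : Cocharacter A} (h : μ.point = ν.point) : μ = ν := by
  apply BialgHom.coe_toAlgHom_injective
  apply Algebra.TensorProduct.ext
  · ext
  · apply AlgHom.ext
    intro a
    exact DFunLike.congr_fun (congrArg WithConv.ofConv h) a

/-- A point `m` of `G` over `ℂ[T;T⁻¹]` that is compatible with counits and comultiplications
defines a cocharacter over `ℂ`. -/
def Cocharacter.ofPoint (m : A →ₐ[ℚ] ℂ[T;T⁻¹])
    (h₁ : ∀ a, Coalgebra.counit (R := ℂ) (m a) = algebraMap ℚ ℂ (Coalgebra.counit a))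
    (h₂ : ∀ a, Coalgebra.comul (R := ℂ) (m a) =
      Algebra.TensorProduct.productMap
        ((Algebra.TensorProduct.includeLeft (R := ℂ) (S := ℚ) (B := ℂ[T;T⁻¹])).comp m)
        (((Algebra.TensorProduct.includeRight (R := ℂ) (A := ℂ[T;T⁻¹])).restrictScalars ℚ).comp m)
        (Coalgebra.comul (R := ℚ) a)) :
    Cocharacter A :=
  BialgHom.ofAlgHom
    (Algebra.TensorProduct.lift (Algebra.ofId ℂ ℂ[T;T⁻¹]) m fun _ _ => Commute.all _ _)
    (by
      ext a
      simp [h₁])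
    (by
      ext a
      simp only [AlgHom.comp_apply, AlgHom.restrictScalars_apply, Bialgebra.comulAlgHom_apply,
        Algebra.TensorProduct.includeRight_apply, Algebra.TensorProduct.lift_tmul, map_one, one_mul,
        h₂]
      have h := (Coalgebra.Repr.arbitrary ℚ a).eq
      simp [← h, TensorProduct.tmul_sum])

theorem Cocharacter.point_ofPoint (m : A →ₐ[ℚ] ℂ[T;T⁻¹]) (h₁) (h₂) :
    (Cocharacter.ofPoint m h₁ h₂).point = toConv m := by
  apply WithConv.ofConv_injective
  apply AlgHom.ext
  intro a
  change Algebra.TensorProduct.lift (Algebra.ofId ℂ ℂ[T;T⁻¹]) m (fun _ _ => Commute.all _ _)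
    (1 ⊗ₜ a) = m a
  simp

theorem Cocharacter.counit_point (μ : Cocharacter A) (a : A) :
    Coalgebra.counit (R := ℂ) (μ.point a) = algebraMap ℚ ℂ (Coalgebra.counit a) :=
  counit_universalPoint (K := ℂ) μ a

theorem Cocharacter.comul_point (μ : Cocharacter A) (a : A) :
    Coalgebra.comul (R := ℂ) (μ.point a) =
      Algebra.TensorProduct.productMap
        ((Algebra.TensorProduct.includeLeft (R := ℂ) (S := ℚ) (B := ℂ[T;T⁻¹])).comp μ.point.ofConv)
        (((Algebra.TensorProduct.includeRight (R := ℂ) (A := ℂ[T;T⁻¹])).restrictScalars ℚ).comp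
          μ.point.ofConv)
        (Coalgebra.comul (R := ℚ) a) :=
  comul_universalPoint (K := ℂ) μ a

/-- The `ℚ`-algebra automorphism of `ℂ[T;T⁻¹]` given by applying `σ` to all coefficients. -/
def laurentMap (σ : ℂ ≃ₐ[ℚ] ℂ) : ℂ[T;T⁻¹] →ₐ[ℚ] ℂ[T;T⁻¹] :=
  AddMonoidAlgebra.mapAlgHom ℤ (σ : ℂ →ₐ[ℚ] ℂ)

@[simp] theorem laurentMap_C (σ : ℂ ≃ₐ[ℚ] ℂ) (c : ℂ) :
    laurentMap σ (LaurentPolynomial.C c) = LaurentPolynomial.C (σ c) :=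
  AddMonoidAlgebra.mapAlgHom_single _ _ _

@[simp] theorem laurentMap_T (σ : ℂ ≃ₐ[ℚ] ℂ) (n : ℤ) :
    laurentMap σ (LaurentPolynomial.T n) = LaurentPolynomial.T n :=
  (AddMonoidAlgebra.mapAlgHom_single _ _ _).trans (by rw [AlgEquiv.coe_toAlgHom, map_one]; rfl)

/-- `σ ∈ Aut(ℂ)` acts on the cocharacters over `ℂ` of the `ℚ`-group `G`: it acts on the
coefficients. Equivalently `σ • μ = σ ∘ μ ∘ σ⁻¹`. -/
instance : SMul (ℂ ≃ₐ[ℚ] ℂ) (Cocharacter A) where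
  smul σ μ := Cocharacter.ofPoint ((laurentMap σ).comp μ.point.ofConv)
    (by
      have h (l : ℂ[T;T⁻¹]) : Coalgebra.counit (R := ℂ) (laurentMap σ l) =
          σ (Coalgebra.counit (R := ℂ) l) := by
        induction l using LaurentPolynomial.induction_on' with
        | add p q hp hq => simp only [map_add, hp, hq]
        | C_mul_T n c =>
          simp
      intro a
      refine (h _).trans ?_
      refine (congrArg σ (Cocharacter.counit_point μ a)).trans ?_
      simp)
    (by
      let s : ℂ[T;T⁻¹] ⊗[ℂ] ℂ[T;T⁻¹] →+* ℂ[T;T⁻¹] ⊗[ℂ] ℂ[T;T⁻¹] :=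
        Algebra.TensorProduct.mapRingHom (σ : ℂ →+* ℂ) (laurentMap σ : ℂ[T;T⁻¹] →+* ℂ[T;T⁻¹])
          (laurentMap σ : ℂ[T;T⁻¹] →+* ℂ[T;T⁻¹])
          (by ext; simp [laurentMap]) (by ext; simp [laurentMap])
      have h (l : ℂ[T;T⁻¹]) : Coalgebra.comul (R := ℂ) (laurentMap σ l) =
          s (Coalgebra.comul (R := ℂ) l) := by
        induction l using LaurentPolynomial.induction_on' with
        | add p q hp hq => simp only [map_add, hp, hq]
        | C_mul_T n c =>
          simp [s]
      intro a
      refine (h _).trans ?_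
      refine (congrArg s (Cocharacter.comul_point μ a)).trans ?_
      have h := (Coalgebra.Repr.arbitrary ℚ a).eq
      simp [← h, s])

theorem Cocharacter.point_smul (σ : ℂ ≃ₐ[ℚ] ℂ) (μ : Cocharacter A) :
    (σ • μ).point = Points.map (laurentMap σ) μ.point :=
  Cocharacter.point_ofPoint _ _ _

instance : MulAction (ℂ ≃ₐ[ℚ] ℂ) (Cocharacter A) where
  one_smul μ := by
    apply Cocharacter.ext
    rw [Cocharacter.point_smul]
    have h : laurentMap 1 = AlgHom.id ℚ _ := by
      ext <;> simp [laurentMap]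
    rw [h]
    rfl
  mul_smul σ τ μ := by
    apply Cocharacter.ext
    simp only [Cocharacter.point_smul]
    have h : laurentMap (σ * τ) = (laurentMap σ).comp (laurentMap τ) := by
      ext <;> simp [laurentMap]
    rw [h]
    rfl

end Cocharacters

/-! ### Shimura data -/

namespace DeligneTorus

/-- The point of `𝕊(ℂ)` defined by `z ∈ ℂˣ = 𝕊(ℝ)`. -/
def realPoint (z : ℂˣ) : DeligneTorus →ₐ[ℝ] ℂ :=
  lift ((z : ℂ).re : ℂ) ((z : ℂ).im : ℂ) ((Complex.normSq z : ℂ)⁻¹) (by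
    have h : Complex.normSq z ≠ 0 := by simp
    rw [Complex.normSq_apply] at *
    have h' : (((z : ℂ).re * (z : ℂ).re + (z : ℂ).im * (z : ℂ).im : ℝ) : ℂ) ≠ 0 :=
      Complex.ofReal_ne_zero.mpr h
    push_cast at h' ⊢
    rw [sq, sq]
    exact mul_inv_cancel₀ h')

/-- The comorphism of the cocharacter `t ↦ (t, 1)` of `𝕊_ℂ = 𝔾ₘ × 𝔾ₘ`, where the first coordinate
of `𝕊_ℂ` is `z = x + iy` and the second one is `z̄ = x - iy`. It sends `z` to `T` and `z̄` to `1`. -/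
def firstCocharacter : DeligneTorus →ₐ[ℝ] ℂ[T;T⁻¹] :=
  lift ((1 / 2 : ℂ) • (LaurentPolynomial.T 1 + 1))
    ((1 / (2 * Complex.I) : ℂ) • (LaurentPolynomial.T 1 - 1))
    (LaurentPolynomial.T (-1)) (by
      have h1 : (LaurentPolynomial.T 1 : ℂ[T;T⁻¹]) * LaurentPolynomial.T (-1) = 1 := by
        rw [← LaurentPolynomial.T_add]; simp
      have h2 : (1 / 2 : ℂ) ^ 2 = 1 / 4 := by norm_num
      have h3 : (1 / (2 * Complex.I) : ℂ) ^ 2 = - (1 / 4) := by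
        rw [div_pow, mul_pow, Complex.I_sq]; norm_num
      have h4 : ((LaurentPolynomial.T 1 + 1 : ℂ[T;T⁻¹]) ^ 2 - (LaurentPolynomial.T 1 - 1) ^ 2) =
          (4 : ℂ) • LaurentPolynomial.T 1 := by
        rw [LaurentPolynomial.smul_eq_C_mul, map_ofNat]; ring
      rw [smul_pow, smul_pow, h2, h3, neg_smul, ← sub_eq_add_neg, ← smul_sub, h4, smul_smul,
        show (1 / 4 : ℂ) * 4 = 1 by norm_num, one_smul, h1])

theorem counit_firstCocharacter (s : DeligneTorus) :
    Coalgebra.counit (R := ℂ) (firstCocharacter s) =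
      algebraMap ℝ ℂ (Coalgebra.counit (R := ℝ) s) := by
  have h : ((Bialgebra.counitAlgHom ℂ ℂ[T;T⁻¹]).restrictScalars ℝ).comp firstCocharacter =
      (Algebra.ofId ℝ ℂ).comp counitHom := by
    ext
    · simp [firstCocharacter, counitHom]
      norm_num
    · simp [firstCocharacter, counitHom]
  exact DFunLike.congr_fun h s

theorem comul_firstCocharacter (s : DeligneTorus) :
    Coalgebra.comul (R := ℂ) (firstCocharacter s) =
      Algebra.TensorProduct.productMap
        ((Algebra.TensorProduct.includeLeft (R := ℂ) (S := ℝ) (B := ℂ[T;T⁻¹])).comp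
          firstCocharacter)
        (((Algebra.TensorProduct.includeRight (R := ℂ) (A := ℂ[T;T⁻¹])).restrictScalars ℝ).comp
          firstCocharacter) (Coalgebra.comul (R := ℝ) s) := by
  have h : ((Bialgebra.comulAlgHom ℂ ℂ[T;T⁻¹]).restrictScalars ℝ).comp firstCocharacter =
      (Algebra.TensorProduct.productMap
        ((Algebra.TensorProduct.includeLeft (R := ℂ) (S := ℝ) (B := ℂ[T;T⁻¹])).comp
          firstCocharacter)
        (((Algebra.TensorProduct.includeRight (R := ℂ) (A := ℂ[T;T⁻¹])).restrictScalars ℝ).comp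
          firstCocharacter)).comp comulHom := by
    ext
    · simp [firstCocharacter, comulHom]
      simp only [Algebra.TensorProduct.one_def, TensorProduct.tmul_add, TensorProduct.add_tmul,
        TensorProduct.tmul_sub, TensorProduct.sub_tmul, TensorProduct.tmul_neg,
        TensorProduct.neg_tmul, TensorProduct.tmul_smul, ← TensorProduct.smul_tmul']
      match_scalars <;>
        first
          | linear_combination (1 / 4) * Complex.I_sq
          | linear_combination (-1 / 4) * Complex.I_sq
    · simp [firstCocharacter, comulHom, -mul_inv_rev]
      simp only [Algebra.TensorProduct.one_def, TensorProduct.tmul_add, TensorProduct.add_tmul,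
        TensorProduct.tmul_sub, TensorProduct.sub_tmul,
        TensorProduct.tmul_smul, ← TensorProduct.smul_tmul']
      match_scalars <;> ring
  exact DFunLike.congr_fun h s

end DeligneTorus

/-- A subfield `E` of `ℂ` is the fixed field of `Aut(ℂ/E)`. -/
theorem fixedField_fixingSubgroup_complex (E : IntermediateField ℚ ℂ) :
    IntermediateField.fixedField E.fixingSubgroup = E := by
  refine le_antisymm (fun z hz => ?_) ((IntermediateField.le_iff_le _ _).mpr le_rfl)
  by_contra hzE
  suffices h : ∃ σ : ℂ ≃ₐ[E] ℂ, σ z ≠ z by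
    obtain ⟨σ, hσ⟩ := h
    refine hσ ?_
    have := (IntermediateField.mem_fixedField_iff _ _).mp hz (σ.restrictScalars ℚ) (by
      rw [IntermediateField.mem_fixingSubgroup_iff]
      intro x hx
      exact σ.commutes ⟨x, hx⟩)
    exact this
  by_cases hz : IsAlgebraic E z
  · let L := algebraicClosure E ℂ
    have : IsGalois E L := IsAlgClosure.isGalois E L
    obtain ⟨φ, hφ⟩ : ∃ φ : L ≃ₐ[E] L, φ ⟨z, hz.isIntegral⟩ ≠ ⟨z, hz.isIntegral⟩ := by
      by_contra! h
      have := (InfiniteGalois.mem_range_algebraMap_iff_fixed (k := E) (K := L)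
        ⟨z, hz.isIntegral⟩).mpr h
      obtain ⟨w, hw⟩ := this
      apply hzE
      have h2 : (w : ℂ) = z := congrArg (algebraMap L ℂ) hw
      rw [← h2]; exact w.2
    obtain ⟨s, hs⟩ := exists_isTranscendenceBasis L ℂ
    have hv : IsTranscendenceBasis L ((↑) : s → ℂ) := hs
    let := IsAlgClosed.isAlgClosure_of_transcendence_basis _ hv
    let e : Algebra.adjoin L (Set.range ((↑) : s → ℂ)) ≃+*
        Algebra.adjoin L (Set.range ((↑) : s → ℂ)) :=
      hv.1.aevalEquiv.symm.toRingEquiv.trans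
        ((MvPolynomial.mapEquiv s φ.toRingEquiv).trans hv.1.aevalEquiv.toRingEquiv)
    have he (l : L) : e (algebraMap L _ l) = algebraMap L _ (φ l) := by
      change hv.1.aevalEquiv (MvPolynomial.map (φ.toRingEquiv : L →+* L)
        (hv.1.aevalEquiv.symm (algebraMap L _ l))) = _
      rw [AlgEquiv.commutes, MvPolynomial.algebraMap_eq, MvPolynomial.map_C,
        ← MvPolynomial.algebraMap_eq, AlgEquiv.commutes]
      rfl
    let τ := IsAlgClosure.equivOfEquiv ℂ ℂ e
    have hτ (l : L) : τ l = φ l := by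
      have := IsAlgClosure.equivOfEquiv_algebraMap ℂ ℂ e (algebraMap L _ l)
      rw [he] at this
      exact this
    refine ⟨AlgEquiv.ofRingEquiv (f := τ) (fun x => ?_), fun h => hφ ?_⟩
    · have := hτ (algebraMap E L x)
      rw [φ.commutes] at this
      exact this
    · apply Subtype.ext
      rw [← hτ]
      exact h
  · have hz : AlgebraicIndepOn E id {z} :=
      (algebraicIndependent_singleton_iff (ι := ({z} : Set ℂ)) ⟨z, rfl⟩).mpr hz
    obtain ⟨s, hs, hv⟩ := exists_isTranscendenceBasis_superset hz
    have := IsAlgClosed.isAlgClosure_of_transcendence_basis _ hv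
    let m : MvPolynomial s E ≃ₐ[E] MvPolynomial s E :=
      AlgEquiv.ofAlgHom (MvPolynomial.aeval fun i => MvPolynomial.X i + 1)
        (MvPolynomial.aeval fun i => MvPolynomial.X i - 1) (by ext; simp) (by ext; simp)
    let e : Algebra.adjoin E (Set.range ((↑) : s → ℂ)) ≃ₐ[E]
        Algebra.adjoin E (Set.range ((↑) : s → ℂ)) :=
      hv.1.aevalEquiv.symm.trans (m.trans hv.1.aevalEquiv)
    let τ := IsAlgClosure.equivOfEquiv ℂ ℂ e.toRingEquiv
    have hτ (l) : τ (algebraMap _ ℂ l) = algebraMap _ ℂ (e l) :=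
      IsAlgClosure.equivOfEquiv_algebraMap ℂ ℂ e.toRingEquiv l
    refine ⟨AlgEquiv.ofRingEquiv (f := τ) (fun x => ?_), fun h => ?_⟩
    · have := hτ (algebraMap E _ x)
      rw [AlgEquiv.commutes] at this
      exact this
    · have h1 := hτ (hv.1.aevalEquiv (MvPolynomial.X ⟨z, hs rfl⟩))
      have h2 : e (hv.1.aevalEquiv (MvPolynomial.X ⟨z, hs rfl⟩)) =
          hv.1.aevalEquiv (MvPolynomial.X ⟨z, hs rfl⟩) + 1 := by
        simp [e, m]
      rw [h2, map_add, map_one] at h1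
      have h3 : algebraMap _ ℂ (hv.1.aevalEquiv (MvPolynomial.X ⟨z, hs rfl⟩)) = z := by
        simp
      rw [h3] at h1
      have h4 : τ z = z := h
      rw [h4] at h1
      simp at h1


section ShimuraData

open scoped Pointwise

/-- `𝔛(G)`: the homomorphisms `𝕊 → G_ℝ` of algebraic groups over `ℝ`. -/
abbrev RealHom (A : Type u) [CommRing A] [HopfAlgebra ℚ A] : Type u :=
  ℝ ⊗[ℚ] A →ₐc[ℝ] DeligneTorus

variable {A : Type u} [CommRing A] [HopfAlgebra ℚ A]

/-- `h(z) ∈ G(ℝ) ⊆ G(ℂ)` for `z ∈ ℂˣ = 𝕊(ℝ)`. -/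
def RealHom.value (h : RealHom A) (z : ℂˣ) : Points ℚ A ℂ :=
  Points.map ((DeligneTorus.realPoint z).restrictScalars ℚ) (universalPoint h)

/-- `μ_h : 𝔾ₘ → G_ℂ`, `t ↦ h_ℂ(t, 1)`. -/
def RealHom.cocharacter (h : RealHom A) : Cocharacter A :=
  Cocharacter.ofPoint
    ((DeligneTorus.firstCocharacter.restrictScalars ℚ).comp (universalPoint h).ofConv)
    (by
      intro a
      refine (DeligneTorus.counit_firstCocharacter _).trans ?_
      refine (congrArg (algebraMap ℝ ℂ) (counit_universalPoint h a)).trans ?_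
      simp)
    (by
      intro a
      refine (DeligneTorus.comul_firstCocharacter _).trans ?_
      refine (congrArg _ (comul_universalPoint h a)).trans ?_
      have h := (Coalgebra.Repr.arbitrary ℚ a).eq
      simp [← h])

variable (A) in
/-- `Lie(G_ℂ)`, as the point derivations `𝒪(G) → ℂ` at the identity. -/
def lieComplex : Submodule ℂ (A →ₗ[ℚ] ℂ) where
  carrier := {D | ∀ a b, D (a * b) =
    Coalgebra.counit (R := ℚ) a • D b + Coalgebra.counit (R := ℚ) b • D a}
  zero_mem' := by simp
  add_mem' := by
    intro D E hD hE a b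
    simp only [LinearMap.add_apply, hD a b, hE a b, smul_add]
    abel
  smul_mem' := by
    intro c D hD a b
    simp only [LinearMap.smul_apply, hD a b, smul_add, smul_comm c]

/-- The adjoint action of `g ∈ G(ℂ)`: `Ad(g) D = g D g⁻¹`, a product of linear forms on `𝒪(G)`
for the convolution. -/
def adjointAction (g : Points ℚ A ℂ) (D : A →ₗ[ℚ] ℂ) : A →ₗ[ℚ] ℂ :=
  (toConv g.ofConv.toLinearMap * toConv D * toConv (g⁻¹).ofConv.toLinearMap).ofConv

theorem adjointAction_add (g : Points ℚ A ℂ) (D E : A →ₗ[ℚ] ℂ) :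
    adjointAction g (D + E) = adjointAction g D + adjointAction g E := by
  simp only [adjointAction, toConv_add, mul_add, add_mul, ofConv_add]

theorem adjointAction_smul (g : Points ℚ A ℂ) (c : ℂ) (D : A →ₗ[ℚ] ℂ) :
    adjointAction g (c • D) = c • adjointAction g D := by
  simp only [adjointAction, toConv_smul, mul_smul_comm, smul_mul_assoc, ofConv_smul]

/-- The part of Hodge type `(p, q)` of `Lie(G_ℂ)` with respect to `h`: there `h(z)` acts as
multiplication by `z^(-p) z̄^(-q)`. -/
def RealHom.hodgePiece (h : RealHom A) (p q : ℤ) : Submodule ℂ (A →ₗ[ℚ] ℂ) where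
  carrier := {D | D ∈ lieComplex A ∧ ∀ z : ℂˣ, adjointAction (h.value z) D =
    ((z : ℂ) ^ (-p) * (starRingEnd ℂ (z : ℂ)) ^ (-q)) • D}
  zero_mem' := by
    refine ⟨zero_mem _, fun z => ?_⟩
    have := adjointAction_smul (h.value z) 0 0
    simpa using this
  add_mem' := by
    rintro D E ⟨hD, hD'⟩ ⟨hE, hE'⟩
    exact ⟨add_mem hD hE, fun z => by rw [adjointAction_add, hD', hE', smul_add]⟩
  smul_mem' := by
    rintro c D ⟨hD, hD'⟩
    exact ⟨Submodule.smul_mem _ c hD, fun z => by rw [adjointAction_smul, hD', smul_comm]⟩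

/-- The complex topology of `G(ℂ)`: the coarsest one for which all `a ∈ 𝒪(G)` are continuous. -/
@[reducible]
def complexTopology (A : Type u) [CommRing A] [HopfAlgebra ℚ A] :
    TopologicalSpace (Points ℚ A ℂ) :=
  TopologicalSpace.induced (fun g a => g a) (Pi.topologicalSpace (Y := fun _ : A => ℂ))

/-- `Int h(i)` is a Cartan involution `θ` of the adjoint group `G^ad = G / Z(G)` over `ℝ`: the
group of the fixed points of `q ↦ θ(q̄)` in `G^ad(ℂ) = G(ℂ) / Z(G(ℂ))` is compact. -/
def RealHom.IsCartan (h : RealHom A) : Prop :=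
  letI := complexTopology A
  letI hi : Points ℚ A ℂ := h.value (Units.mk0 Complex.I Complex.I_ne_zero)
  IsCompact {q : Points ℚ A ℂ ⧸ Subgroup.center (Points ℚ A ℂ) | ∃ g : Points ℚ A ℂ,
    (QuotientGroup.mk g = q) ∧
    QuotientGroup.mk (hi * Points.map (Complex.conjAe.toAlgHom.restrictScalars ℚ) g * hi⁻¹) = q}

/-- The composite of `h : 𝕊 → G_ℝ` and of the base change to `ℝ` of a homomorphism `f : G → G'`. -/
def RealHom.push {A' : Type u'} [CommRing A'] [HopfAlgebra ℚ A'] (f : A' →ₐc[ℚ] A)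
    (h : RealHom A) : RealHom A' :=
  h.comp (Bialgebra.TensorProduct.map (BialgHom.id ℝ ℝ) f)

/-- A pure Shimura datum `(G, X)` in the sense of Deligne, for `G = Spec A`. -/
structure ShimuraDatum (A : Type u) [CommRing A] [HopfAlgebra ℚ A] where
  reductive : IsReductiveGroup ℚ A
  X : Set (RealHom A)
  /-- `X` is a `G(ℝ)`-conjugacy class. -/
  isConjugacyClass : ∃ h₀ : RealHom A, X = {h | ∃ g : Points ℚ A ℝ, IsConjugateBy g h₀ h}
  /-- The Hodge structure on `Lie(G_ℝ)` is of type `{(-1, 1), (0, 0), (1, -1)}`. -/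
  hodgeType : ∀ h ∈ X, h.hodgePiece (-1) 1 ⊔ h.hodgePiece 0 0 ⊔ h.hodgePiece 1 (-1) = lieComplex A
  /-- `Int h(i)` is a Cartan involution of the adjoint group of `G_ℝ`. -/
  cartan : ∀ h ∈ X, h.IsCartan
  /-- The adjoint group of `G` has no nontrivial factor `Q` over `ℚ` on which the projection of `h`
  is trivial; the factors of `G^ad` are the quotients `Q = Spec B` of `G` with trivial centre. -/
  noTrivialFactor : ∀ h ∈ X, ∀ (B : Type u) [CommRing B] [HopfAlgebra ℚ B] (j : B →ₐc[ℚ] A),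
    Function.Injective j → Subgroup.center (Points ℚ B ℂ) = ⊥ →
    universalPoint (h.push j) = 1 → Function.Surjective (algebraMap ℚ B)

namespace ShimuraDatum

/-- `f : G → G'` is a morphism of Shimura data `(G, X) → (G', X')`. -/
def IsMorphism {A' : Type u'} [CommRing A'] [HopfAlgebra ℚ A'] (D : ShimuraDatum A)
    (D' : ShimuraDatum A') (f : A' →ₐc[ℚ] A) : Prop :=
  ∀ h ∈ D.X, h.push f ∈ D'.X

variable (D : ShimuraDatum A)

/-- The `G(ℂ)`-conjugacy class of the cocharacters `μ_h` for `h ∈ X`. -/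
def cocharacterClass : Set (Cocharacter A) :=
  {ν | ∃ h ∈ D.X, ∃ g : Points ℚ A ℂ, IsConjugateBy (K := ℂ) g h.cocharacter ν}

/-- The isotropy group in `Aut(ℂ)` of the conjugacy class of `μ_h`. -/
def isotropyGroup : Subgroup (ℂ ≃ₐ[ℚ] ℂ) :=
  MulAction.stabilizer (ℂ ≃ₐ[ℚ] ℂ) D.cocharacterClass

/-- The reflex field `E(G, X) ⊆ ℂ`: the field of definition of the conjugacy class of `μ_h`, that
is, the fixed field of its isotropy group. -/
def reflexField : IntermediateField ℚ ℂ :=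
  IntermediateField.fixedField D.isotropyGroup

/-- The smallest subfield `E` of `ℂ` for which `Aut(ℂ/E)` is the isotropy group is `E(G, X)`. -/
theorem eq_reflexField {E : IntermediateField ℚ ℂ}
    (hE : IsLeast {F : IntermediateField ℚ ℂ | F.fixingSubgroup = D.isotropyGroup} E) :
    E = D.reflexField := by
  rw [reflexField, ← show E.fixingSubgroup = _ from hE.1, fixedField_fixingSubgroup_complex]

end ShimuraDatum

end ShimuraData

end

/-! Both reflex fields are fixed fields, so it is enough to compare isotropy groups. Fix `h ∈ X`
with cocharacter `μ`. An automorphism `σ` of `ℂ` lies in the isotropy group of `(G, X)` exactly when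
`σμ = gμg⁻¹` for some `g ∈ G(ℂ)` (`ShimuraDatum.mem_isotropyGroup`), and likewise for `f ∘ μ` in
`G'`. Applying `f` gives one inclusion. For the other, suppose that `σ(f ∘ μ)` is the conjugate of
`f ∘ μ` by `g' ∈ G'(ℂ)`.

The conjugator can be moved into `f(G(ℂ))` (`exists_push_conj`). Since `G'` is connected, the
cokernel is itself a split torus. The centralizer of `f ∘ μ` maps onto this torus
(`exists_commute_apply_eq`): a tangent vector with prescribed derivatives of characters is projected
to its part of weight zero under `f ∘ μ`, which keeps those derivatives, and is then exponentiated.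
Hence `g' = n z` with `z` centralizing `f ∘ μ` and `n` trivial in the cokernel. Chevalley's
construction, together with the rigidity of characters of a normal subgroup, shows that `n` lies in
the image of `f` (`apply_eq_zero_of_coinvariants`); over `ℂ` it then lifts to some `g ∈ G(ℂ)`
(`exists_push_eq`).

Now `σμ` and `gμg⁻¹` agree after `f`, and their quotient `δ` is a point of `Ker f` over `ℂ[T;T⁻¹]`
with value `1` at `T = 1` (`point_smul_eq_of_push`). As `ℂ[T;T⁻¹]` has no idempotents but `0` and
`1`, `δ` lies in the neutral component, a split torus, which is central because `G` is connected
(`commute_of_normal_torus`). A character of this torus takes a value `T ^ k` on `δ`. Choose a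
function `b` on `G`, over `ℚ`, on which the torus acts by this character and with `b(1) = 1`. The
exponents of `T` in the functions `b(xμy)` form a finite nonempty set; it does not grow under `σ`,
because `b` is rational, conjugation is absorbed by `x` and `y`, and `δ` shifts it by `k`. So `k =
0` and `δ = 1` (`eq_one_of_central`). -/

noncomputable section

/-! ### Calculus of points -/

namespace Points

variable {k A A' R S T : Type*} [Field k] [CommRing A] [HopfAlgebra k A] [CommRing A']
  [HopfAlgebra k A'] [CommRing R] [Algebra k R] [CommRing S] [Algebra k S] [CommRing T]
  [Algebra k T]

theorem ext {g h : Points k A R} (H : ∀ a, g a = h a) : g = h :=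
  WithConv.ofConv_injective (AlgHom.ext H)

theorem mul_apply (g h : Points k A R) (a : A) :
    (g * h) a = Algebra.TensorProduct.lift g.ofConv h.ofConv (fun _ _ => .all _ _)
      (Coalgebra.comul (R := k) a) :=
  AlgHom.convMul_apply g h a

theorem mul_apply_of_comul {ι : Type*} (s : Finset ι) {a : A} {x y : ι → A}
    (ha : Coalgebra.comul (R := k) a = ∑ i ∈ s, x i ⊗ₜ[k] y i) (g h : Points k A R) :
    (g * h) a = ∑ i ∈ s, g (x i) * h (y i) := by
  rw [mul_apply, ha, map_sum]
  simp

theorem one_apply (a : A) :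
    (1 : Points k A R) a = algebraMap k R (Coalgebra.counit a) := rfl

@[simp] theorem map_apply (φ : R →ₐ[k] S) (g : Points k A R) (a : A) :
    Points.map φ g a = φ (g a) := rfl

/-- The homomorphism of groups `G(R) → G(S)` induced by `R → S`. -/
def mapHom (φ : R →ₐ[k] S) : Points k A R →* Points k A S where
  toFun := Points.map φ
  map_one' := ext fun _ => φ.commutes _
  map_mul' g h := WithConv.ofConv_injective (AlgHom.comp_convMul_distrib φ g h)

theorem map_one (φ : R →ₐ[k] S) : Points.map φ (1 : Points k A R) = 1 := _root_.map_one (mapHom φ)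

theorem map_mul (φ : R →ₐ[k] S) (g h : Points k A R) :
    Points.map φ (g * h) = Points.map φ g * Points.map φ h := _root_.map_mul (mapHom φ) g h

theorem map_inv (φ : R →ₐ[k] S) (g : Points k A R) :
    Points.map φ g⁻¹ = (Points.map φ g)⁻¹ := _root_.map_inv (mapHom φ) g

/-- The homomorphism `G(R) → G'(R)` induced by a homomorphism of groups `f : G → G'`. -/
def push (f : A' →ₐc[k] A) : Points k A R →* Points k A' R where
  toFun g := toConv (g.ofConv.comp (f : A' →ₐ[k] A))
  map_one' := ext fun a => by
    change algebraMap k R (Coalgebra.counit (f a)) = algebraMap k R (Coalgebra.counit a)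
    simp
  map_mul' g h := WithConv.ofConv_injective (AlgHom.convMul_comp_bialgHom_distrib g h f)

@[simp] theorem push_apply (f : A' →ₐc[k] A) (g : Points k A R) (a : A') :
    push f g a = g (f a) := rfl

theorem map_push (f : A' →ₐc[k] A) (φ : R →ₐ[k] S) (g : Points k A R) :
    Points.map φ (push f g) = push f (Points.map φ g) := rfl

/-- The comultiplication is the product of the two universal points, so identities about it become
computations in a group of points. -/
theorem comul_eq_left_mul_right (a : A) : Coalgebra.comul (R := k) a =
    ((toConv Algebra.TensorProduct.includeLeft : Points k A (A ⊗[k] A)) *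
      (toConv Algebra.TensorProduct.includeRight : Points k A (A ⊗[k] A)) :
        Points k A (A ⊗[k] A)) a := by
  have h := (Coalgebra.Repr.arbitrary k a).eq
  rw [mul_apply_of_comul _ h.symm, ← h]
  simp

/-- The matrix `m(g)` obtained by evaluating a matrix of functions at a point. -/
def mat {ι κ : Type*} (m : Matrix ι κ A) (g : Points k A R) : Matrix ι κ R := m.map g.ofConv

theorem mat_apply {ι κ : Type*} (m : Matrix ι κ A) (g : Points k A R) (i : ι) (j : κ) :
    g.mat m i j = g (m i j) := rfl

end Points

/-- The matrix `m` consists of the matrix coefficients of a representation of `Spec A`. -/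
structure IsMatrixCoefficients (k : Type*) {A ι : Type*} [Field k] [CommRing A] [HopfAlgebra k A]
    [Fintype ι] [DecidableEq ι] (m : Matrix ι ι A) : Prop where
  comul : ∀ i j, Coalgebra.comul (R := k) (m i j) = ∑ l, m i l ⊗ₜ[k] m l j
  counit : ∀ i j, Coalgebra.counit (R := k) (m i j) = (1 : Matrix ι ι k) i j

namespace IsMatrixCoefficients

variable {k A ι R : Type*} [Field k] [CommRing A] [HopfAlgebra k A]
  [Fintype ι] [DecidableEq ι] {m : Matrix ι ι A} [CommRing R] [Algebra k R]

theorem mat_mul (hm : IsMatrixCoefficients k m) (g h : Points k A R) :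
    (g * h).mat m = g.mat m * h.mat m := by
  ext i j
  rw [Matrix.mul_apply, Points.mat_apply, Points.mul_apply_of_comul _ (hm.comul i j)]
  rfl

theorem mat_one (hm : IsMatrixCoefficients k m) : (1 : Points k A R).mat m = 1 := by
  ext i j
  rw [Points.mat_apply, Points.one_apply, hm.counit, Matrix.one_apply, Matrix.one_apply]
  split_ifs <;> simp

end IsMatrixCoefficients

/-! ### Tensors and linear independence -/

section Tensors

variable {k V W : Type*} [Field k] [AddCommGroup V] [Module k V] [AddCommGroup W] [Module k W]

theorem exists_dual_of_linearIndependent {ι : Type*} {e : ι → V} (he : LinearIndependent k e)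
    (i : ι) : ∃ ξ : V →ₗ[k] k, ∀ j, ξ (e j) = (Finsupp.single j (1 : k)) i := by
  obtain ⟨ξ, hξ⟩ := LinearMap.exists_extend he.repr
  refine ⟨(Finsupp.lapply i).comp ξ, fun j => ?_⟩
  have := DFunLike.congr_fun hξ ⟨e j, Submodule.subset_span ⟨j, rfl⟩⟩
  simp only [LinearMap.comp_apply, Submodule.subtype_apply] at this
  rw [LinearMap.comp_apply, this]
  simp [he.repr_eq_single j ⟨e j, Submodule.subset_span ⟨j, rfl⟩⟩ rfl]

/-- Contracting with a dual family isolates one coefficient. This is how coassociativity is read off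
in coordinates below. -/
theorem eq_of_sum_tmul_eq {ι : Type*} [Fintype ι] {e : ι → V} (he : LinearIndependent k e)
    {x y : ι → W} (h : ∑ i, e i ⊗ₜ[k] x i = ∑ i, e i ⊗ₜ[k] y i) : x = y := by
  classical
  funext i
  obtain ⟨ξ, hξ⟩ := exists_dual_of_linearIndependent he i
  have := congrArg ((TensorProduct.lid k W).toLinearMap ∘ₗ ξ.rTensor W) h
  simpa [hξ, Finsupp.single_apply] using this

theorem TensorProduct.ext_of_dual {x y : V ⊗[k] W} (h : ∀ ξ : W →ₗ[k] k,
    TensorProduct.rid k V (ξ.lTensor V x) = TensorProduct.rid k V (ξ.lTensor V y)) : x = y := by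
  classical
  let b := Module.Basis.ofVectorSpace k W
  apply (TensorProduct.equivFinsuppOfBasisRight b (M := V)).injective
  ext i
  have := h (b.coord i)
  have key (z : V ⊗[k] W) : TensorProduct.equivFinsuppOfBasisRight b z i =
      TensorProduct.rid k V ((b.coord i).lTensor V z) := by
    induction z with
    | zero => simp
    | add x y hx hy => simp [hx, hy]
    | tmul v w => simp
  rw [key, key, this]

end Tensors

/-! ### Local finiteness of the regular representation -/

section LocallyFinite

variable {k A : Type*} [Field k] [CommRing A] [HopfAlgebra k A]

/-- The subspace `V` of `𝒪(G)` is stable under right translations. -/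
def IsRightStable (V : Submodule k A) : Prop :=
  ∀ a ∈ V, Coalgebra.comul (R := k) a ∈ LinearMap.range (TensorProduct.map V.subtype (.id : A →ₗ[k] A))

/-- Expanding `Δ a = ∑ c i ⊗ b i` in a basis of the second factor, the finitely many `c i` span a
stable space by coassociativity, and it contains `a` by the counit axiom. -/
theorem exists_rightStable_of_mem (a : A) :
    ∃ V : Submodule k A, FiniteDimensional k V ∧ a ∈ V ∧ IsRightStable V := by
  classical
  let b := Module.Basis.ofVectorSpace k A
  let c : Module.Basis.ofVectorSpaceIndex k A →₀ A :=
    TensorProduct.equivFinsuppOfBasisRight b (Coalgebra.comul (R := k) a)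
  have hc : Coalgebra.comul (R := k) a = ∑ i ∈ c.support, c i ⊗ₜ[k] b i := by
    have := (TensorProduct.equivFinsuppOfBasisRight b).symm_apply_apply
      (Coalgebra.comul (R := k) a)
    rw [← this]
    exact TensorProduct.equivFinsuppOfBasisRight_symm_apply b c
  refine ⟨Submodule.span k (c '' c.support), ?_, ?_, ?_⟩
  · exact FiniteDimensional.span_of_finite k (c.support.finite_toSet.image c)
  · have h := Coalgebra.lTensor_counit_comul (R := k) a
    rw [hc, map_sum] at h
    simp only [LinearMap.lTensor_tmul] at h
    have h := congrArg (TensorProduct.rid k A) h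
    simp only [map_sum, TensorProduct.rid_tmul, one_smul] at h
    rw [← h]
    exact Submodule.sum_mem _ fun i hi =>
      Submodule.smul_mem _ _ (Submodule.subset_span ⟨i, hi, rfl⟩)
  · intro v hv
    induction hv using Submodule.span_induction with
    | zero => simp
    | add x y _ _ hx hy => rw [map_add]; exact add_mem hx hy
    | smul r x _ hx => rw [map_smul]; exact Submodule.smul_mem _ _ hx
    | mem x hx =>
      obtain ⟨l, hl, rfl⟩ := hx
      have h := Coalgebra.coassoc_apply (R := k) a
      rw [hc] at h
      simp only [map_sum, LinearMap.rTensor_tmul, LinearMap.lTensor_tmul] at h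
      -- `π` takes the coordinate `l` in the third factor: one side of coassociativity becomes `Δ (c
      -- l)`, the other a sum of tensors `c i ⊗ _`.
      let π : A ⊗[k] (A ⊗[k] A) →ₗ[k] A ⊗[k] A :=
        LinearMap.lTensor A ((TensorProduct.rid k A).toLinearMap ∘ₗ (b.coord l).lTensor A)
      have h2 := congrArg π h
      have e (t : A ⊗[k] A) (y : A) : π (TensorProduct.assoc k A A A (t ⊗ₜ y)) =
          (b.coord l y) • t := by
        induction t with
        | zero => simp
        | add x y hx hy => rw [TensorProduct.add_tmul, map_add, map_add, hx, hy, smul_add]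
        | tmul x z => simp [π, TensorProduct.tmul_smul]
      simp only [map_sum, e] at h2
      rw [Finset.sum_eq_single l (by intro i _ hi; simp [hi])
        (fun h => (h hl).elim)] at h2
      simp only [Module.Basis.coord_apply, Module.Basis.repr_self, Finsupp.single_eq_same,
        one_smul] at h2
      rw [h2]
      refine Submodule.sum_mem _ fun i hi => ?_
      simp only [π, LinearMap.lTensor_tmul]
      exact ⟨(⟨c i, Submodule.subset_span ⟨i, hi, rfl⟩⟩ : Submodule.span k (c '' c.support)) ⊗ₜ _,
        TensorProduct.map_tmul ..⟩

theorem IsRightStable.sup {V W : Submodule k A} (hV : IsRightStable V) (hW : IsRightStable W) :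
    IsRightStable (V ⊔ W) := by
  have mono {U U' : Submodule k A} (h : U ≤ U') :
      LinearMap.range (TensorProduct.map U.subtype (.id : A →ₗ[k] A)) ≤
        LinearMap.range (TensorProduct.map U'.subtype (.id : A →ₗ[k] A)) := by
    rw [← Submodule.subtype_comp_inclusion U U' h, ← LinearMap.id_comp (LinearMap.id : A →ₗ[k] A),
      TensorProduct.map_comp, LinearMap.id_comp]
    exact LinearMap.range_comp_le_range _ _
  intro a ha
  obtain ⟨v, hv, w, hw, rfl⟩ := Submodule.mem_sup.mp ha
  rw [map_add]
  exact add_mem (mono le_sup_left (hV v hv)) (mono le_sup_right (hW w hw))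

theorem exists_rightStable_of_finite (s : Finset A) :
    ∃ V : Submodule k A, FiniteDimensional k V ∧ (s : Set A) ⊆ V ∧ IsRightStable V := by
  classical
  induction s using Finset.induction_on with
  | empty => exact ⟨⊥, inferInstance, by simp, fun a ha => by simp [(Submodule.mem_bot k).mp ha]⟩
  | insert a s _ ih =>
    obtain ⟨V, h1, h2, h3⟩ := ih
    obtain ⟨W, g1, g2, g3⟩ := exists_rightStable_of_mem (k := k) a
    refine ⟨W ⊔ V, inferInstance, ?_, g3.sup h3⟩
    rw [Finset.coe_insert]
    exact Set.insert_subset (Submodule.mem_sup_left g2)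
      (h2.trans (SetLike.coe_subset_coe.mpr le_sup_right))

/-- The matrix coefficients of a finite dimensional subrepresentation of `𝒪(G)`. -/
theorem IsRightStable.exists_matrix {V : Submodule k A} (hV : IsRightStable V) {ι : Type*}
    [Fintype ι] [DecidableEq ι] (b : Module.Basis ι k V) :
    ∃ m : Matrix ι ι A, IsMatrixCoefficients k m ∧
      ∀ j, Coalgebra.comul (R := k) (b j : A) = ∑ i, (b i : A) ⊗ₜ[k] m i j := by
  have hli : LinearIndependent k fun i => (b i : A) :=
    b.linearIndependent.map' V.subtype (Submodule.ker_subtype V)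
  have h (j : ι) : ∃ x : ι → A, Coalgebra.comul (R := k) (b j : A) = ∑ i, (b i : A) ⊗ₜ[k] x i := by
    obtain ⟨t, ht⟩ := hV (b j) (b j).2
    refine ⟨fun i => TensorProduct.equivFinsuppOfBasisLeft b t i, ?_⟩
    have h2 := (TensorProduct.equivFinsuppOfBasisLeft b).symm_apply_apply t
    rw [TensorProduct.equivFinsuppOfBasisLeft_symm_apply, Finsupp.sum_fintype _ _ (by simp)] at h2
    rw [← ht, ← h2, map_sum]
    simp
  choose x hx using h
  refine ⟨fun i j => x j i, ⟨fun i j => ?_, fun i j => ?_⟩, hx⟩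
  · have h := Coalgebra.coassoc_apply (R := k) (b j : A)
    rw [hx] at h
    simp only [map_sum, LinearMap.rTensor_tmul, LinearMap.lTensor_tmul, hx,
      TensorProduct.sum_tmul, TensorProduct.assoc_tmul] at h
    rw [Finset.sum_comm] at h
    simp only [← TensorProduct.tmul_sum] at h
    exact (congrFun (eq_of_sum_tmul_eq hli h) i).symm
  · have h := Coalgebra.lTensor_counit_comul (R := k) (b j : A)
    rw [hx, map_sum] at h
    simp only [LinearMap.lTensor_tmul] at h
    have h2 : (b j : A) ⊗ₜ[k] (1 : k) =
        ∑ i, (b i : A) ⊗ₜ[k] ((1 : Matrix ι ι k) i j) := by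
      rw [Finset.sum_eq_single j (fun i _ hi => by simp [hi]) (by simp)]
      simp
    exact congrFun (eq_of_sum_tmul_eq hli (h.trans h2)) i

theorem apply_eq_sum_of_comul {ι : Type*} [Fintype ι] {a : A} {e x : ι → A}
    (h : Coalgebra.comul (R := k) a = ∑ i, e i ⊗ₜ[k] x i) :
    a = ∑ i, Coalgebra.counit (R := k) (e i) • x i := by
  have h2 := Coalgebra.rTensor_counit_comul (R := k) a
  rw [h, map_sum] at h2
  simpa using (congrArg (TensorProduct.lid k A) h2).symm

end LocallyFinite

/-! ### Reducedness and rigidity -/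

/-- A smooth algebra over a field is reduced. -/
theorem isReduced_of_smooth (k A : Type*) [Field k] [CommRing A] [Algebra k A]
    [Algebra.Smooth k A] : IsReduced A := by
  refine ⟨fun a ha => ?_⟩
  -- Integral closure commutes with smooth base change, and `k` is integrally closed in `k[X]`. For
  -- nilpotent `a`, the element `aX` of `A[X]` is integral over `A`, so it is a constant polynomial,
  -- and its coefficient `a` vanishes.
  have hint : IsIntegral A (a ⊗ₜ[k] (Polynomial.X : Polynomial k)) := by
    obtain ⟨n, hn⟩ := ha
    refine ⟨Polynomial.X ^ (n + 1), Polynomial.monic_X_pow _, ?_⟩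
    rw [Polynomial.eval₂_X_pow, Algebra.TensorProduct.tmul_pow, pow_succ, hn, zero_mul,
      TensorProduct.zero_tmul]
  obtain ⟨t, ht⟩ := (TensorProduct.toIntegralClosure_bijective_of_smooth (R := k) (S := A)
    (B := Polynomial k)).2 ⟨_, hint⟩
  let c : A ⊗[k] Polynomial k →ₗ[k] A :=
    (TensorProduct.rid k A).toLinearMap ∘ₗ (Polynomial.lcoeff k 1).lTensor A
  have h1 : c (a ⊗ₜ[k] (Polynomial.X : Polynomial k)) = a := by simp [c]
  have h2 (t : A ⊗[k] integralClosure k (Polynomial k)) :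
      c (TensorProduct.toIntegralClosure k A (Polynomial k) t) = 0 := by
    induction t with
    | zero => simp
    | add x y hx hy => rw [map_add, Subalgebra.coe_add, map_add, hx, hy, add_zero]
    | tmul x y =>
      have hy : (y : Polynomial k).natDegree = 0 := by
        by_contra h
        exact Polynomial.transcendental (y : Polynomial k) h
          (by simpa [mem_nonZeroDivisors_iff_ne_zero] using fun h' => h (by simp [h']))
          y.2.isAlgebraic
      have hy' : (y : Polynomial k).coeff 1 = 0 :=
        Polynomial.coeff_eq_zero_of_natDegree_lt (by omega)
      simp [TensorProduct.toIntegralClosure, c, hy']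
  rw [← h1, ← h2 t, ht]

theorem IsIdempotentElem.eq_zero_or_eq_one_of_connected {A : Type*} [CommRing A]
    [ConnectedSpace (PrimeSpectrum A)] {e : A} (he : IsIdempotentElem e) : e = 0 ∨ e = 1 := by
  have h : IsClopen (PrimeSpectrum.basicOpen e : Set (PrimeSpectrum A)) :=
    PrimeSpectrum.isClopen_iff.mpr ⟨e, he, rfl⟩
  rcases isClopen_iff.mp h with h | h
  · left
    have : IsNilpotent e := PrimeSpectrum.basicOpen_eq_bot_iff e |>.mp (SetLike.coe_injective h)
    obtain ⟨n, hn⟩ := this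
    rw [← he.pow_succ_eq n, pow_succ, hn, zero_mul]
  · right
    have h : IsUnit e := by
      by_contra hu
      obtain ⟨m, hm, hem⟩ := exists_max_ideal_of_mem_nonunits hu
      exact (h ▸ Set.mem_univ (⟨m, hm.isPrime⟩ : PrimeSpectrum A) :
        _ ∈ (PrimeSpectrum.basicOpen e : Set (PrimeSpectrum A))) hem
    exact h.mul_left_cancel (he.trans (mul_one e).symm)

section Rigidity

variable {k A R : Type*} [Field k] [CommRing A] [Algebra k A] [CommRing R]

/-- A connected reduced finite dimensional algebra with a rational point is trivial: an
element of a finite dimensional subalgebra of a connected reduced algebra `A` which vanishes at a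
rational point of `A` is `0`. -/
theorem eq_zero_of_mem_finiteDimensional [IsReduced A] [ConnectedSpace (PrimeSpectrum A)]
    (ε : A →ₐ[k] k) (F : Subalgebra k A) [FiniteDimensional k F] {u : A} (hu : u ∈ F)
    (h : ε u = 0) : u = 0 := by
  have : IsArtinianRing F := isArtinian_of_tower k inferInstance
  obtain ⟨n, v, hv⟩ : ∃ (n : ℕ) (v : A), u ^ n = u ^ (n + 1) * v := by
    obtain ⟨n, v, hv⟩ := IsArtinian.exists_pow_succ_smul_dvd (⟨u, hu⟩ : F) (1 : F)
    exact ⟨n, v, by simpa using (congrArg F.val hv).symm⟩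
  have key (j : ℕ) : u ^ n = u ^ (n + j) * v ^ j := by
    induction j with
    | zero => simp
    | succ j ih =>
      calc u ^ n = u ^ n * (u ^ j * v ^ j) := by rw [← mul_assoc, ← pow_add, ← ih]
        _ = u ^ (n + 1) * v * (u ^ j * v ^ j) := by rw [← hv]
        _ = _ := by ring
  -- From `u ^ n = u ^ (n + 1) * v`, this power is an idempotent that acts as the identity on `u ^
  -- (n + 1)`. It vanishes at the rational point, so it is not `1`.
  have he : IsIdempotentElem ((u * v) ^ (n + 1)) := by
    have := key (n + 1)
    change (u * v) ^ (n + 1) * (u * v) ^ (n + 1) = (u * v) ^ (n + 1)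
    calc _ = (u ^ (n + (n + 1)) * v ^ (n + 1)) * u * v ^ (n + 1) := by ring
      _ = _ := by rw [← this]; ring
  have h0 : (u * v) ^ (n + 1) = 0 := by
    rcases he.eq_zero_or_eq_one_of_connected with h0 | h1
    · exact h0
    · have := congrArg ε h1
      simp [h] at this
  refine eq_zero_of_pow_eq_zero (n := n + 1) ?_
  have := key (n + 1)
  calc u ^ (n + 1) = (u ^ (n + (n + 1)) * v ^ (n + 1)) * u := by rw [← this, pow_succ]
    _ = (u * v) ^ (n + 1) * u ^ (n + 1) := by ring
    _ = 0 := by rw [h0, zero_mul]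

variable [Bialgebra k R]

/-- A family of group-like elements of `R` over a connected reduced base `A` is constant. -/
theorem eq_one_tmul_of_groupLike [IsReduced A] [ConnectedSpace (PrimeSpectrum A)]
    (ε : A →ₐ[k] k) (ψ : A ⊗[k] R)
    (h₁ : Algebra.TensorProduct.map (AlgHom.id k A) (Bialgebra.counitAlgHom k R) ψ = 1)
    (h₂ : Algebra.TensorProduct.map (AlgHom.id k A) (Bialgebra.comulAlgHom k R) ψ =
      Algebra.TensorProduct.map (AlgHom.id k A) Algebra.TensorProduct.includeLeft ψ *
      Algebra.TensorProduct.map (AlgHom.id k A) Algebra.TensorProduct.includeRight ψ) :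
    ψ = 1 ⊗ₜ Algebra.TensorProduct.lift ((Algebra.ofId k R).comp ε) (AlgHom.id k R)
      (fun _ _ => .all _ _) ψ := by
  let ev (ξ : R →ₗ[k] k) : A ⊗[k] R →ₗ[k] A := (TensorProduct.rid k A).toLinearMap ∘ₗ ξ.lTensor A
  have ev_tmul (ξ a r) : ev ξ (a ⊗ₜ r) = ξ r • a := by simp [ev]
  obtain ⟨s, hs⟩ := TensorProduct.exists_finset (R := k) ψ
  have hev (ξ) : ev ξ ψ = ∑ i ∈ s, ξ i.2 • i.1 := by
    rw [hs, map_sum]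
    exact Finset.sum_congr rfl fun i _ => ev_tmul _ _ _
  -- `L ξ` contracts `ψ` with `ξ`. The group-like identities make the range of `L` a subalgebra of
  -- `A`, with product given by convolution of linear forms. It is finite dimensional because `ψ` is
  -- a finite sum of tensors, hence it consists of constants.
  let L : (R →ₗ[k] k) →ₗ[k] A :=
    { toFun := fun ξ => ev ξ ψ
      map_add' := fun ξ η => by simp only [hev, LinearMap.add_apply, add_smul, Finset.sum_add_distrib]
      map_smul' := fun c ξ => by
        simp only [hev, LinearMap.smul_apply, smul_assoc, Finset.smul_sum, RingHom.id_apply] }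
  have hone : L (Coalgebra.counit (R := k)) = 1 := by
    have h (t : A ⊗[k] R) : ev Coalgebra.counit t = TensorProduct.rid k A
        (Algebra.TensorProduct.map (AlgHom.id k A) (Bialgebra.counitAlgHom k R) t) := by
      induction t with
      | zero => simp
      | add x y hx hy => simp only [map_add, hx, hy]
      | tmul a r => simp [ev_tmul]
    change ev _ ψ = 1
    rw [h, h₁, Algebra.TensorProduct.one_def]
    simp
  have hmul (ξ η) : L ξ * L η =
      L ((LinearMap.mul' k k ∘ₗ TensorProduct.map ξ η) ∘ₗ Coalgebra.comul) := by
    let ev2 : A ⊗[k] (R ⊗[k] R) →ₗ[k] A := (TensorProduct.rid k A).toLinearMap ∘ₗ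
      (LinearMap.mul' k k ∘ₗ TensorProduct.map ξ η).lTensor A
    have e1 (t : A ⊗[k] R) : ev ((LinearMap.mul' k k ∘ₗ TensorProduct.map ξ η) ∘ₗ
        Coalgebra.comul) t = ev2 (Algebra.TensorProduct.map (AlgHom.id k A)
          (Bialgebra.comulAlgHom k R) t) := by
      induction t with
      | zero => simp
      | add x y hx hy => simp only [map_add, hx, hy]
      | tmul a r => simp [ev_tmul, ev2]
    have e2 (t u : A ⊗[k] R) : ev ξ t * ev η u = ev2
        (Algebra.TensorProduct.map (AlgHom.id k A) Algebra.TensorProduct.includeLeft t *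
          Algebra.TensorProduct.map (AlgHom.id k A) Algebra.TensorProduct.includeRight u) := by
      induction t with
      | zero => simp
      | add x y hx hy => simp only [map_add, add_mul, hx, hy]
      | tmul a r =>
        induction u with
        | zero => simp
        | add x y hx hy => simp only [map_add, mul_add, hx, hy]
        | tmul b r' => simp [ev_tmul, ev2, smul_smul, mul_comm]
    change ev ξ ψ * ev η ψ = ev _ ψ
    rw [e1, h₂, e2]
  let F : Subalgebra k A := (LinearMap.range L).toSubalgebra ⟨_, hone⟩ (by
    rintro _ _ ⟨ξ, rfl⟩ ⟨η, rfl⟩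
    exact ⟨_, (hmul ξ η).symm⟩)
  have hF : FiniteDimensional k F := by
    have : LinearMap.range L ≤ Submodule.span k (Prod.fst '' (s : Set (A × R))) := by
      rintro _ ⟨ξ, rfl⟩
      change ev ξ ψ ∈ _
      rw [hev]
      exact Submodule.sum_mem _ fun i hi => Submodule.smul_mem _ _
        (Submodule.subset_span ⟨i, hi, rfl⟩)
    have h2 : FiniteDimensional k (LinearMap.range L) :=
      have := FiniteDimensional.span_of_finite k (s.finite_toSet.image Prod.fst)
      Submodule.finiteDimensional_of_le ‹_›
    exact h2
  apply TensorProduct.ext_of_dual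
  intro ξ
  change ev ξ ψ = ev ξ (1 ⊗ₜ _)
  have hconst : ev ξ ψ = algebraMap k A (ε (ev ξ ψ)) := by
    rw [← sub_eq_zero]
    refine eq_zero_of_mem_finiteDimensional ε F
      (sub_mem (⟨ξ, rfl⟩ : ev ξ ψ ∈ LinearMap.range L) (Subalgebra.algebraMap_mem F _)) ?_
    simp
  have e3 (t : A ⊗[k] R) : ε (ev ξ t) = ξ (Algebra.TensorProduct.lift ((Algebra.ofId k R).comp ε)
      (AlgHom.id k R) (fun _ _ => .all _ _) t) := by
    induction t with
    | zero => simp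
    | add x y hx hy => simp only [map_add, hx, hy]
    | tmul a r =>
      rw [ev_tmul, map_smul, Algebra.TensorProduct.lift_tmul, AlgHom.comp_apply,
        Algebra.ofId_apply, ← Algebra.smul_def, map_smul, smul_eq_mul, smul_eq_mul, mul_comm]
      rfl
  rw [hconst, e3, ev_tmul, Algebra.algebraMap_eq_smul_one]

end Rigidity

/-! ### Functions invariant under a normal subgroup -/

section Quotient

/-- Normality is postulated only for algebras in one universe, but that includes `A ⊗ (A ⧸ I)`,
which carries the universal pair `(x, n)`; every other pair is a specialization. -/
theorem IsNormalIdeal.conj_apply_eq_zero {k : Type v} {A : Type u} {R : Type*} [Field k]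
    [CommRing A] [HopfAlgebra k A] [CommRing R] [Algebra k R] {I : Ideal A}
    (h : IsNormalIdeal k I) (x n : Points k A R) (hn : ∀ a ∈ I, n a = 0) :
    ∀ a ∈ I, (x * n * x⁻¹) a = 0 := by
  let x₀ : Points k A (A ⊗[k] (A ⧸ I)) := toConv Algebra.TensorProduct.includeLeft
  let n₀ : Points k A (A ⊗[k] (A ⧸ I)) :=
    toConv (Algebra.TensorProduct.includeRight.comp (Ideal.Quotient.mkₐ k I))
  let φ : A ⊗[k] (A ⧸ I) →ₐ[k] R :=
    Algebra.TensorProduct.lift x.ofConv (Ideal.Quotient.liftₐ I n.ofConv hn) fun _ _ => .all _ _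
  have hx : Points.map φ x₀ = x := Points.ext fun a => by simp [x₀, φ]
  have hn : Points.map φ n₀ = n := Points.ext fun a => by
    simp only [n₀, φ, Points.map_apply, AlgHom.comp_apply, Algebra.TensorProduct.includeRight_apply,
      Algebra.TensorProduct.lift_tmul, map_one, one_mul]
    rfl
  intro a ha
  have h0 : (x₀ * n₀ * x₀⁻¹) a = 0 := h _ x₀ n₀ (fun b hb => by
    simp [n₀, Ideal.Quotient.eq_zero_iff_mem.mpr hb]) a ha
  rw [← hx, ← hn, ← Points.map_inv, ← Points.map_mul, ← Points.map_mul, Points.map_apply, h0,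
    map_zero]

variable {k : Type v} {A : Type u} {A' : Type u'} [Field k] [CommRing A] [HopfAlgebra k A]
  [CommRing A'] [HopfAlgebra k A'] (f : A' →ₐc[k] A)

/-- The functions `a` with `a (x · f y) = a x`, for the universal points `x` of `G'` and `y` of
`G`. -/
theorem mem_coinvariants_iff (a : A') : a ∈ coinvariants f ↔
    ((toConv Algebra.TensorProduct.includeLeft : Points k A' (A' ⊗[k] A)) *
      Points.push f (toConv Algebra.TensorProduct.includeRight : Points k A (A' ⊗[k] A)) :
        Points k A' (A' ⊗[k] A)) a = a ⊗ₜ 1 := by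
  have h := (Coalgebra.Repr.arbitrary k a).eq
  rw [coinvariants, AlgHom.mem_equalizer, Points.mul_apply_of_comul _ h.symm, AlgHom.comp_apply,
    Bialgebra.comulAlgHom_apply, ← h]
  simp

theorem Points.map_conj_push {R S : Type*} [CommRing R] [Algebra k R] [CommRing S] [Algebra k S]
    (φ : R →ₐ[k] S) (x : Points k A' R) (y : Points k A R) (a : A') :
    φ ((x * Points.push f y * x⁻¹) a) =
      (Points.map φ x * Points.push f (Points.map φ y) * (Points.map φ x)⁻¹) a := by
  rw [← Points.map_push, ← Points.map_inv, ← Points.map_mul, ← Points.map_mul, Points.map_apply]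

theorem Points.push_apply_ker {R : Type*} [CommRing R] [Algebra k R] (y : Points k A R) :
    ∀ a ∈ RingHom.ker f, Points.push f y a = 0 := by
  intro a ha
  rw [Points.push_apply, (RingHom.mem_ker).mp ha, map_zero]

/-- A character `χ` of a normal subgroup of a connected reduced group `G'`, the image of `f`, is
invariant under conjugation by `G'`. -/
theorem apply_conj_of_character [IsReduced A'] [ConnectedSpace (PrimeSpectrum A')]
    (hf : IsNormalIdeal k (RingHom.ker f)) {χ : A'} (h1 : Coalgebra.counit (R := k) χ = 1)
    (hmul : ∀ (R : Type (max u u')) [CommRing R] [Algebra k R] (x n : Points k A' R),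
      (∀ a ∈ RingHom.ker f, n a = 0) → (x * n) χ = x χ * n χ)
    {R : Type*} [CommRing R] [Algebra k R] (x : Points k A' R) (y : Points k A R) :
    (x * Points.push f y * x⁻¹) χ = y (f χ) := by
  let x₀ : Points k A' (A' ⊗[k] A) := toConv Algebra.TensorProduct.includeLeft
  let y₀ : Points k A (A' ⊗[k] A) := toConv Algebra.TensorProduct.includeRight
  let w := x₀ * Points.push f y₀ * x₀⁻¹
  -- The function `y ↦ χ (x f(y) x⁻¹)` is a family of characters of `G` parametrized by `x` in the
  -- connected group `G'`. By rigidity it is constant, with the value at `x = 1`.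
  have hψ : w χ = 1 ⊗ₜ f χ := by
    have hε : Points.map (Algebra.TensorProduct.lift ((Algebra.ofId k A).comp
        (Bialgebra.counitAlgHom k A')) (AlgHom.id k A) fun _ _ => .all _ _) x₀ = 1 :=
      Points.ext fun a => by simp [x₀, Algebra.ofId_apply]
    have hid : Points.map (Algebra.TensorProduct.lift ((Algebra.ofId k A).comp
        (Bialgebra.counitAlgHom k A')) (AlgHom.id k A) fun _ _ => .all _ _) y₀ =
        toConv (AlgHom.id k A) :=
      Points.ext fun a => by simp [y₀]
    rw [eq_one_tmul_of_groupLike (Bialgebra.counitAlgHom k A') (w χ) ?_ ?_]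
    · rw [Points.map_conj_push, hε, hid]
      simp
    · have h2 : Points.map (Algebra.TensorProduct.map (AlgHom.id k A')
          (Bialgebra.counitAlgHom k A)) y₀ = 1 :=
        Points.ext fun a => by
          simp only [y₀, Points.map_apply, Algebra.TensorProduct.includeRight_apply,
            Algebra.TensorProduct.map_tmul, map_one, Points.one_apply,
            Bialgebra.counitAlgHom_apply, Algebra.TensorProduct.algebraMap_apply]
          rw [Algebra.algebraMap_eq_smul_one, TensorProduct.smul_tmul, smul_eq_mul, mul_one]
      rw [Points.map_conj_push, h2]
      simp [h1, Algebra.TensorProduct.one_def]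
    · let X : Points k A' (A' ⊗[k] (A ⊗[k] A)) := toConv Algebra.TensorProduct.includeLeft
      let Y₁ : Points k A (A' ⊗[k] (A ⊗[k] A)) := toConv
        (Algebra.TensorProduct.includeRight.comp Algebra.TensorProduct.includeLeft)
      let Y₂ : Points k A (A' ⊗[k] (A ⊗[k] A)) := toConv
        (Algebra.TensorProduct.includeRight.comp Algebra.TensorProduct.includeRight)
      have hx (ψ : A →ₐ[k] A ⊗[k] A) :
          Points.map (Algebra.TensorProduct.map (AlgHom.id k A') ψ) x₀ = X :=
        Points.ext fun a => by simp [x₀, X]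
      have hy (ψ : A →ₐ[k] A ⊗[k] A) :
          Points.map (Algebra.TensorProduct.map (AlgHom.id k A') ψ) y₀ =
            toConv (Algebra.TensorProduct.includeRight.comp ψ) :=
        Points.ext fun a => by simp [y₀]
      have hΔ : (toConv (Algebra.TensorProduct.includeRight.comp (Bialgebra.comulAlgHom k A)) :
          Points k A (A' ⊗[k] (A ⊗[k] A))) = Y₁ * Y₂ := by
        refine (Points.ext fun a => ?_).trans
          (Points.map_mul (Algebra.TensorProduct.includeRight : A ⊗[k] A →ₐ[k] A' ⊗[k] (A ⊗[k] A))
            (toConv Algebra.TensorProduct.includeLeft : Points k A (A ⊗[k] A))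
            (toConv Algebra.TensorProduct.includeRight : Points k A (A ⊗[k] A)))
        rw [Points.map_apply, ← Points.comul_eq_left_mul_right]
        simp
      have hE : X * Points.push f (Y₁ * Y₂) * X⁻¹ =
          (X * Points.push f Y₁ * X⁻¹) * (X * Points.push f Y₂ * X⁻¹) := by
        rw [map_mul]; group
      rw [Points.map_conj_push, Points.map_conj_push, Points.map_conj_push, hx, hx, hx, hy, hy, hy,
        hΔ, hE, hmul _ _ _ (hf.conj_apply_eq_zero _ _ (Points.push_apply_ker f Y₂))]
  have key := congrArg
    (Algebra.TensorProduct.lift x.ofConv y.ofConv fun _ _ => .all _ _) hψ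
  have hx : Points.map (Algebra.TensorProduct.lift x.ofConv y.ofConv fun _ _ => .all _ _) x₀ = x :=
    Points.ext fun a => by simp [x₀]
  have hy : Points.map (Algebra.TensorProduct.lift x.ofConv y.ofConv fun _ _ => .all _ _) y₀ = y :=
    Points.ext fun a => by simp [y₀]
  rw [Points.map_conj_push, hx, hy] at key
  simpa using key

section Blocks

variable {R ι κ : Type*} [CommRing R] [Algebra k R] [Fintype ι] [DecidableEq ι] [Fintype κ]
  [DecidableEq κ] {m : Matrix (ι ⊕ κ) (ι ⊕ κ) A} (x n : Points k A R)

/-- A point with vanishing lower left block stabilizes the subspace of the first block, so its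
matrix is block triangular. -/
theorem IsMatrixCoefficients.toBlocks₁₁_mul (hm : IsMatrixCoefficients k m)
    (hn : n.mat m.toBlocks₂₁ = 0) :
    (x * n).mat m.toBlocks₁₁ = x.mat m.toBlocks₁₁ * n.mat m.toBlocks₁₁ := by
  ext i j
  have h := congrFun (congrFun (hm.mat_mul x n) (Sum.inl i)) (Sum.inl j)
  have h0 (l) : n (m (Sum.inr l) (Sum.inl j)) = 0 := congrFun (congrFun hn l) j
  simp only [Matrix.mul_apply, Fintype.sum_sum_type, Points.mat_apply, h0, mul_zero,
    Finset.sum_const_zero, add_zero] at h ⊢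
  exact h

theorem IsMatrixCoefficients.toBlocks₂₁_mul (hm : IsMatrixCoefficients k m)
    (hn : n.mat m.toBlocks₂₁ = 0) :
    (x * n).mat m.toBlocks₂₁ = x.mat m.toBlocks₂₁ * n.mat m.toBlocks₁₁ := by
  ext i j
  have h := congrFun (congrFun (hm.mat_mul x n) (Sum.inr i)) (Sum.inl j)
  have h0 (l) : n (m (Sum.inr l) (Sum.inl j)) = 0 := congrFun (congrFun hn l) j
  simp only [Matrix.mul_apply, Fintype.sum_sum_type, Points.mat_apply, h0, mul_zero,
    Finset.sum_const_zero, add_zero] at h ⊢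
  exact h

theorem Points.apply_det (M : Matrix ι ι A) : x M.det = (x.mat M).det :=
  AlgHom.map_det x.ofConv M

end Blocks

theorem Points.mat_mul_adjugate {R ι κ : Type*} [CommRing R] [Algebra k R] [Fintype ι]
    [DecidableEq ι] (x : Points k A R) (N : Matrix κ ι A) (M : Matrix ι ι A) :
    x.mat (N * M.adjugate) = x.mat N * (x.mat M).adjugate := by
  have h := AlgHom.map_adjugate x.ofConv M
  simp only [AlgHom.mapMatrix_apply] at h
  rw [Points.mat, Matrix.map_mul, h]
  rfl

/-- If a point of `G'` cannot be distinguished from the identity by the functions on `G'` that are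
invariant under the normal subgroup `f(G)`, then it lies in `f(G)`. -/
theorem apply_eq_zero_of_coinvariants [IsNoetherianRing A'] [IsReduced A']
    [ConnectedSpace (PrimeSpectrum A')] (hf : IsNormalIdeal k (RingHom.ker f))
    {R : Type*} [CommRing R] [Algebra k R] (g : Points k A' R)
    (hg : ∀ c ∈ coinvariants f, g c = algebraMap k R (Coalgebra.counit c)) :
    ∀ a ∈ RingHom.ker f, g a = 0 := by
  classical
  -- Chevalley's construction: `V` is a finite dimensional subrepresentation containing generators
  -- of the ideal of `f(G)`, and `W` is its intersection with that ideal. The basis of `V` begins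
  -- with one of `W`.
  obtain ⟨s, hs⟩ := (isNoetherianRing_iff_ideal_fg A').mp inferInstance (RingHom.ker f)
  obtain ⟨V, hVfin, hsV, hV⟩ := exists_rightStable_of_finite (k := k) s
  let fV : V →ₗ[k] A := (f : A' →ₗ[k] A) ∘ₗ V.subtype
  let W : Submodule k V := LinearMap.ker fV
  have : Module.Free k W := Module.Free.of_divisionRing k W
  let bW := Module.finBasis k W
  let bQ := Module.finBasis k (V ⧸ W)
  let b := Module.Basis.sumQuot bW bQ
  obtain ⟨m, hm, hb⟩ := hV.exists_matrix b
  have hbl (j) : f (b (Sum.inl j)) = 0 := by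
    have := LinearMap.mem_ker.mp (bW j).2
    rw [Module.Basis.sumQuot_inl]
    exact this
  have hli : LinearIndependent k fun j => f (b (Sum.inr j)) := by
    have h := bQ.linearIndependent.map' ((W).liftQ fV le_rfl)
      (Submodule.ker_liftQ_eq_bot _ _ _ le_rfl)
    convert! h using 2 with j
    rw [Function.comp_apply, ← Module.Basis.sumQuot_inr bW bQ j, Submodule.liftQ_apply]
    rfl
  -- The subgroup `f(G)` stabilizes `W`: comultiplication of `f (b (inl j)) = 0` is expanded along
  -- the independent elements `f (b (inr i))`.
  have hm21 (i j) : f (m (Sum.inr i) (Sum.inl j)) = 0 := by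
    have h := CoalgHomClass.map_comp_comul_apply f (b (Sum.inl j) : A')
    rw [hbl, map_zero, hb, map_sum, Fintype.sum_sum_type] at h
    simp only [TensorProduct.map_tmul] at h
    have h2 : ∑ i, f (b (Sum.inr i)) ⊗ₜ[k] f (m (Sum.inr i) (Sum.inl j)) =
        ∑ i, f (b (Sum.inr i)) ⊗ₜ[k] (0 : A) := by
      simpa [hbl] using h
    exact congrFun (eq_of_sum_tmul_eq hli h2) i
  -- `M` is the action on `W` and `N` the obstruction to stabilizing `W`. Under right translation by
  -- `n` in `f(G)`, both `χ = det M` and the entries of `U = N * adj M` are multiplied by `χ(n)`.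
  -- The adjugate replaces `M⁻¹`, since `M` need not be invertible on all of `G'`.
  let M := m.toBlocks₁₁
  let N := m.toBlocks₂₁
  let χ := M.det
  let U := N * M.adjugate
  have hχ1 : Coalgebra.counit (R := k) χ = 1 := by
    have h := (1 : Points k A' k).apply_det M
    have h2 : (1 : Points k A' k).mat M = 1 := by
      ext i j
      have := congrFun (congrFun (hm.mat_one (R := k)) (Sum.inl i)) (Sum.inl j)
      refine this.trans ?_
      simp [Matrix.one_apply]
    rw [h2, Matrix.det_one] at h
    exact h
  have hU1 (i j) : Coalgebra.counit (R := k) (U i j) = 0 := by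
    have h := (1 : Points k A' k).mat_mul_adjugate N M
    have h2 : (1 : Points k A' k).mat N = 0 := by
      ext i j
      have := congrFun (congrFun (hm.mat_one (R := k)) (Sum.inr i)) (Sum.inl j)
      refine this.trans ?_
      simp
    rw [h2, Matrix.zero_mul] at h
    exact congrFun (congrFun h i) j
  have hχmul (S : Type (max u u')) [CommRing S] [Algebra k S] (x n : Points k A' S)
      (hn : ∀ a ∈ RingHom.ker f, n a = 0) : (x * n) χ = x χ * n χ := by
    have h0 : n.mat m.toBlocks₂₁ = 0 := by
      ext i j
      exact hn _ (hm21 i j)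
    rw [Points.apply_det, Points.apply_det, Points.apply_det, hm.toBlocks₁₁_mul x n h0,
      Matrix.det_mul]
  have hχconj {S : Type (max u u')} [CommRing S] [Algebra k S] (x : Points k A' S)
      (y : Points k A S) := apply_conj_of_character f hf hχ1 hχmul x y
  let x₀ : Points k A' (A' ⊗[k] A) := toConv Algebra.TensorProduct.includeLeft
  let y₀ : Points k A (A' ⊗[k] A) := toConv Algebra.TensorProduct.includeRight
  have h0 : (Points.push f y₀).mat m.toBlocks₂₁ = 0 := by
    ext i j
    exact Points.push_apply_ker f y₀ _ (hm21 i j)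
  have hxχ : (x₀ * Points.push f y₀) χ = x₀ χ * Points.push f y₀ χ :=
    hχmul _ _ _ (Points.push_apply_ker f y₀)
  -- Here conjugation invariance of `χ` on `f(G)` is essential: `(xn)⁻¹ = x⁻¹ (x n⁻¹ x⁻¹)`, and `χ`
  -- takes the same value on `x n⁻¹ x⁻¹` as on `n⁻¹`.
  have hxχinv : (x₀ * Points.push f y₀)⁻¹ χ = x₀⁻¹ χ * Points.push f y₀⁻¹ χ := by
    have h := hχconj x₀ y₀⁻¹
    have e : (x₀ * Points.push f y₀)⁻¹ = x₀⁻¹ * (x₀ * Points.push f y₀⁻¹ * x₀⁻¹) := by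
      rw [map_inv]; group
    rw [e, hχmul _ _ _ (hf.conj_apply_eq_zero _ _ (Points.push_apply_ker f _)), h]
    rfl
  have hχχ : Points.push f y₀ χ * Points.push f y₀⁻¹ χ = 1 := by
    rw [← hχmul _ _ _ (Points.push_apply_ker f _), ← map_mul, mul_inv_cancel, map_one,
      Points.one_apply, hχ1, _root_.map_one]
  have hxU (i j) : (x₀ * Points.push f y₀) (U i j) = x₀ (U i j) * Points.push f y₀ χ := by
    have h := (x₀ * Points.push f y₀).mat_mul_adjugate N M
    rw [hm.toBlocks₂₁_mul _ _ h0, hm.toBlocks₁₁_mul _ _ h0, Matrix.adjugate_mul_distrib,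
      Matrix.mul_assoc, ← Matrix.mul_assoc _ (Matrix.adjugate _), Matrix.mul_adjugate,
      Matrix.smul_mul, Matrix.one_mul, Matrix.mul_smul, ← Points.mat_mul_adjugate] at h
    rw [Points.apply_det, mul_comm]
    exact congrFun (congrFun h i) j
  -- The factor `χ(n)` acquired by `u` cancels against the factor `χ(n⁻¹)` acquired by the antipode
  -- of `χ`. Applied to `χ` and to `U`, this yields enough invariants to detect `f(G)`.
  have hcoinv {u : A'} (hu : (x₀ * Points.push f y₀) u = x₀ u * Points.push f y₀ χ) :
      u * HopfAlgebra.antipode k χ ∈ coinvariants f := by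
    rw [mem_coinvariants_iff]
    change (x₀ * Points.push f y₀) _ = x₀ _
    have hS (x : Points k A' (A' ⊗[k] A)) : x (HopfAlgebra.antipode k χ) = x⁻¹ χ := rfl
    rw [map_mul, map_mul, hS, hS, hu, hxχinv]
    linear_combination (x₀ u * x₀⁻¹ χ) * hχχ
  have hgχ : g χ * g⁻¹ χ = 1 := by
    have := hg _ (hcoinv hxχ)
    rw [map_mul] at this
    refine this.trans ?_
    simp [hχ1]
  have hgU (i j) : g (U i j) = 0 := by
    have := hg _ (hcoinv (hxU i j))
    rw [map_mul] at this
    have h2 : g (U i j) * g⁻¹ χ = 0 := by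
      refine this.trans ?_
      simp [hU1]
    calc g (U i j) = g (U i j) * g⁻¹ χ * g χ := by linear_combination -g (U i j) * hgχ
      _ = 0 := by rw [h2, zero_mul]
  -- Multiplying `U(g) = 0` by `M(g)` gives `χ(g) N(g) = 0`, and `χ(g)` is a unit.
  have hgN : g.mat N = 0 := by
    have h := g.mat_mul_adjugate N M
    have hz : g.mat (N * M.adjugate) = 0 := by
      ext i j
      exact hgU i j
    have h2 : g.mat N * ((g.mat M).adjugate * g.mat M) = 0 := by
      rw [← Matrix.mul_assoc, ← h, hz, Matrix.zero_mul]
    rw [Matrix.adjugate_mul, Matrix.mul_smul, Matrix.mul_one, ← Points.apply_det] at h2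
    calc g.mat N = g⁻¹ χ • (g χ • g.mat N) := by rw [smul_smul, mul_comm, hgχ, one_smul]
      _ = 0 := by rw [h2, smul_zero]
  -- Evaluate `b j = ∑ ε(b i) • m i j` at `g`: elements of `W` vanish at the identity, which kills
  -- the upper terms, and `N(g) = 0` kills the lower ones.
  have hgb (j) : g (b (Sum.inl j)) = 0 := by
    rw [apply_eq_sum_of_comul (hb (Sum.inl j)), map_sum, Fintype.sum_sum_type]
    have h1 (i) : Coalgebra.counit (R := k) (b (Sum.inl i) : A') = 0 := by
      rw [← CoalgHomClass.counit_comp_apply f, hbl, map_zero]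
    have h2 (i) : g (m (Sum.inr i) (Sum.inl j)) = 0 := congrFun (congrFun hgN i) j
    simp [h1, h2]
  have hsg : RingHom.ker f ≤ RingHom.ker g.ofConv := by
    rw [← hs, Ideal.span_le]
    intro a ha
    have haI : f a = 0 := by
      have : a ∈ RingHom.ker f := hs ▸ Ideal.subset_span ha
      exact this
    have haW : (⟨a, hsV ha⟩ : V) ∈ W := haI
    have := congrArg (fun w : W => g (w : V)) (bW.sum_repr ⟨_, haW⟩)
    rw [SetLike.mem_coe, RingHom.mem_ker]
    refine this.symm.trans ?_
    simp only [Submodule.coe_sum, Submodule.coe_smul, map_sum, map_smul]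
    refine Finset.sum_eq_zero fun i _ => ?_
    have := hgb i
    rw [Module.Basis.sumQuot_inl] at this
    rw [this, smul_zero]
  exact fun a ha => hsg ha

end Quotient

/-! ### Lifting points along a homomorphism onto its image -/

section Lifting

/-- The Nullstellensatz: in a Jacobson ring some maximal ideal avoids a non-nilpotent `t`, and its
residue field is finite over `K`, hence equal to `K`. -/
theorem exists_algHom_apply_ne_zero {K T : Type*} [Field K] [IsAlgClosed K] [CommRing T]
    [Algebra K T] [Algebra.FiniteType K T] {t : T} (ht : ¬ IsNilpotent t) :
    ∃ φ : T →ₐ[K] K, φ t ≠ 0 := by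
  have : IsJacobsonRing T := isJacobsonRing_of_finiteType (A := K)
  have h : t ∉ Ideal.jacobson (⊥ : Ideal T) := by
    rw [← Ideal.radical_eq_jacobson]
    exact ht
  rw [Ideal.jacobson, Ideal.mem_sInf] at h
  push Not at h
  obtain ⟨m, ⟨-, hm⟩, htm⟩ := h
  let : Field (T ⧸ m) := Ideal.Quotient.field m
  have : Module.Finite K (T ⧸ m) := finite_of_finite_type_of_isJacobsonRing K (T ⧸ m)
  let e := AlgEquiv.ofBijective (Algebra.ofId K (T ⧸ m))
    (IsAlgClosed.algebraMap_bijective_of_isIntegral (k := K) (K := T ⧸ m))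
  refine ⟨e.symm.toAlgHom.comp (Ideal.Quotient.mkₐ K m), ?_⟩
  intro h0
  have h0 : e.symm (Ideal.Quotient.mk m t) = 0 := h0
  rw [EmbeddingLike.map_eq_zero_iff, Ideal.Quotient.eq_zero_iff_mem] at h0
  exact htm h0

/-- An injective homomorphism of finite type `B → A` of noetherian rings is surjective on
prime spectra over a nonempty open subset. -/
theorem exists_basicOpen_subset_range_comap {A B : Type*} [CommRing A] [CommRing B]
    [IsNoetherianRing B] [Nontrivial B] {φ : B →+* A} (hφ : Function.Injective φ)
    (hft : φ.FiniteType) :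
    ∃ r : B, ¬ IsNilpotent r ∧
      (PrimeSpectrum.basicOpen r : Set (PrimeSpectrum B)) ⊆ Set.range (PrimeSpectrum.comap φ) := by
  classical
  obtain ⟨S, hS⟩ := PrimeSpectrum.exists_constructibleSetData_iff.mpr
    (PrimeSpectrum.isConstructible_range_comap (RingHom.FinitePresentation.of_finiteType.mp hft))
  -- A minimal prime `p` is in the image since the homomorphism is injective. By Chevalley's theorem
  -- the image is constructible, so one locally closed piece of it contains `p`.
  obtain ⟨p, hp⟩ := Ideal.nonempty_minimalPrimes (bot_ne_top (α := Ideal B))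
  have hpp : p.IsPrime := hp.1.1
  obtain ⟨q, hq, hqp⟩ := Ideal.exists_comap_eq_of_mem_minimalPrimes_of_injective hφ p hp
  have hmem : (⟨p, hpp⟩ : PrimeSpectrum B) ∈ S.toSet := by
    rw [hS]
    exact ⟨⟨q, hq⟩, PrimeSpectrum.ext hqp⟩
  rw [PrimeSpectrum.ConstructibleSetData.toSet, Set.mem_iUnion₂] at hmem
  obtain ⟨C, hC, hg, hf⟩ := hmem
  have hg : ∀ i, C.g i ∈ p := fun i => hg ⟨i, rfl⟩
  have hf : C.f ∉ p := fun h => hf (Set.singleton_subset_iff.mpr h)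
  have hfin := (minimalPrimes.finite_of_isNoetherianRing B)
  -- Inverting `s` removes all other irreducible components; there the closed condition of the
  -- chosen piece, which holds at `p`, holds everywhere.
  obtain ⟨s, hs, hsp⟩ : ∃ s ∈ (hfin.toFinset.erase p).inf id, s ∉ p := by
    by_contra! h
    obtain ⟨i, hi, hip⟩ := (Ideal.IsPrime.inf_le' hpp).mp (show (hfin.toFinset.erase p).inf id ≤ p from h)
    rw [Finset.mem_erase, Set.Finite.mem_toFinset] at hi
    exact hi.1 (le_antisymm hip (hp.2 ⟨hi.2.1.1, bot_le⟩ hip))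
  have hnil {x : B} (hx : x ∈ p) (Q : PrimeSpectrum B) (hsQ : s ∉ Q.asIdeal) : x ∈ Q.asIdeal := by
    obtain ⟨P, hP, hPQ⟩ := Ideal.exists_minimalPrimes_le (bot_le (a := Q.asIdeal))
    by_cases h : P = p
    · exact hPQ (h ▸ hx)
    · exact absurd (hPQ ((Finset.inf_le (f := id) (Finset.mem_erase.mpr
        ⟨h, hfin.mem_toFinset.mpr hP⟩) : _ ≤ P) hs)) hsQ
  refine ⟨s * C.f, fun h => ?_, fun Q hQ => ?_⟩
  · obtain ⟨n, hn⟩ := h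
    rcases hpp.mem_or_mem (hpp.mem_of_pow_mem n (hn ▸ zero_mem p)) with h | h
    · exact hsp h
    · exact hf h
  · have hQ : s * C.f ∉ Q.asIdeal := hQ
    rw [← hS, PrimeSpectrum.ConstructibleSetData.toSet, Set.mem_iUnion₂]
    refine ⟨C, hC, ?_, ?_⟩
    · rintro _ ⟨i, rfl⟩
      exact hnil (hg i) Q fun h => hQ (Ideal.mul_mem_right _ _ h)
    · intro h
      exact hQ (Ideal.mul_mem_left _ _ (h rfl))

/-- A geometric point of `Spec B` in the image of `Spec A` lifts to a geometric point of
`Spec A`. -/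
theorem exists_comp_eq_of_ker_mem_range {A B K : Type*} [CommRing A] [CommRing B] [Field K]
    [IsAlgClosed K] [Algebra B A] [Algebra.FiniteType B A] (n : B →+* K)
    (h : (⟨RingHom.ker n, RingHom.ker_isPrime n⟩ : PrimeSpectrum B) ∈
      Set.range (PrimeSpectrum.comap (algebraMap B A))) :
    ∃ g : A →+* K, g.comp (algebraMap B A) = n := by
  let : Algebra B K := n.toAlgebra
  have hn := (PrimeSpectrum.nontrivial_iff_mem_rangeComap _).mpr h
  let p := RingHom.ker n
  have hp : p.IsPrime := RingHom.ker_isPrime n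
  let F := p.ResidueField
  let j : F →+* K := Ideal.ResidueField.lift p n le_rfl (fun x hx => by
    exact (isUnit_iff_ne_zero.mpr fun h => hx h))
  let : Algebra F K := j.toAlgebra
  have : IsScalarTower B F K := .of_algebraMap_eq fun b => by
    exact (Ideal.ResidueField.lift_algebraMap ..).symm
  -- The fibre over the point is nonempty and remains so over `K`; the Nullstellensatz then supplies
  -- a `K`-point of it.
  have hF : Nontrivial (F ⊗[B] A) := hn
  have h1 : Nontrivial (K ⊗[F] (F ⊗[B] A)) := inferInstance
  have h2 : Nontrivial (K ⊗[B] A) :=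
    (TensorProduct.AlgebraTensorModule.cancelBaseChange B F F K A).symm.toEquiv.nontrivial
  obtain ⟨φ, -⟩ := exists_algHom_apply_ne_zero (K := K) (T := K ⊗[B] A) (t := 1)
    not_isNilpotent_one
  refine ⟨φ.toRingHom.comp (Algebra.TensorProduct.includeRight : A →ₐ[B] K ⊗[B] A).toRingHom, ?_⟩
  ext b
  change φ (1 ⊗ₜ algebraMap B A b) = n b
  rw [Algebra.algebraMap_eq_smul_one, ← TensorProduct.smul_tmul, ← Algebra.algebraMap_eq_smul_one]
  exact φ.commutes (n b)

variable {k : Type*} {A A' : Type*} [Field k] [CommRing A] [HopfAlgebra k A]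
  [CommRing A'] [HopfAlgebra k A'] (f : A' →ₐc[k] A)

/-- Since `B ⊗ B → A ⊗ A` is injective over a field, `f a = 0` already forces the comultiplication
of `a` to vanish in `B ⊗ B`, where `B` is the coordinate ring of the image. -/
theorem Points.mul_comp_apply_eq_zero {B R : Type*} [CommRing B] [Algebra k B] [CommRing R]
    [Algebra k R] (q : A' →ₐ[k] B) (j : B →ₐ[k] A) (hj : Function.Injective j)
    (hjq : ∀ a, j (q a) = f a) (x y : B →ₐ[k] R) {a : A'} (ha : f a = 0) :
    ((toConv (x.comp q) : Points k A' R) * (toConv (y.comp q) : Points k A' R) :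
      Points k A' R) a = 0 := by
  have hjj : Function.Injective (TensorProduct.map j.toLinearMap j.toLinearMap) :=
    TensorProduct.map_injective_of_flat_flat _ _ hj hj
  have hz : Algebra.TensorProduct.map q q (Coalgebra.comul (R := k) a) = 0 := by
    apply hjj
    rw [map_zero]
    have h := CoalgHomClass.map_comp_comul_apply f a
    rw [ha, map_zero] at h
    rw [← h]
    have hr := (Coalgebra.Repr.arbitrary k a).eq
    rw [← hr]
    simp [hjq]
  have e : Algebra.TensorProduct.lift (x.comp q) (y.comp q) (fun _ _ => .all _ _) =
      (Algebra.TensorProduct.lift x y (fun _ _ => .all _ _)).comp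
        (Algebra.TensorProduct.map q q) := by
    ext b <;> simp
  rw [Points.mul_apply, e, AlgHom.comp_apply, hz, map_zero]

/-- The image of `f : G → G'` is closed under multiplication. -/
theorem Points.mul_apply_eq_zero_of_mem_ker {R : Type*} [CommRing R] [Algebra k R]
    {x y : Points k A' R} (hx : ∀ a ∈ RingHom.ker f, x a = 0) (hy : ∀ a ∈ RingHom.ker f, y a = 0) :
    ∀ a ∈ RingHom.ker f, (x * y) a = 0 := fun _ ha =>
  Points.mul_comp_apply_eq_zero f (Ideal.Quotient.mkₐ k (RingHom.ker (f : A' →ₐ[k] A)))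
    (Ideal.kerLiftAlg (f : A' →ₐ[k] A)) (Ideal.kerLiftAlg_injective _) (fun _ => rfl)
    (Ideal.Quotient.liftₐ _ x.ofConv hx) (Ideal.Quotient.liftₐ _ y.ofConv hy) ha

theorem Points.inv_apply_eq_zero_of_mem_ker {R : Type*} [CommRing R] [Algebra k R]
    {x : Points k A' R} (hx : ∀ a ∈ RingHom.ker f, x a = 0) :
    ∀ a ∈ RingHom.ker f, x⁻¹ a = 0 := by
  intro a ha
  refine hx _ ?_
  rw [RingHom.mem_ker] at ha ⊢
  change f (HopfAlgebra.antipode k a) = 0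
  rw [← antipode_bialgHom, ha, map_zero]

/-- Over an algebraically closed field, every point of the image of `f : G → G'` lifts to `G`. -/
theorem exists_push_eq [Algebra.FiniteType k A] [Algebra.FiniteType k A'] {K : Type*} [Field K]
    [IsAlgClosed K] [Algebra k K] (n : Points k A' K) (hn : ∀ a ∈ RingHom.ker f, n a = 0) :
    ∃ g : Points k A K, Points.push f g = n := by
  let B := A' ⧸ RingHom.ker (f : A' →ₐ[k] A)
  let q : A' →ₐ[k] B := Ideal.Quotient.mkₐ k _
  let j : B →ₐ[k] A := Ideal.kerLiftAlg (f : A' →ₐ[k] A)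
  have hj : Function.Injective j := Ideal.kerLiftAlg_injective _
  have hjq (a : A') : j (q a) = f a := rfl
  have hq0 (a : A') (ha : a ∈ RingHom.ker f) : q a = 0 := Ideal.Quotient.eq_zero_iff_mem.mpr ha
  have : IsNoetherianRing A' := Algebra.FiniteType.isNoetherianRing k A'
  have : Nontrivial A := (Bialgebra.counitAlgHom k A).toRingHom.domain_nontrivial
  have : Nontrivial B := j.toRingHom.domain_nontrivial
  let : Algebra B A := j.toRingHom.toAlgebra
  have : IsScalarTower k B A := .of_algebraMap_eq fun c => (j.commutes c).symm
  have hft : Algebra.FiniteType B A := Algebra.FiniteType.of_restrictScalars_finiteType k B A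
  obtain ⟨r, hr, hrange⟩ := exists_basicOpen_subset_range_comap
    (show Function.Injective (algebraMap B A) from hj) hft
  obtain ⟨r, rfl⟩ := Ideal.Quotient.mk_surjective r
  -- Points of the open subset `r ≠ 0` of the image lift directly. A general `n` is translated into
  -- this subset by the image of a suitable point of `G`.
  have hlift (u : Points k A' K) (hu : ∀ a ∈ RingHom.ker f, u a = 0) (hur : u r ≠ 0) :
      ∃ g : Points k A K, Points.push f g = u := by
    let u' : B →ₐ[k] K := Ideal.Quotient.liftₐ _ u.ofConv hu
    obtain ⟨g, hg⟩ := exists_comp_eq_of_ker_mem_range (A := A) u'.toRingHom (hrange hur)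
    have hg' (b : B) : g (j b) = u' b := DFunLike.congr_fun hg b
    refine ⟨toConv { g with commutes' := fun c => ?_ }, Points.ext fun a => hg' (q a)⟩
    have := hg' (algebraMap k B c)
    rw [AlgHom.commutes, AlgHom.commutes] at this
    exact this
  let X : Points k A (K ⊗[k] A) := toConv Algebra.TensorProduct.includeRight
  let nA : Points k A' (K ⊗[k] A) := Points.map Algebra.TensorProduct.includeLeft n
  let u : Points k A' (K ⊗[k] A) := (Points.push f X)⁻¹ * nA
  have hu : ¬ IsNilpotent (u r) := by
    intro h
    let Y : Points k A' (K ⊗[k] B) := toConv (Algebra.TensorProduct.includeRight.comp q)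
    let nB : Points k A' (K ⊗[k] B) := Points.map Algebra.TensorProduct.includeLeft n
    let J : K ⊗[k] B →ₐ[K] K ⊗[k] A := Algebra.TensorProduct.map (AlgHom.id K K) j
    have hJ : Function.Injective J :=
      Module.Flat.lTensor_preserves_injective_linearMap (M := K) j.toLinearMap hj
    have hJu : Points.map (J.restrictScalars k) (Y⁻¹ * nB) = u := by
      rw [Points.map_mul, Points.map_inv]
      have h1 : Points.map (J.restrictScalars k) Y = Points.push f X :=
        Points.ext fun a => by simp [Y, X, J, hjq]
      have h2 : Points.map (J.restrictScalars k) nB = nA :=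
        Points.ext fun a => by simp [nA, nB, J]
      rw [h1, h2]
    have h3 : IsNilpotent ((Y⁻¹ * nB) r) := by
      rw [← hJu] at h
      exact (IsNilpotent.map_iff hJ).mp h
    have hY : ∀ a ∈ RingHom.ker f, Y a = 0 := fun a ha => by simp [Y, hq0 a ha]
    have hnB : ∀ a ∈ RingHom.ker f, nB a = 0 := fun a ha => by simp [nB, hn a ha]
    -- The substitution `Y ↦ n Y⁻¹` sends `Y⁻¹ n` to the universal point `Y` of the image. So if
    -- `r(Y⁻¹ n)` were nilpotent, `r` would be too.
    let θ₀ : B →ₐ[k] K ⊗[k] B := Ideal.Quotient.liftₐ _ (nB * Y⁻¹).ofConv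
      (Points.mul_apply_eq_zero_of_mem_ker f hnB (Points.inv_apply_eq_zero_of_mem_ker f hY))
    let θ : K ⊗[k] B →ₐ[k] K ⊗[k] B :=
      Algebra.TensorProduct.lift Algebra.TensorProduct.includeLeft θ₀ fun _ _ => .all _ _
    have hθY : Points.map θ Y = nB * Y⁻¹ := Points.ext fun a => by
      simp only [θ, Y, Points.map_apply, AlgHom.comp_apply,
        Algebra.TensorProduct.includeRight_apply, Algebra.TensorProduct.lift_tmul, map_one, one_mul]
      rfl
    have hθn : Points.map θ nB = nB := Points.ext fun a => by simp [θ, nB]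
    have h4 : Points.map θ (Y⁻¹ * nB) = Y := by
      rw [Points.map_mul, Points.map_inv, hθY, hθn]
      group
    have h5 : IsNilpotent (Y r) := by
      rw [← h4]
      exact h3.map θ
    have h6 : Function.Injective (Algebra.TensorProduct.includeRight : B →ₐ[k] K ⊗[k] B) :=
      Algebra.TensorProduct.includeRight_injective (algebraMap k K).injective
    exact hr ((IsNilpotent.map_iff h6).mp h5)
  obtain ⟨φ, hφ⟩ := exists_algHom_apply_ne_zero (K := K) hu
  let ψ : K ⊗[k] A →ₐ[k] K := φ.restrictScalars k
  have hn' : Points.map ψ nA = n := Points.ext fun a => φ.commutes (n a)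
  have hψ : Points.map ψ u = (Points.push f (Points.map ψ X))⁻¹ * n := by
    rw [Points.map_mul, Points.map_inv, Points.map_push, hn']
  obtain ⟨g, hg⟩ := hlift _ (Points.mul_apply_eq_zero_of_mem_ker f
    (Points.inv_apply_eq_zero_of_mem_ker f (Points.push_apply_ker f (Points.map ψ X))) hn)
    (hψ ▸ hφ)
  exact ⟨Points.map ψ X * g, by rw [map_mul, hg]; group⟩

end Lifting

/-! ### Logarithmic derivatives of characters -/

open DualNumber in
theorem DualNumber.isUnit_of_fst_ne_zero {K : Type*} [Field K] {x : K[ε]}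
    (hx : TrivSqZeroExt.fst x ≠ 0) : IsUnit x :=
  TrivSqZeroExt.isUnit_iff_isUnit_fst.mpr (isUnit_iff_ne_zero.mpr hx)

/-- Formal smoothness lifts the identity of `K` through the nilpotent thickening `B`. With `B` the
dual numbers over `K`, this extends a tangent vector from `F` to `K`. -/
theorem exists_section_of_formallySmooth {F K B : Type*} [CommRing F] [CommRing K] [CommRing B]
    [Algebra F K] [Algebra.FormallySmooth F K] (θ : F →+* B) (g : B →+* K)
    (hg : Function.Surjective g) (hn : IsNilpotent (RingHom.ker g))
    (h : g.comp θ = algebraMap F K) :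
    ∃ ψ : K →+* B, g.comp ψ = RingHom.id K ∧ ψ.comp (algebraMap F K) = θ := by
  algebraize [θ]
  let g' : B →ₐ[F] K := ⟨g, fun r => DFunLike.congr_fun h r⟩
  let s := Algebra.FormallySmooth.liftOfSurjective (AlgHom.id F K) g' hg hn
  refine ⟨s, RingHom.ext fun x => ?_, RingHom.ext fun r => s.commutes r⟩
  exact Algebra.FormallySmooth.liftOfSurjective_apply (AlgHom.id F K) g' hg hn x

open DualNumber in
/-- Let `j : B → A` be an injective homomorphism from an integral domain to an algebra of finite type
over a field of characteristic zero. Then there is a point of `A` in a field such that every tangent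
vector of `B` at its image lifts to a tangent vector of `A`. -/
theorem exists_lift_dualNumber {k : Type v} {A : Type u} {B : Type*} [Field k] [CharZero k]
    [CommRing A] [Algebra k A] [Algebra.FiniteType k A] [CommRing B] [IsDomain B] [Algebra k B]
    (j : B →ₐ[k] A) (hj : Function.Injective j) :
    ∃ (K : Type u) (_ : Field K) (_ : Algebra k K) (π : A →ₐ[k] K),
      ∀ δ : B →ₐ[k] K[ε], (∀ b, TrivSqZeroExt.fst (δ b) = π (j b)) →
        ∃ ψ : A →ₐ[k] K[ε], (∀ a, TrivSqZeroExt.fst (ψ a) = π a) ∧ ∀ b, ψ (j b) = δ b := by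
  -- A prime of `A` above the generic point of `B`; the required point of `A` is its residue field
  -- `K`.
  obtain ⟨p, hp, -, hpS⟩ := Ideal.exists_le_prime_disjoint (⊥ : Ideal A)
    ((nonZeroDivisors B).map j) (by
      rw [Set.disjoint_left]
      rintro _ h0 ⟨b, hb, rfl⟩
      have : b = 0 := hj (by simpa using h0)
      exact nonZeroDivisors.ne_zero hb this)
  let K := FractionRing (A ⧸ p)
  let π : A →ₐ[k] K := (IsScalarTower.toAlgHom k (A ⧸ p) K).comp (Ideal.Quotient.mkₐ k p)
  have hinj : Function.Injective (π.comp j) := by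
    rw [injective_iff_map_eq_zero]
    intro b hb
    by_contra hb0
    have h1 : Ideal.Quotient.mkₐ k p (j b) = 0 :=
      IsFractionRing.injective (A ⧸ p) K (hb.trans (map_zero _).symm)
    exact Set.disjoint_left.mp hpS (Ideal.Quotient.eq_zero_iff_mem.mp h1)
      ⟨b, mem_nonZeroDivisors_of_ne_zero hb0, rfl⟩
  refine ⟨K, inferInstance, inferInstance, π, fun δ hδ => ?_⟩
  let F := FractionRing B
  let i : F →ₐ[k] K := IsFractionRing.liftAlgHom (g := π.comp j) hinj
  let : Algebra F K := i.toRingHom.toAlgebra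
  have : IsScalarTower k F K := IsScalarTower.of_algebraMap_eq fun r => (i.commutes r).symm
  have hi (b : B) : algebraMap F K (algebraMap B F b) = π (j b) :=
    IsFractionRing.lift_algebraMap (g := (π.comp j).toRingHom) hinj b
  -- In characteristic zero the finitely generated field extension `K` of `F` is formally smooth.
  have : CharZero F := charZero_of_injective_algebraMap (algebraMap k F).injective
  have : Algebra.EssFiniteType k K := Algebra.EssFiniteType.comp k (A ⧸ p) K
  have : Algebra.EssFiniteType F K := Algebra.EssFiniteType.of_comp k F K
  let θ : F →+* K[ε] := IsLocalization.lift (M := nonZeroDivisors B) (g := δ.toRingHom) fun b =>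
    DualNumber.isUnit_of_fst_ne_zero (by
      refine fun h => nonZeroDivisors.ne_zero b.2 (hinj ?_)
      exact ((hδ b).symm.trans h).trans (map_zero _).symm)
  have hθ (b : B) : θ (algebraMap B F b) = δ b := IsLocalization.lift_eq _ _
  let g : K[ε] →+* K := (TrivSqZeroExt.fstHom K K K).toRingHom
  have hn : IsNilpotent (RingHom.ker g) := by
    refine ⟨2, ?_⟩
    exact TrivSqZeroExt.kerIdeal_sq K K
  obtain ⟨s, hs, hs'⟩ := exists_section_of_formallySmooth θ g
    (fun x => ⟨TrivSqZeroExt.inl x, rfl⟩) hn (by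
      apply IsLocalization.ringHom_ext (nonZeroDivisors B)
      ext b
      change TrivSqZeroExt.fst (θ (algebraMap B F b)) = algebraMap F K (algebraMap B F b)
      rw [hθ, hδ, hi])
  have hsj (b : B) : s (π (j b)) = δ b := by
    rw [← hi, ← hθ]
    exact DFunLike.congr_fun hs' _
  refine ⟨⟨s.comp π.toRingHom, fun r => ?_⟩, fun a => DFunLike.congr_fun hs (π a), hsj⟩
  have h := hsj (algebraMap k B r)
  rw [AlgHom.commutes, AlgHom.commutes, AlgHom.commutes] at h
  change s (π (algebraMap k A r)) = _
  rw [AlgHom.commutes, h]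

section PointDerivation

open DualNumber

variable {k A R : Type*} [Field k] [CommRing A] [HopfAlgebra k A] [CommRing R] [Algebra k R]

/-- The derivations of `A` at the identity, with values in `R`. -/
def IsPointDerivation (D : A →ₗ[k] R) : Prop :=
  ∀ a b, D (a * b) = Coalgebra.counit (R := k) a • D b + Coalgebra.counit (R := k) b • D a

/-- The linear form `D` such that `g = 1 + D ε`. -/
def Points.tangent (g : Points k A R[ε]) : A →ₗ[k] R :=
  (TrivSqZeroExt.sndHom R R).restrictScalars k ∘ₗ g.ofConv.toLinearMap

theorem Points.tangent_apply (g : Points k A R[ε]) (a : A) :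
    g.tangent a = TrivSqZeroExt.snd (g a) := rfl

theorem Points.isPointDerivation_tangent (g : Points k A R[ε])
    (hg : Points.map (TrivSqZeroExt.fstHom k R R) g = 1) : IsPointDerivation g.tangent := by
  intro a b
  have h (a : A) : TrivSqZeroExt.fst (g a) = algebraMap k R (Coalgebra.counit a) :=
    congrArg (fun x : Points k A R => x a) hg
  have hm : g (a * b) = g a * g b := _root_.map_mul g.ofConv a b
  rw [tangent_apply, hm, DualNumber.snd_mul, h, h, Algebra.smul_def, Algebra.smul_def,
    tangent_apply, tangent_apply]
  ring

theorem Points.mul_apply_of_isGroupLikeElem (g h : Points k A R) {a : A}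
    (ha : Coalgebra.comul (R := k) a = a ⊗ₜ a) : (g * h) a = g a * h a := by
  rw [mul_apply, ha]
  simp

/-- The homomorphism `v ↦ 1 + v_i ε`. -/
def dualNumberExp (K : Type*) [Field K] {n : ℕ} (i : Fin n) :
    Multiplicative (Fin n → ℤ) →* K[ε] where
  toFun v := 1 + ((v.toAdd i : ℤ) : K) • ε
  map_one' := by simp
  map_mul' v w := by
    ext <;> simp [add_comm]

variable [CharZero k] [Algebra.FiniteType k A]

/-- The characters in an independent family have independent differentials at the identity. -/
theorem exists_isPointDerivation {n : ℕ}
    (j : AddMonoidAlgebra k (Fin n → ℤ) →ₐc[k] A) (hj : Function.Injective j) (i : Fin n) :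
    ∃ D : A →ₗ[k] k, IsPointDerivation D ∧ ∀ v, D (j (.single v 1)) = v i := by
  obtain ⟨K, _, _, π, hπ⟩ := exists_lift_dualNumber (j : AddMonoidAlgebra k (Fin n → ℤ) →ₐ[k] A) hj
  -- The image of `π` in the torus is multiplied by the tangent vector `v ↦ 1 + v_i ε`. A lift of
  -- the product to `A`, divided by `π` itself, is a tangent vector of `G` at the identity.
  let δ : AddMonoidAlgebra k (Fin n → ℤ) →ₐ[k] K[ε] :=
    AddMonoidAlgebra.lift k K[ε] (Fin n → ℤ)
      ((((TrivSqZeroExt.inlAlgHom k K K).comp (π.comp (j : AddMonoidAlgebra k (Fin n → ℤ) →ₐ[k] A)) : _ →* K[ε]).comp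
        (AddMonoidAlgebra.of k (Fin n → ℤ))) * dualNumberExp K i)
  have hδ (v : Fin n → ℤ) : δ (.single v 1) =
      TrivSqZeroExt.inl (π (j (.single v 1))) * (1 + ((v i : ℤ) : K) • ε) := by
    simp [δ, dualNumberExp]
  obtain ⟨ψ, hψ, hψδ⟩ := hπ δ (by
    intro b
    have : (TrivSqZeroExt.fstHom k K K).comp δ = π.comp (j : AddMonoidAlgebra k (Fin n → ℤ) →ₐ[k] A) := by
      refine AddMonoidAlgebra.algHom_ext (fun v => ?_) (Subsingleton.elim _ _)
      change TrivSqZeroExt.fst (δ (.single v 1)) = _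
      rw [hδ]
      simp
    exact DFunLike.congr_fun this b)
  let x : Points k A K[ε] := toConv ((TrivSqZeroExt.inlAlgHom k K K).comp π)
  let y : Points k A K[ε] := toConv ψ
  have hxy : Points.map (TrivSqZeroExt.fstHom k K K) x =
      Points.map (TrivSqZeroExt.fstHom k K K) y := Points.ext fun a => (hψ a).symm
  have h1 : Points.map (TrivSqZeroExt.fstHom k K K) (x⁻¹ * y) = 1 := by
    rw [Points.map_mul, Points.map_inv, hxy, inv_mul_cancel]
  have h2 (v : Fin n → ℤ) : (x⁻¹ * y) (j (.single v 1)) = 1 + ((v i : ℤ) : K) • ε := by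
    have hc : Coalgebra.comul (R := k) (j (.single v 1)) =
        j (.single v 1) ⊗ₜ j (.single v 1) := by
      rw [← CoalgHomClass.map_comp_comul_apply]
      simp
    have hy : y (j (.single v 1)) = x (j (.single v 1)) * (1 + ((v i : ℤ) : K) • ε) :=
      (hψδ _).trans (hδ v)
    have hx : x⁻¹ (j (.single v 1)) * x (j (.single v 1)) = 1 := by
      rw [← Points.mul_apply_of_isGroupLikeElem _ _ hc, inv_mul_cancel, Points.one_apply]
      simp
    rw [Points.mul_apply_of_isGroupLikeElem _ _ hc, hy, ← mul_assoc, hx, one_mul]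
  -- A `k`-linear retraction of `K` onto `k` brings the values down to `k`; the integers `v i` are
  -- unchanged.
  obtain ⟨ξ, hξ⟩ := (Algebra.linearMap k K).exists_leftInverse_of_injective
    (LinearMap.ker_eq_bot.mpr (algebraMap k K).injective)
  refine ⟨ξ ∘ₗ (x⁻¹ * y).tangent, fun a b => ?_, fun v => ?_⟩
  · simp only [LinearMap.comp_apply, Points.isPointDerivation_tangent _ h1 a b, map_add, map_smul]
  · rw [LinearMap.comp_apply, Points.tangent_apply, h2]
    have h := DFunLike.congr_fun hξ ((v i : ℤ) : k)
    simpa using h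

end PointDerivation

/-! ### The cokernel of a homomorphism to a connected group -/

section Cokernel

/-- A quotient of a connected group is connected: an idempotent of `C` becomes `0` or `1` in `A`,
and the counit excludes `1`. -/
theorem neutralIdeal_eq_bot {k C A : Type*} [Field k] [CommRing C] [HopfAlgebra k C] [CommRing A]
    [HopfAlgebra k A] [ConnectedSpace (PrimeSpectrum A)] (q : C →ₐc[k] A)
    (hq : Function.Injective q) : neutralIdeal k C = ⊥ := by
  refine Ideal.span_eq_bot.mpr ?_
  rintro e ⟨he, h0⟩
  rcases IsIdempotentElem.eq_zero_or_eq_one_of_connected (he.map q) with h | h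
  · exact hq (h.trans (map_zero q).symm)
  · rw [hq (h.trans (map_one q).symm)] at h0
    simp at h0

/-- If `G'` is connected and the neutral component of the cokernel of `G → G'` is a split torus, then
the cokernel is a split torus. -/
theorem exists_torus_of_cokernelIsSplitTorus {k : Type v} {A : Type u} {A' : Type u'} [Field k]
    [CommRing A] [HopfAlgebra k A] [CommRing A'] [HopfAlgebra k A']
    [ConnectedSpace (PrimeSpectrum A')] {f : A' →ₐc[k] A} (hf : CokernelIsSplitTorus f) :
    ∃ (n : ℕ) (j : AddMonoidAlgebra k (Fin n → ℤ) →ₐc[k] A'), Function.Injective j ∧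
      ∀ c ∈ coinvariants f, c ∈ Set.range j := by
  obtain ⟨C, _, _, q, ⟨hq, hqr⟩, n, φ, hφ, hφk⟩ := hf
  rw [neutralIdeal_eq_bot q hq] at hφk
  have hφi : Function.Injective φ := by
    refine (injective_iff_map_eq_zero φ).mpr fun c hc => ?_
    have h : c ∈ RingHom.ker φ := hc
    rwa [hφk] at h
  let e := BialgEquiv.ofBijective φ ⟨hφi, hφ⟩
  let s : AddMonoidAlgebra k (Fin n → ℤ) →ₐc[k] C := e.symm
  have hs : Function.Injective s := EquivLike.injective e.symm
  refine ⟨n, q.comp s, fun x y h => hs (hq h), fun c hc => ?_⟩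
  rw [← hqr] at hc
  obtain ⟨c, rfl⟩ := hc
  exact ⟨e c, congrArg q (e.symm_apply_apply c)⟩

end Cokernel

/-! ### Linear forms on `𝒪(G)` under convolution -/

namespace ConvForm

variable {k A R S : Type*} [Field k] [CommRing A] [HopfAlgebra k A] [CommRing R] [Algebra k R]
  [CommRing S] [Algebra k S]

/-- A point as a linear form. -/
def ofPoint : Points k A R →* WithConv (A →ₗ[k] R) where
  toFun g := toConv g.ofConv.toLinearMap
  map_one' := rfl
  map_mul' _ _ := rfl

@[simp] theorem ofPoint_apply (g : Points k A R) (a : A) : ofPoint g a = g a := rfl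

theorem ofPoint_inv_mul (g : Points k A R) : ofPoint g⁻¹ * ofPoint g = 1 := by
  rw [← _root_.map_mul, inv_mul_cancel, _root_.map_one]

theorem ofPoint_mul_inv (g : Points k A R) : ofPoint g * ofPoint g⁻¹ = 1 := by
  rw [← _root_.map_mul, mul_inv_cancel, _root_.map_one]

theorem mul_apply_of_comul {ι : Type*} (s : Finset ι) {a : A} {x y : ι → A}
    (ha : Coalgebra.comul (R := k) a = ∑ i ∈ s, x i ⊗ₜ[k] y i) (F G : WithConv (A →ₗ[k] R)) :
    (F * G) a = ∑ i ∈ s, F (x i) * G (y i) := by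
  rw [LinearMap.convMul_apply, ha]
  simp

/-- The linear form `a ⊗ b ↦ F a * G b`. -/
def box (F G : WithConv (A →ₗ[k] R)) : WithConv (A ⊗[k] A →ₗ[k] R) :=
  toConv (LinearMap.mul' k R ∘ₗ TensorProduct.map F.ofConv G.ofConv)

@[simp] theorem box_tmul (F G : WithConv (A →ₗ[k] R)) (a b : A) :
    box F G (a ⊗ₜ b) = F a * G b := by
  change LinearMap.mul' k R (TensorProduct.map F.ofConv G.ofConv (a ⊗ₜ b)) = _
  simp

theorem box_mul (F G F' G' : WithConv (A →ₗ[k] R)) :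
    box F G * box F' G' = box (F * F') (G * G') := by
  have h := LinearMap.algHom_comp_convMul_distrib (Algebra.TensorProduct.lmul' k (S := R))
    (toConv (TensorProduct.map F.ofConv G.ofConv)) (toConv (TensorProduct.map F'.ofConv G'.ofConv))
  rw [TensorProduct.map_convMul_map] at h
  exact (congrArg toConv h).symm

theorem box_one_one : box (1 : WithConv (A →ₗ[k] R)) 1 = 1 := by
  apply WithConv.ofConv_injective
  ext a b
  change box (1 : WithConv (A →ₗ[k] R)) 1 (a ⊗ₜ b) = algebraMap k R (Coalgebra.counit (a ⊗ₜ[k] b))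
  rw [box_tmul]
  simp [mul_comm]

theorem box_pow (F G : WithConv (A →ₗ[k] R)) (n : ℕ) : box F G ^ n = box (F ^ n) (G ^ n) := by
  induction n with
  | zero => simp [box_one_one]
  | succ n ih => rw [pow_succ, ih, box_mul, ← pow_succ, ← pow_succ]

/-- The linear form `a ⊗ b ↦ F (a * b)`. -/
def mulPullback : WithConv (A →ₗ[k] R) →+* WithConv (A ⊗[k] A →ₗ[k] R) where
  toFun F := toConv (F.ofConv ∘ₗ LinearMap.mul' k A)
  map_one' := by
    apply WithConv.ofConv_injective
    ext a b
    change algebraMap k R (Coalgebra.counit (a * b)) =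
      algebraMap k R (Coalgebra.counit (a ⊗ₜ[k] b))
    simp [mul_comm]
  map_mul' F G := congrArg toConv
    (LinearMap.convMul_comp_coalgHom_distrib F G (Bialgebra.mulCoalgHom k A))
  map_zero' := rfl
  map_add' _ _ := rfl

theorem mulPullback_ofPoint (g : Points k A R) :
    mulPullback (ofPoint g) = box (ofPoint g) (ofPoint g) := by
  apply WithConv.ofConv_injective
  ext a b
  change ofPoint g (a * b) = box (ofPoint g) (ofPoint g) (a ⊗ₜ b)
  rw [box_tmul]
  exact _root_.map_mul g.ofConv a b

/-- This writes the Leibniz rule as an identity in the convolution algebra of `G × G`, where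
conjugation and powers of `D` can be computed formally. -/
theorem isPointDerivation_iff (D : WithConv (A →ₗ[k] R)) :
    IsPointDerivation D.ofConv ↔ mulPullback D = box D 1 + box 1 D := by
  have h (a b : A) : (box D 1 + box 1 D) (a ⊗ₜ b) =
      Coalgebra.counit (R := k) a • D b + Coalgebra.counit (R := k) b • D a := by
    change box D 1 (a ⊗ₜ b) + box 1 D (a ⊗ₜ b) = _
    rw [box_tmul, box_tmul, Algebra.smul_def, Algebra.smul_def, add_comm]
    simp [mul_comm]
  constructor
  · intro hD
    apply WithConv.ofConv_injective
    ext a b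
    exact (hD a b).trans (h a b).symm
  · intro hD a b
    exact (congrArg (fun F : WithConv (A ⊗[k] A →ₗ[k] R) => F (a ⊗ₜ b)) hD).trans (h a b)

theorem isPointDerivation_conj (g : Points k A R) {D : WithConv (A →ₗ[k] R)}
    (hD : IsPointDerivation D.ofConv) :
    IsPointDerivation (ofPoint g * D * ofPoint g⁻¹).ofConv := by
  rw [isPointDerivation_iff] at hD ⊢
  rw [_root_.map_mul, _root_.map_mul, hD, mulPullback_ofPoint, mulPullback_ofPoint, mul_add,
    add_mul, box_mul, box_mul, box_mul, box_mul, mul_one, ofPoint_mul_inv]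

/-- The forms `D ⊗ 1` and `1 ⊗ D` commute, so the binomial formula applies to their sum. -/
theorem pow_apply_mul {D : WithConv (A →ₗ[k] R)} (hD : IsPointDerivation D.ofConv) (n : ℕ)
    (a b : A) : (D ^ n) (a * b) = ∑ m ∈ Finset.HasAntidiagonal.antidiagonal n,
      n.choose m.1 • ((D ^ m.1) a * (D ^ m.2) b) := by
  rw [isPointDerivation_iff] at hD
  have hc : Commute (box D 1) (box 1 D) := by
    rw [commute_iff_eq, box_mul, box_mul, one_mul, mul_one]
  have h := hc.add_pow' n
  rw [← hD, ← map_pow] at h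
  have h2 := congrArg (fun F : WithConv (A ⊗[k] A →ₗ[k] R) => F.ofConv (a ⊗ₜ b)) h
  refine h2.trans ?_
  simp only [ofConv_sum, LinearMap.sum_apply]
  refine Finset.sum_congr rfl fun m _ => ?_
  rw [box_pow, box_pow, one_pow, one_pow, box_mul, one_mul, mul_one]
  exact congrArg (n.choose m.1 • ·) (box_tmul (D ^ m.1) (D ^ m.2) a b)

end ConvForm

/-! ### The exponential map of the Lie algebra -/

section Exponential

open ConvForm

variable {A : Type*} [CommRing A] [HopfAlgebra ℚ A]

theorem Matrix.norm_pow_apply_le {ι : Type*} [Fintype ι] [DecidableEq ι] (N : Matrix ι ι ℂ)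
    (n : ℕ) (i j : ι) : ‖(N ^ n) i j‖ ≤ (∑ i, ∑ j, ‖N i j‖) ^ n := by
  induction n generalizing i j with
  | zero =>
    by_cases h : i = j <;> simp [h]
  | succ n ih =>
    rw [pow_succ, Matrix.mul_apply, pow_succ]
    refine (norm_sum_le _ _).trans ?_
    have h0 : 0 ≤ ∑ i, ∑ j, ‖N i j‖ := by positivity
    calc ∑ l, ‖(N ^ n) i l * N l j‖ ≤ ∑ l, (∑ i, ∑ j, ‖N i j‖) ^ n * ‖N l j‖ := by
          refine Finset.sum_le_sum fun l _ => ?_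
          rw [norm_mul]
          exact mul_le_mul_of_nonneg_right (ih i l) (norm_nonneg _)
      _ = (∑ i, ∑ j, ‖N i j‖) ^ n * ∑ l, ‖N l j‖ := by rw [Finset.mul_sum]
      _ ≤ _ := by
          refine mul_le_mul_of_nonneg_left (Finset.sum_le_sum fun l _ => ?_) (pow_nonneg h0 n)
          exact Finset.single_le_sum (f := fun j => ‖N l j‖) (fun _ _ => norm_nonneg _)
            (Finset.mem_univ j)

/-- In a finite dimensional subrepresentation containing `a`, convolution powers of `D` become
powers of the matrix `N`, which grow at most geometrically. -/
theorem exists_norm_pow_apply_le (D : WithConv (A →ₗ[ℚ] ℂ)) (a : A) :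
    ∃ C M : ℝ, ∀ n : ℕ, ‖(D ^ n) a‖ ≤ C * M ^ n := by
  obtain ⟨V, hfin, haV, hV⟩ := exists_rightStable_of_mem (k := ℚ) a
  have : Module.Free ℚ V := Module.Free.of_divisionRing ℚ V
  let b := Module.finBasis ℚ V
  obtain ⟨m, hm, hb⟩ := hV.exists_matrix b
  let N : Matrix (Fin _) (Fin _) ℂ := Matrix.of fun i j => D (m i j)
  have hN (n : ℕ) (i j) : (D ^ n) (m i j) = (N ^ n) i j := by
    induction n generalizing i j with
    | zero =>
      rw [pow_zero, pow_zero, LinearMap.convOne_apply, hm.counit, Matrix.one_apply,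
        Matrix.one_apply]
      split_ifs <;> simp
    | succ n ih =>
      rw [pow_succ, pow_succ, ConvForm.mul_apply_of_comul _ (hm.comul i j), Matrix.mul_apply]
      exact Finset.sum_congr rfl fun l _ => by rw [ih]; rfl
  have ha : a = ∑ j, ∑ i, (b.repr ⟨a, haV⟩ j * Coalgebra.counit (R := ℚ) (b i : A)) • m i j := by
    have h := congrArg V.subtype (b.sum_repr ⟨a, haV⟩)
    rw [map_sum] at h
    refine h.symm.trans (Finset.sum_congr rfl fun j _ => ?_)
    rw [map_smul]
    conv_lhs => rw [Submodule.subtype_apply, apply_eq_sum_of_comul (hb j), Finset.smul_sum]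
    simp only [smul_smul]
  refine ⟨∑ j, ∑ i, ‖((b.repr ⟨a, haV⟩ j * Coalgebra.counit (R := ℚ) (b i : A) : ℚ) : ℂ)‖,
    ∑ i, ∑ j, ‖N i j‖, fun n => ?_⟩
  have h : (D ^ n) a = ∑ j, ∑ i,
      ((b.repr ⟨a, haV⟩ j * Coalgebra.counit (R := ℚ) (b i : A) : ℚ) : ℂ) * (N ^ n) i j := by
    conv_lhs => rw [ha]
    change (D ^ n).ofConv _ = _
    simp only [map_sum, map_smul]
    refine Finset.sum_congr rfl fun j _ => Finset.sum_congr rfl fun i _ => ?_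
    rw [Algebra.smul_def]
    exact congrArg _ (hN n i j)
  rw [h]
  refine (norm_sum_le _ _).trans ?_
  rw [Finset.sum_mul]
  refine Finset.sum_le_sum fun j _ => (norm_sum_le _ _).trans ?_
  rw [Finset.sum_mul]
  refine Finset.sum_le_sum fun i _ => ?_
  rw [norm_mul]
  exact mul_le_mul_of_nonneg_left (N.norm_pow_apply_le n i j) (norm_nonneg _)

theorem summable_norm_exp (D : WithConv (A →ₗ[ℚ] ℂ)) (a : A) :
    Summable fun n : ℕ => ‖((n.factorial : ℂ)⁻¹ * (D ^ n) a)‖ := by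
  obtain ⟨C, M, h⟩ := exists_norm_pow_apply_le D a
  refine Summable.of_nonneg_of_le (fun _ => norm_nonneg _) (fun n => ?_)
    ((Real.summable_pow_div_factorial M).mul_left C)
  rw [norm_mul, norm_inv, Complex.norm_natCast, mul_comm, ← div_eq_mul_inv, mul_div_assoc']
  exact div_le_div_of_nonneg_right (h n) (Nat.cast_nonneg _)

/-- On a group-like element convolution is ordinary multiplication, so the series is that of the
complex exponential. -/
theorem hasSum_exp_of_isGroupLikeElem (D : WithConv (A →ₗ[ℚ] ℂ)) {a : A}
    (ha : IsGroupLikeElem ℚ a) :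
    HasSum (fun n : ℕ => (n.factorial : ℂ)⁻¹ * (D ^ n) a) (Complex.exp (D a)) := by
  have h (n : ℕ) : (D ^ n) a = (D a) ^ n := by
    induction n with
    | zero =>
      rw [pow_zero, LinearMap.convOne_apply, ha.counit_eq_one]; simp
    | succ n ih =>
      rw [pow_succ, LinearMap.convMul_apply, ha.comul_eq_tmul_self, pow_succ, ← ih]
      simp
  rw [Complex.exp_eq_exp_ℂ]
  refine (NormedSpace.exp_series_hasSum_exp' (𝕂 := ℂ) (D a)).congr_fun fun n => ?_
  rw [h, smul_eq_mul]

/-- The exponential of an element of `Lie(G_ℂ)`. -/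
theorem exists_exp {D : WithConv (A →ₗ[ℚ] ℂ)} (hD : IsPointDerivation D.ofConv) :
    ∃ z : Points ℚ A ℂ, ∀ a, HasSum (fun n : ℕ => (n.factorial : ℂ)⁻¹ * (D ^ n) a) (z a) := by
  let E (a : A) : ℂ := ∑' n : ℕ, (n.factorial : ℂ)⁻¹ * (D ^ n) a
  have hs (a : A) : HasSum (fun n : ℕ => (n.factorial : ℂ)⁻¹ * (D ^ n) a) (E a) :=
    (summable_norm_exp D a).of_norm.hasSum
  have hadd (a b : A) : E (a + b) = E a + E b := by
    refine (hs (a + b)).unique (((hs a).add (hs b)).congr_fun fun n => ?_)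
    rw [← mul_add]
    exact congrArg _ (map_add (D ^ n).ofConv a b)
  have hone : E 1 = 1 := by
    have h : D 1 = 0 := by
      have h : D (1 * 1) = _ := hD 1 1
      simpa using h
    rw [(hs 1).unique (hasSum_exp_of_isGroupLikeElem D .one), h, Complex.exp_zero]
  -- The Cauchy product of the two absolutely convergent series matches the higher Leibniz formula
  -- term by term.
  have hmul (a b : A) : E (a * b) = E a * E b := by
    rw [tsum_mul_tsum_eq_tsum_sum_antidiagonal_of_summable_norm (summable_norm_exp D a)
      (summable_norm_exp D b)]
    refine tsum_congr fun n => ?_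
    rw [pow_apply_mul hD, Finset.mul_sum]
    refine Finset.sum_congr rfl fun m hm => ?_
    rw [Finset.HasAntidiagonal.mem_antidiagonal] at hm
    subst hm
    have h0 (n : ℕ) : (n.factorial : ℂ) ≠ 0 := Nat.cast_ne_zero.mpr n.factorial_ne_zero
    rw [nsmul_eq_mul, Nat.cast_add_choose]
    have h1 := h0 m.1
    have h2 := h0 m.2
    have h3 := h0 (m.1 + m.2)
    field_simp
  let Z : A →+* ℂ :=
    { toFun := E
      map_one' := hone
      map_mul' := hmul
      map_zero' := by simpa using hadd 0 0
      map_add' := hadd }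
  exact ⟨toConv Z.toRatAlgHom, hs⟩

variable {D : WithConv (A →ₗ[ℚ] ℂ)} {z : Points ℚ A ℂ}

theorem commute_exp (hz : ∀ a, HasSum (fun n : ℕ => (n.factorial : ℂ)⁻¹ * (D ^ n) a) (z a))
    {x : Points ℚ A ℂ} (hx : Commute (ofPoint x) D) : Commute x z := by
  refine Points.ext fun a => ?_
  have h := (Coalgebra.Repr.arbitrary ℚ a).eq.symm
  rw [Points.mul_apply_of_comul _ h, Points.mul_apply_of_comul _ h]
  have h1 := hasSum_sum (s := (Coalgebra.Repr.arbitrary ℚ a).index)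
    fun i _ => (hz ((Coalgebra.Repr.arbitrary ℚ a).right i)).mul_left
      (x ((Coalgebra.Repr.arbitrary ℚ a).left i))
  have h2 := hasSum_sum (s := (Coalgebra.Repr.arbitrary ℚ a).index)
    fun i _ => (hz ((Coalgebra.Repr.arbitrary ℚ a).left i)).mul_right
      (x ((Coalgebra.Repr.arbitrary ℚ a).right i))
  refine h1.unique (h2.congr_fun fun n => ?_)
  have h3 : (ofPoint x * D ^ n) a = (D ^ n * ofPoint x) a := by rw [(hx.pow_right n).eq]
  rw [ConvForm.mul_apply_of_comul _ h, ConvForm.mul_apply_of_comul _ h] at h3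
  have h4 := congrArg ((n.factorial : ℂ)⁻¹ * ·) h3
  simp only [Finset.mul_sum] at h4
  refine Eq.trans (Finset.sum_congr rfl fun i _ => ?_)
    (h4.trans (Finset.sum_congr rfl fun i _ => ?_))
  · rw [ofPoint_apply]; ring
  · rw [ofPoint_apply]; ring

theorem exp_apply_of_isGroupLikeElem
    (hz : ∀ a, HasSum (fun n : ℕ => (n.factorial : ℂ)⁻¹ * (D ^ n) a) (z a)) {a : A}
    (ha : IsGroupLikeElem ℚ a) : z a = Complex.exp (D a) :=
  (hz a).unique (hasSum_exp_of_isGroupLikeElem D ha)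

end Exponential

/-! ### Laurent polynomials and cocharacters -/

section Laurent

variable {B : Type*} [CommRing B] [Algebra ℂ B]

/-- The homomorphism `T ↦ u`. -/
def laurentHom (u : Bˣ) : ℂ[T;T⁻¹] →ₐ[ℂ] B :=
  AddMonoidAlgebra.lift ℂ B ℤ ((Units.coeHom B).comp (zpowersHom Bˣ u))

@[simp] theorem laurentHom_T (u : Bˣ) (n : ℤ) :
    laurentHom u (LaurentPolynomial.T n) = ((u ^ n : Bˣ) : B) := by
  refine (AddMonoidAlgebra.lift_single _ _ _).trans ?_
  simp

theorem laurentHom_ext {φ ψ : ℂ[T;T⁻¹] →ₐ[ℂ] B}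
    (h : φ (LaurentPolynomial.T 1) = ψ (LaurentPolynomial.T 1)) : φ = ψ := by
  have h' : IsUnit (LaurentPolynomial.T 1 : ℂ[T;T⁻¹]) := LaurentPolynomial.isUnit_T 1
  apply AddMonoidAlgebra.algHom_ext'
  · apply MonoidHom.ext_mint
    exact h
  · exact Subsingleton.elim _ _

/-- The coefficient of `T ^ n`. -/
def laurentCoeff (n : ℤ) : ℂ[T;T⁻¹] →ₗ[ℂ] ℂ :=
  Finsupp.lapply n ∘ₗ (AddMonoidAlgebra.coeffLinearEquiv ℂ).toLinearMap

theorem laurentCoeff_apply (n : ℤ) (p : ℂ[T;T⁻¹]) : laurentCoeff n p = p.coeff n := rfl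

theorem laurentCoeff_C_mul_T (n m : ℤ) (c : ℂ) :
    laurentCoeff n (LaurentPolynomial.C c * LaurentPolynomial.T m) = if m = n then c else 0 := by
  rw [← LaurentPolynomial.single_eq_C_mul_T, laurentCoeff_apply, AddMonoidAlgebra.coeff_single,
    Finsupp.single_apply]

theorem eq_of_laurentHom_eq {p q : ℂ[T;T⁻¹]} (h : ∀ s : ℂˣ, laurentHom s p = laurentHom s q) :
    p = q := by
  rw [← sub_eq_zero]
  obtain ⟨n, f, hf⟩ := (p - q).exists_T_pow
  have h0 (s : ℂˣ) : f.eval (s : ℂ) = 0 := by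
    have h1 : (laurentHom s).comp Polynomial.toLaurentAlg = Polynomial.aeval (s : ℂ) := by
      ext
      simp
    have h2 := DFunLike.congr_fun h1 f
    rw [AlgHom.comp_apply, Polynomial.toLaurentAlg_apply, hf, map_mul, map_sub, h, sub_self,
      zero_mul] at h2
    rw [← Polynomial.coe_aeval_eq_eval]
    exact h2.symm
  have h1 : f = 0 := by
    apply Polynomial.eq_zero_of_infinite_isRoot
    refine (Set.Infinite.mono (s := {0}ᶜ) ?_ (Set.finite_singleton (0 : ℂ)).infinite_compl)
    intro s hs
    exact h0 (Units.mk0 s hs)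
  rw [h1, map_zero] at hf
  exact ((LaurentPolynomial.isUnit_T n).mul_left_eq_zero).mp hf.symm

/-- The scalars of `ℂ[T;T⁻¹]`, as a homomorphism of `ℚ`-algebras. -/
def laurentScalar (B : Type*) [CommRing B] [Algebra ℂ B] [Algebra ℚ B] : ℂ →ₐ[ℚ] B :=
  (algebraMap ℂ B).toRatAlgHom

end Laurent

section Cocharacters

variable {A : Type u} [CommRing A] [HopfAlgebra ℚ A]

/-- The point `μ(s)`. -/
def Cocharacter.eval (μ : Cocharacter A) (s : ℂˣ) : Points ℚ A ℂ :=
  Points.map ((laurentHom s).restrictScalars ℚ) μ.point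

/-- The unit `s T` of `ℂ[T;T⁻¹]`. -/
def laurentScale (s : ℂˣ) : ℂ[T;T⁻¹]ˣ :=
  Units.map (algebraMap ℂ ℂ[T;T⁻¹]).toMonoidHom s * (LaurentPolynomial.isUnit_T 1).unit

/-- The identity `μ(sT) = μ(s) μ(T)`: compatibility with comultiplication, with the first variable
specialized to `s`. -/
theorem Cocharacter.map_scale_point (μ : Cocharacter A) (s : ℂˣ) :
    Points.map ((laurentHom (laurentScale s)).restrictScalars ℚ) μ.point =
      Points.map (laurentScalar _) (μ.eval s) * μ.point := by
  let π : ℂ[T;T⁻¹] ⊗[ℂ] ℂ[T;T⁻¹] →ₐ[ℂ] ℂ[T;T⁻¹] :=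
    Algebra.TensorProduct.lift ((Algebra.ofId ℂ _).comp (laurentHom s)) (AlgHom.id ℂ _)
      fun _ _ => .all _ _
  have hπ : π.comp (Bialgebra.comulAlgHom ℂ ℂ[T;T⁻¹]) = laurentHom (laurentScale s) := by
    apply laurentHom_ext
    simp [π, laurentScale, Algebra.ofId_apply]
  refine Points.ext fun a => ?_
  have h := DFunLike.congr_fun hπ (μ.point a)
  rw [AlgHom.comp_apply, Bialgebra.comulAlgHom_apply, Cocharacter.comul_point] at h
  refine h.symm.trans ?_
  have h2 := (Coalgebra.Repr.arbitrary ℚ a).eq.symm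
  rw [Points.mul_apply_of_comul _ h2, h2]
  simp [π]
  rfl

theorem Cocharacter.eval_one (μ : Cocharacter A) : μ.eval 1 = 1 := by
  have h : laurentHom (1 : ℂˣ) = Bialgebra.counitAlgHom ℂ ℂ[T;T⁻¹] := by
    apply laurentHom_ext
    simp
  refine Points.ext fun a => ?_
  exact (DFunLike.congr_fun h (μ.point a)).trans (μ.counit_point a)

end Cocharacters

/-! ### The centralizer of a cocharacter maps onto torus quotients -/

section Centralizer

open ConvForm

variable {A : Type u} [CommRing A] [HopfAlgebra ℚ A]

/-- The linear form `φ ∘ F`. -/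
def ConvForm.map {R S : Type*} [CommRing R] [Algebra ℚ R] [CommRing S] [Algebra ℚ S]
    (φ : R →ₐ[ℚ] S) : WithConv (A →ₗ[ℚ] R) →* WithConv (A →ₗ[ℚ] S) where
  toFun F := toConv (φ.toLinearMap ∘ₗ F.ofConv)
  map_one' := by
    apply WithConv.ofConv_injective
    ext a
    exact φ.commutes _
  map_mul' F G := congrArg toConv (LinearMap.algHom_comp_convMul_distrib φ F G)

theorem laurentScalar_apply (c : ℂ) :
    laurentScalar ℂ[T;T⁻¹] c = LaurentPolynomial.C c := rfl

/-- Taking a coefficient is `ℂ`-linear, so it commutes with convolution by constant points on either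
side. -/
theorem laurentCoeff_conj (n : ℤ) (g h : Points ℚ A ℂ) (F : WithConv (A →ₗ[ℚ] ℂ[T;T⁻¹])) :
    toConv ((laurentCoeff n).restrictScalars ℚ ∘ₗ
      (ofPoint (Points.map (laurentScalar _) g) * F *
        ofPoint (Points.map (laurentScalar _) h)).ofConv) =
      ofPoint g * toConv ((laurentCoeff n).restrictScalars ℚ ∘ₗ F.ofConv) * ofPoint h := by
  have hl (c : ℂ) (p : ℂ[T;T⁻¹]) :
      laurentCoeff n (laurentScalar _ c * p) = c * laurentCoeff n p := by
    rw [laurentScalar_apply, ← LaurentPolynomial.smul_eq_C_mul, map_smul, smul_eq_mul]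
  have h1 (F : WithConv (A →ₗ[ℚ] ℂ[T;T⁻¹])) :
      toConv ((laurentCoeff n).restrictScalars ℚ ∘ₗ
        (ofPoint (Points.map (laurentScalar _) g) * F).ofConv) =
      ofPoint g * toConv ((laurentCoeff n).restrictScalars ℚ ∘ₗ F.ofConv) := by
    apply WithConv.ofConv_injective
    ext a
    have h := (Coalgebra.Repr.arbitrary ℚ a).eq.symm
    refine (congrArg (laurentCoeff n) (ConvForm.mul_apply_of_comul _ h _ _)).trans
      (Eq.trans ?_ (ConvForm.mul_apply_of_comul _ h _ _).symm)
    rw [map_sum]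
    exact Finset.sum_congr rfl fun i _ => hl _ _
  have h2 (F : WithConv (A →ₗ[ℚ] ℂ[T;T⁻¹])) :
      toConv ((laurentCoeff n).restrictScalars ℚ ∘ₗ
        (F * ofPoint (Points.map (laurentScalar _) h)).ofConv) =
      toConv ((laurentCoeff n).restrictScalars ℚ ∘ₗ F.ofConv) * ofPoint h := by
    apply WithConv.ofConv_injective
    ext a
    have h := (Coalgebra.Repr.arbitrary ℚ a).eq.symm
    refine (congrArg (laurentCoeff n) (ConvForm.mul_apply_of_comul _ h _ _)).trans
      (Eq.trans ?_ (ConvForm.mul_apply_of_comul _ h _ _).symm)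
    rw [map_sum]
    refine Finset.sum_congr rfl fun i _ => ?_
    rw [mul_comm]
    exact (hl _ _).trans (mul_comm _ _)
  rw [h2, h1]

theorem laurentCoeff_zero_scale (s : ℂˣ) (p : ℂ[T;T⁻¹]) :
    laurentCoeff 0 (laurentHom (laurentScale s) p) = laurentCoeff 0 p := by
  induction p using LaurentPolynomial.induction_on' with
  | add p q hp hq => simp only [map_add, hp, hq]
  | C_mul_T n c =>
    have h : laurentHom (laurentScale s) (LaurentPolynomial.C c * LaurentPolynomial.T n) =
        LaurentPolynomial.C (c * (s ^ n : ℂˣ)) * LaurentPolynomial.T n := by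
      rw [map_mul, map_mul, laurentHom_T, mul_assoc]
      congr 1
      · exact (laurentHom (laurentScale s)).commutes c
      · rw [laurentScale, mul_zpow, Units.val_mul, ← _root_.map_zpow]
        congr 1
        have h (m : ℤ) : (((LaurentPolynomial.isUnit_T (R := ℂ) 1).unit ^ m : ℂ[T;T⁻¹]ˣ) :
            ℂ[T;T⁻¹]) = LaurentPolynomial.T m := by
          have h1 : laurentHom (LaurentPolynomial.isUnit_T (R := ℂ) 1).unit = AlgHom.id ℂ _ :=
            laurentHom_ext (by simp)
          rw [← laurentHom_T, h1, AlgHom.id_apply]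
        exact h n
    rw [h, laurentCoeff_C_mul_T, laurentCoeff_C_mul_T]
    split_ifs with hn
    · simp [hn]
    · rfl

/-- The projection of `Lie(G_ℂ)` onto the part fixed by a cocharacter does not change the
differentials of the characters of `G`. -/
theorem exists_isPointDerivation_commute (μ : Cocharacter A) {D : WithConv (A →ₗ[ℚ] ℂ)}
    (hD : IsPointDerivation D.ofConv) :
    ∃ D₀ : WithConv (A →ₗ[ℚ] ℂ), IsPointDerivation D₀.ofConv ∧
      (∀ a, IsGroupLikeElem ℚ a → D₀ a = D a) ∧ ∀ s, Commute (ofPoint (μ.eval s)) D₀ := by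
  let DL := ConvForm.map (laurentScalar ℂ[T;T⁻¹]) D
  have hDL : IsPointDerivation DL.ofConv := fun a b => by
    refine (congrArg (laurentScalar ℂ[T;T⁻¹]) (hD a b)).trans ?_
    rw [map_add, map_smul, map_smul]
    rfl
  -- `P` is `Ad(μ(T)) D`, a Laurent polynomial whose coefficients are the weight components of `D`;
  -- `D₀` is its constant term.
  let P := ofPoint μ.point * DL * ofPoint μ.point⁻¹
  have hP : IsPointDerivation P.ofConv := isPointDerivation_conj _ hDL
  let D₀ : WithConv (A →ₗ[ℚ] ℂ) := toConv ((laurentCoeff 0).restrictScalars ℚ ∘ₗ P.ofConv)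
  refine ⟨D₀, fun a b => ?_, fun a ha => ?_, fun s => ?_⟩
  · refine (congrArg (laurentCoeff 0) (hP a b)).trans ?_
    rw [map_add, LinearMap.map_smul_of_tower, LinearMap.map_smul_of_tower]
    rfl
  · have h1 : P a = LaurentPolynomial.C (D a) := by
      have h2 : ∀ F G : WithConv (A →ₗ[ℚ] ℂ[T;T⁻¹]), (F * G) a = F a * G a := fun F G => by
        rw [LinearMap.convMul_apply, ha.comul_eq_tmul_self]
        simp
      have h3 : ofPoint μ.point a * ofPoint μ.point⁻¹ a = 1 := by
        rw [← h2, ofPoint_mul_inv, LinearMap.convOne_apply, ha.counit_eq_one, map_one]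
      change (ofPoint μ.point * DL * ofPoint μ.point⁻¹) a = _
      rw [h2, h2, mul_right_comm, h3, one_mul]
      rfl
    refine (congrArg (laurentCoeff 0) h1).trans ?_
    have := laurentCoeff_C_mul_T 0 0 (D a)
    simpa using this
  -- The substitution `T ↦ sT` turns `P` into `Ad(μ(s)) P` and preserves constant terms, so `D₀` is
  -- fixed by `Ad(μ(s))`.
  · have h1 : ConvForm.map ((laurentHom (laurentScale s)).restrictScalars ℚ) P =
        ofPoint (Points.map (laurentScalar _) (μ.eval s)) * P *
          ofPoint (Points.map (laurentScalar _) (μ.eval s)⁻¹) := by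
      have h2 (g : Points ℚ A ℂ[T;T⁻¹]) :
          ConvForm.map ((laurentHom (laurentScale s)).restrictScalars ℚ) (ofPoint g) =
          ofPoint (Points.map ((laurentHom (laurentScale s)).restrictScalars ℚ) g) := rfl
      have h3 : ConvForm.map ((laurentHom (laurentScale s)).restrictScalars ℚ) DL = DL := by
        apply WithConv.ofConv_injective
        refine LinearMap.ext fun a => ?_
        exact (laurentHom (laurentScale s)).commutes (D a)
      rw [_root_.map_mul, _root_.map_mul, h2, h2, h3, Points.map_inv, μ.map_scale_point, mul_inv_rev,
        _root_.map_mul, _root_.map_mul, Points.map_inv]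
      simp only [P, mul_assoc]
    have h2 : toConv ((laurentCoeff 0).restrictScalars ℚ ∘ₗ
        (ConvForm.map ((laurentHom (laurentScale s)).restrictScalars ℚ) P).ofConv) = D₀ := by
      apply WithConv.ofConv_injective
      ext a
      exact laurentCoeff_zero_scale s (P a)
    rw [h1, laurentCoeff_conj] at h2
    change ofPoint (μ.eval s) * D₀ * ofPoint (μ.eval s)⁻¹ = D₀ at h2
    rw [commute_iff_eq]
    conv_rhs => rw [← h2, mul_assoc, ofPoint_inv_mul, mul_one]

theorem monoidHom_ext_of_piSingle {M : Type*} [CommMonoid M] {n : ℕ}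
    {φ ψ : Multiplicative (Fin n → ℤ) →* M}
    (h : ∀ i, φ (.ofAdd (Pi.single i 1)) = ψ (.ofAdd (Pi.single i 1))) : φ = ψ := by
  apply MonoidHom.toAdditiveRight.injective
  refine AddMonoidHom.functions_ext' _ _ _ fun i => AddMonoidHom.ext_int ?_
  exact h i

/-- Every point of a torus quotient of `G` lifts to the centralizer of a given cocharacter. -/
theorem exists_commute_apply_eq [Algebra.FiniteType ℚ A] (μ : Cocharacter A) {n : ℕ}
    (j : AddMonoidAlgebra ℚ (Fin n → ℤ) →ₐc[ℚ] A) (hj : Function.Injective j)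
    (g : Points ℚ A ℂ) :
    ∃ z : Points ℚ A ℂ, Commute (Points.map (laurentScalar _) z) μ.point ∧
      ∀ b, z (j b) = g (j b) := by
  have hgl (v : Fin n → ℤ) : IsGroupLikeElem ℚ (j (.single v 1)) :=
    IsGroupLikeElem.map j ⟨by simp, by simp⟩
  choose D hD hDj using exists_isPointDerivation j hj
  -- Logarithms of the coordinates of the image of `g` in the torus. `E` has these as derivatives of
  -- the basic characters, so the exponential of its weight zero part has the required image.
  let t (i : Fin n) : ℂ := Complex.log (g (j (.single (Pi.single i 1) 1)))
  let E : WithConv (A →ₗ[ℚ] ℂ) := toConv (∑ i, t i • (Algebra.linearMap ℚ ℂ ∘ₗ D i))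
  have hE : IsPointDerivation E.ofConv := fun a b => by
    simp only [E, LinearMap.sum_apply, LinearMap.smul_apply, LinearMap.comp_apply,
      hD _ a b, map_add, map_smul, smul_add, Finset.sum_add_distrib, Finset.smul_sum]
    simp only [smul_comm (t _)]
  have hEj (i : Fin n) : E (j (.single (Pi.single i 1) 1)) = t i := by
    change (∑ i, t i • (Algebra.linearMap ℚ ℂ ∘ₗ D i)) _ = _
    rw [LinearMap.sum_apply, Finset.sum_eq_single i]
    · simp [hDj]
    · intro l _ hl
      simp [hDj, Pi.single_eq_of_ne hl]
    · simp
  obtain ⟨D₀, hD₀, hgr, hcomm⟩ := exists_isPointDerivation_commute μ hE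
  obtain ⟨z, hz⟩ := exists_exp hD₀
  refine ⟨z, ?_, fun b => ?_⟩
  -- A Laurent polynomial is determined by its values on `ℂˣ`, so it suffices that `z` commutes with
  -- every `μ(s)`.
  · refine Points.ext fun a => eq_of_laurentHom_eq fun s => ?_
    have h := commute_exp hz (hcomm s)
    have h1 : Points.map ((laurentHom s).restrictScalars ℚ) (Points.map (laurentScalar _) z) = z :=
      Points.ext fun a => (laurentHom s).commutes (z a)
    have h2 := congrArg (fun x : Points ℚ A ℂ => x a) h.eq.symm
    rw [← h1, Cocharacter.eval, ← Points.map_mul, ← Points.map_mul] at h2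
    exact h2
  · have h : ((z.ofConv.comp (j : AddMonoidAlgebra ℚ (Fin n → ℤ) →ₐ[ℚ] A)) : _ →* ℂ).comp
        (AddMonoidAlgebra.of ℚ (Fin n → ℤ)) =
        ((g.ofConv.comp (j : AddMonoidAlgebra ℚ (Fin n → ℤ) →ₐ[ℚ] A)) : _ →* ℂ).comp
        (AddMonoidAlgebra.of ℚ (Fin n → ℤ)) := by
      refine monoidHom_ext_of_piSingle fun i => ?_
      change z (j (.single (Pi.single i 1) 1)) = g (j (.single (Pi.single i 1) 1))
      have h0 : g (j (.single (Pi.single i 1) 1)) ≠ 0 := by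
        intro h0
        have h1 : g (j (.single (Pi.single i 1) 1) * j (.single (-Pi.single i 1) 1)) = 1 := by
          rw [← map_mul, AddMonoidAlgebra.single_mul_single, add_neg_cancel, mul_one]
          exact (congrArg g.ofConv (map_one j)).trans (map_one g.ofConv)
        have h2 : g (j (.single (Pi.single i 1) 1) * j (.single (-Pi.single i 1) 1)) =
          g (j (.single (Pi.single i 1) 1)) * g (j (.single (-Pi.single i 1) 1)) :=
            map_mul g.ofConv _ _
        rw [h2, h0, zero_mul] at h1
        exact zero_ne_one h1
      rw [exp_apply_of_isGroupLikeElem hz (hgl _), hgr _ (hgl _), hEj, Complex.exp_log h0]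
    exact DFunLike.congr_fun (AddMonoidAlgebra.algHom_ext' h (Subsingleton.elim _ _)) b

end Centralizer

/-! ### Central tori -/

section CentralTorus

variable {k : Type v} [Field k] {A : Type u} [CommRing A] [HopfAlgebra k A]

/-- A split torus has connected fibres: modulo a prime of `B` the group algebra is a domain, so the
idempotent becomes `0` or `1`, and the counit forces `0`. Its coefficients thus lie in the
nilradical. -/
theorem AddMonoidAlgebra.eq_zero_of_isIdempotentElem {B : Type*} [CommRing B] [IsReduced B]
    {n : ℕ} {e : AddMonoidAlgebra B (Fin n → ℤ)} (he : IsIdempotentElem e)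
    (h0 : Coalgebra.counit (R := B) e = 0) : e = 0 := by
  ext v
  have h : e.coeff v ∈ nilradical B := by
    rw [nilradical_eq_sInf, Ideal.mem_sInf]
    intro P hP
    have : P.IsPrime := hP
    let ρ := AddMonoidAlgebra.mapRingHom (Fin n → ℤ) (Ideal.Quotient.mk P)
    have h1 : ρ e = 0 := by
      rcases IsIdempotentElem.iff_eq_zero_or_one.mp (he.map ρ) with h | h
      · exact h
      · have h2 := DFunLike.congr_fun
          (AddMonoidAlgebra.counitAlgHom_comp_mapRingHom (M := Fin n → ℤ) (Ideal.Quotient.mk P)) e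
        have h3 : Coalgebra.counit (R := B ⧸ P) (ρ e) =
          Ideal.Quotient.mk P (Coalgebra.counit (R := B) e) := h2
        rw [h, h0, map_zero] at h3
        simp at h3
    have h2 : (ρ e).coeff v = Ideal.Quotient.mk P (e.coeff v) := by simp [ρ]
    rw [h1] at h2
    exact Ideal.Quotient.eq_zero_iff_mem.mp h2.symm
  rw [nilradical_eq_zero] at h
  exact h

theorem eq_zero_of_isIdempotentElem_tmul [IsReduced A] {n : ℕ}
    {e : A ⊗[k] AddMonoidAlgebra k (Fin n → ℤ)} (he : IsIdempotentElem e)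
    (h0 : Algebra.TensorProduct.map (AlgHom.id k A)
      (Bialgebra.counitAlgHom k (AddMonoidAlgebra k (Fin n → ℤ))) e = 0) : e = 0 := by
  let Φ := AddMonoidAlgebra.scalarTensorEquiv k A (M := Fin n → ℤ)
  have h : (Algebra.TensorProduct.rid k k A : A ⊗[k] k →ₐ[k] A).comp
      (Algebra.TensorProduct.map (AlgHom.id k A)
        (Bialgebra.counitAlgHom k (AddMonoidAlgebra k (Fin n → ℤ)))) =
      ((Bialgebra.counitAlgHom A (AddMonoidAlgebra A (Fin n → ℤ))).comp
        (Φ : _ →ₐ[A] _)).restrictScalars k := by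
    apply Algebra.TensorProduct.ext
    · ext a
      simp [Φ]
    · refine AddMonoidAlgebra.algHom_ext (fun v => ?_) (Subsingleton.elim _ _)
      simp [Φ]
  have h1 := DFunLike.congr_fun h e
  refine Φ.injective (Eq.trans ?_ (map_zero Φ).symm)
  refine AddMonoidAlgebra.eq_zero_of_isIdempotentElem (he.map Φ) (h1.symm.trans ?_)
  rw [AlgHom.comp_apply, h0, map_zero]

/-- Two points with values in `R` of a group factor through the same quotient if they agree on it. -/
theorem exists_comp_eq_of_surjective {B C R : Type*} [CommRing B] [Algebra k B] [CommRing C]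
    [Algebra k C] [CommRing R] [Algebra k R] (p : B →ₐ[k] C) (hp : Function.Surjective p)
    (g : B →ₐ[k] R) (hg : ∀ b, p b = 0 → g b = 0) : ∃ g' : C →ₐ[k] R, ∀ b, g' (p b) = g b :=
  ⟨AlgHom.liftOfSurjective p hp g hg, fun b => AlgHom.liftOfSurjective_apply p hp g hg b⟩

variable {A' : Type u'} [CommRing A'] [HopfAlgebra k A'] {f : A' →ₐc[k] A}

theorem Points.apply_eq_zero_of_mem_kerIdeal {R : Type*} [CommRing R] [Algebra k R]
    {g : Points k A R} (hg : Points.push f g = 1) {a : A} (ha : a ∈ kerIdeal f) : g a = 0 := by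
  have h : kerIdeal f ≤ RingHom.ker g.ofConv := by
    rw [kerIdeal, Ideal.map_le_iff_le_comap]
    intro b hb
    have h1 := congrArg (fun x : Points k A' R => x b) hg
    have hb : Coalgebra.counit (R := k) b = 0 := hb
    have h2 : g (f b) = algebraMap k R (Coalgebra.counit b) := h1
    rw [hb, map_zero] at h2
    exact h2
  exact h ha

/-- If the neutral component of `Ker f` is the split torus defined by `p`, then a point of `Ker f`
lies in it if idempotents that vanish at the identity vanish at the point. -/
theorem Points.apply_eq_zero_of_neutralIdeal {H R : Type*} [CommRing H] [HopfAlgebra k H]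
    [CommRing R] [Algebra k R] {φ : A ⧸ kerIdeal f →ₐc[k] H}
    (hφ : RingHom.ker φ = neutralIdeal k (A ⧸ kerIdeal f)) {g : Points k A R}
    (hg : Points.push f g = 1)
    (hR : ∀ a, Coalgebra.counit (R := k) a = 0 → IsIdempotentElem (g a) → g a = 0) {a : A}
    (ha : φ (Ideal.Quotient.mk _ a) = 0) : g a = 0 := by
  let g' : A ⧸ kerIdeal f →ₐ[k] R :=
    Ideal.Quotient.liftₐ _ g.ofConv fun a ha => g.apply_eq_zero_of_mem_kerIdeal hg ha
  have h : neutralIdeal k (A ⧸ kerIdeal f) ≤ RingHom.ker g' := by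
    rw [neutralIdeal, Ideal.span_le]
    rintro e ⟨he, h0⟩
    obtain ⟨a, rfl⟩ := Ideal.Quotient.mk_surjective e
    exact hR a h0 (he.map g')
  rw [← hφ] at h
  exact h ha

end CentralTorus

/-! ### Normal split tori in connected groups are central -/

section Rigidity

variable {k : Type v} [Field k] {A : Type u} [CommRing A] [HopfAlgebra k A]
  {H : Type*} [CommRing H] [HopfAlgebra k H]

theorem map_counit_conj (p : A →ₐc[k] H) {x t : Points k A (A ⊗[k] H)}
    (ht : ∀ a, t a = 1 ⊗ₜ p a) :
    Points.map (Algebra.TensorProduct.map (AlgHom.id k A) (Bialgebra.counitAlgHom k H))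
      (x * t * x⁻¹) = 1 := by
  set φ := Algebra.TensorProduct.map (AlgHom.id k A) (Bialgebra.counitAlgHom k H)
  have ht' : Points.map φ t = 1 := Points.ext fun b => by
    rw [Points.map_apply, ht, Points.one_apply]
    rw [Algebra.TensorProduct.map_tmul, map_one, Bialgebra.counitAlgHom_apply,
      CoalgHomClass.counit_comp_apply, Algebra.TensorProduct.algebraMap_apply']
    rfl
  rw [Points.map_mul, Points.map_mul, ht', mul_one, ← Points.map_mul, mul_inv_cancel,
    Points.map_one]

variable [IsReduced A] [ConnectedSpace (PrimeSpectrum A)]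

/-- The conjugates of a character of the subgroup by `x ∈ G` form a family of group-like elements
over the connected base `G`. Rigidity makes the family constant, and at `x = 1` it is the character
itself. -/
theorem apply_groupLike_of_conj (p : A →ₐc[k] H) {x t : Points k A (A ⊗[k] H)}
    (hx : ∀ a, x a = a ⊗ₜ 1) (ht : ∀ a, t a = 1 ⊗ₜ p a) (w : H →ₐ[k] A ⊗[k] H)
    (hw : ∀ b, w (p b) = (x * t * x⁻¹) b) {a : A} {h : H} (ha : p a = h)
    (hh : IsGroupLikeElem k h) : w h = 1 ⊗ₜ h := by
  have hε : Coalgebra.counit (R := k) a = 1 := by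
    rw [← CoalgHomClass.counit_comp_apply p a, ha, hh.counit_eq_one]
  have h₁ : Algebra.TensorProduct.map (AlgHom.id k A)
      (Bialgebra.counitAlgHom k H) (w h) = 1 := by
    set φ := Algebra.TensorProduct.map (AlgHom.id k A)
      (Bialgebra.counitAlgHom k H)
    have h2 := map_counit_conj p (x := x) ht
    have h3 := congrArg (fun y : Points k A (A ⊗[k] k) => y a) h2
    rw [← ha, hw]
    refine h3.trans ?_
    rw [Points.one_apply, hε, map_one]
  have h₂ : Algebra.TensorProduct.map (AlgHom.id k A)
      (Bialgebra.comulAlgHom k H) (w h) =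
      Algebra.TensorProduct.map (AlgHom.id k A) Algebra.TensorProduct.includeLeft
        (w h) *
      Algebra.TensorProduct.map (AlgHom.id k A) Algebra.TensorProduct.includeRight
        (w h) := by
    set c := Algebra.TensorProduct.map (AlgHom.id k A)
      (Bialgebra.comulAlgHom k H)
    set l : A ⊗[k] H →ₐ[k] _ :=
      Algebra.TensorProduct.map (AlgHom.id k A) (Algebra.TensorProduct.includeLeft (R := k) (S := k)
        (A := H) (B := H))
    set r : A ⊗[k] H →ₐ[k] _ :=
      Algebra.TensorProduct.map (AlgHom.id k A) (Algebra.TensorProduct.includeRight (R := k)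
        (A := H) (B := H))
    have hxl : Points.map (S := A ⊗[k] (H ⊗[k] H)) c x = Points.map (S := A ⊗[k] (H ⊗[k] H)) l x := Points.ext fun b => by
      rw [Points.map_apply, Points.map_apply, hx]
      simp [c, l, Algebra.TensorProduct.one_def]
    have hxr : Points.map (S := A ⊗[k] (H ⊗[k] H)) c x = Points.map (S := A ⊗[k] (H ⊗[k] H)) r x := Points.ext fun b => by
      rw [Points.map_apply, Points.map_apply, hx]
      simp [c, r, Algebra.TensorProduct.one_def]
    have ht' : Points.map (S := A ⊗[k] (H ⊗[k] H)) c t = Points.map (S := A ⊗[k] (H ⊗[k] H)) l t * Points.map (S := A ⊗[k] (H ⊗[k] H)) r t := Points.ext fun b => by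
      have hb := (Coalgebra.Repr.arbitrary k b).eq.symm
      rw [Points.mul_apply_of_comul _ hb, Points.map_apply, ht, Algebra.TensorProduct.map_tmul,
        map_one, Bialgebra.comulAlgHom_apply, ← CoalgHomClass.map_comp_comul_apply p b]
      conv_lhs => rw [hb]
      rw [map_sum, TensorProduct.tmul_sum]
      refine Finset.sum_congr rfl fun i _ => ?_
      rw [Points.map_apply, Points.map_apply, ht, ht]
      simp [l, r]
    have h2 : Points.map (S := A ⊗[k] (H ⊗[k] H)) c (x * t * x⁻¹) =
        Points.map (S := A ⊗[k] (H ⊗[k] H)) l (x * t * x⁻¹) * Points.map (S := A ⊗[k] (H ⊗[k] H)) r (x * t * x⁻¹) := by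
      simp only [Points.map_mul, Points.map_inv, ht', ← hxl, ← hxr]
      group
    have hl : Points.map (S := A ⊗[k] (H ⊗[k] H)) l (x * t * x⁻¹) = Points.push p (toConv (l.comp w)) :=
      Points.ext fun b => congrArg l (hw b).symm
    have hr : Points.map (S := A ⊗[k] (H ⊗[k] H)) r (x * t * x⁻¹) = Points.push p (toConv (r.comp w)) :=
      Points.ext fun b => congrArg r (hw b).symm
    rw [hl, hr, ← _root_.map_mul] at h2
    have h3 := congrArg (fun y : Points k A _ => y a) h2
    have h4 : c (w (p a)) = (toConv (l.comp w) * toConv (r.comp w) :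
        Points k (H) _) (p a) := by
      rw [hw]
      exact h3
    rw [ha, Points.mul_apply_of_isGroupLikeElem _ _ hh.comul_eq_tmul_self] at h4
    exact h4
  have h3 := eq_one_tmul_of_groupLike (Bialgebra.counitAlgHom k A) _ h₁ h₂
  rw [h3]
  congr 1
  set S := Algebra.TensorProduct.lift ((Algebra.ofId k H).comp
    (Bialgebra.counitAlgHom k A)) (AlgHom.id k _) (fun _ _ => .all _ _)
  have hxS : Points.map S x = 1 := Points.ext fun b => by
    rw [Points.map_apply, hx, Points.one_apply]
    simp [S, Algebra.ofId_apply]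
  have h4 : Points.map S (x * t * x⁻¹) = Points.map S t := by
    rw [Points.map_mul, Points.map_mul, Points.map_inv, hxS, inv_one, one_mul, mul_one]
  have h5 := congrArg (fun y : Points k A _ => y a) h4
  rw [← ha, hw]
  refine h5.trans ?_
  change S (t a) = _
  rw [ht, Algebra.TensorProduct.lift_tmul, map_one, one_mul]
  rfl

/-- A normal split torus in a connected group is central. -/
theorem conj_eq_of_normal_torus {n : ℕ} (p : A →ₐc[k] AddMonoidAlgebra k (Fin n → ℤ))
    (hp : Function.Surjective p) {x t : Points k A (A ⊗[k] AddMonoidAlgebra k (Fin n → ℤ))}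
    (hx : ∀ a, x a = a ⊗ₜ 1) (ht : ∀ a, t a = 1 ⊗ₜ p a)
    (h : ∀ a, p a = 0 → (x * t * x⁻¹) a = 0) : x * t * x⁻¹ = t := by
  obtain ⟨w, hw⟩ := exists_comp_eq_of_surjective (p : A →ₐ[k] AddMonoidAlgebra k (Fin n → ℤ)) hp
    (x * t * x⁻¹).ofConv h
  replace hw (b : A) : w (p b) = (x * t * x⁻¹) b := hw b
  have hwr : w = Algebra.TensorProduct.includeRight :=
    AddMonoidAlgebra.algHom_ext (fun v => by
      obtain ⟨a, ha⟩ := hp (.single v 1)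
      exact apply_groupLike_of_conj p hx ht w hw ha ⟨by simp, by simp⟩) (Subsingleton.elim _ _)
  refine Points.ext fun b => ?_
  rw [← hw, hwr, ht]
  rfl

/-- The points of a normal split torus in a connected group are central. -/
theorem commute_of_normal_torus {n : ℕ} (p : A →ₐc[k] AddMonoidAlgebra k (Fin n → ℤ))
    (hp : Function.Surjective p)
    (h : ∀ x t : Points k A (A ⊗[k] AddMonoidAlgebra k (Fin n → ℤ)), (∀ a, t a = 1 ⊗ₜ p a) →
      ∀ a, p a = 0 → (x * t * x⁻¹) a = 0)
    {R : Type*} [CommRing R] [Algebra k R] (x g : Points k A R) (hg : ∀ a, p a = 0 → g a = 0) :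
    Commute x g := by
  obtain ⟨g', hg'⟩ := exists_comp_eq_of_surjective (p : A →ₐ[k] AddMonoidAlgebra k (Fin n → ℤ)) hp
    g.ofConv hg
  let x₀ : Points k A (A ⊗[k] AddMonoidAlgebra k (Fin n → ℤ)) :=
    toConv Algebra.TensorProduct.includeLeft
  let t₀ : Points k A (A ⊗[k] AddMonoidAlgebra k (Fin n → ℤ)) :=
    toConv (Algebra.TensorProduct.includeRight.comp (p : A →ₐ[k] AddMonoidAlgebra k (Fin n → ℤ)))
  have hc := conj_eq_of_normal_torus p hp (x := x₀) (t := t₀) (fun _ => rfl) (fun _ => rfl)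
    (h x₀ t₀ fun _ => rfl)
  let φ : A ⊗[k] AddMonoidAlgebra k (Fin n → ℤ) →ₐ[k] R :=
    Algebra.TensorProduct.lift x.ofConv g' fun _ _ => .all _ _
  have hx : Points.map φ x₀ = x := Points.ext fun a => by
    change φ (a ⊗ₜ 1) = _
    simp [φ]
  have ht : Points.map φ t₀ = g := Points.ext fun a => by
    change φ (1 ⊗ₜ p a) = _
    rw [Algebra.TensorProduct.lift_tmul, map_one, one_mul]
    exact hg' a
  have h2 := congrArg (Points.map φ) (mul_inv_eq_iff_eq_mul.mp hc)
  rw [Points.map_mul, Points.map_mul, hx, ht] at h2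
  exact h2

end Rigidity

/-! ### Isotypic functions for a torus acting by translations -/

section Isotypic

variable {k A H : Type*} [Field k] [CommRing A] [HopfAlgebra k A] [CommRing H] [HopfAlgebra k H]

/-- The coaction on `𝒪(G)` of the subgroup given by `p`, acting by left translations. -/
def leftCoaction (p : A →ₐc[k] H) : A →ₗ[k] H ⊗[k] A :=
  (p : A →ₗ[k] H).rTensor A ∘ₗ Coalgebra.comul

theorem leftCoaction_coassoc (p : A →ₐc[k] H) (a : A) :
    TensorProduct.assoc k H H A ((Coalgebra.comul (R := k)).rTensor A (leftCoaction p a)) =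
      (leftCoaction p).lTensor H (leftCoaction p a) := by
  let P := (p : A →ₗ[k] H)
  have h1 (t : A ⊗[k] A) : TensorProduct.assoc k H H A
      ((Coalgebra.comul (R := k)).rTensor A (P.rTensor A t)) =
      TensorProduct.map P (P.rTensor A)
        (TensorProduct.assoc k A A A ((Coalgebra.comul (R := k)).rTensor A t)) := by
    induction t with
    | zero => simp
    | add x y hx hy => simp only [map_add, hx, hy]
    | tmul x y =>
      have h2 : Coalgebra.comul (R := k) (P x) = TensorProduct.map P P (Coalgebra.comul x) :=
        (CoalgHomClass.map_comp_comul_apply p x).symm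
      rw [LinearMap.rTensor_tmul, LinearMap.rTensor_tmul, LinearMap.rTensor_tmul, h2]
      induction Coalgebra.comul (R := k) x with
      | zero => simp
      | add x y hx hy => simp only [map_add, TensorProduct.add_tmul, hx, hy]
      | tmul x y => simp
  have h2 (t : A ⊗[k] A) : (leftCoaction p).lTensor H (P.rTensor A t) =
      TensorProduct.map P (P.rTensor A) ((Coalgebra.comul (R := k)).lTensor A t) := by
    induction t with
    | zero => simp
    | add x y hx hy => simp only [map_add, hx, hy]
    | tmul x y => rfl
  change TensorProduct.assoc k H H A
      ((Coalgebra.comul (R := k)).rTensor A (P.rTensor A (Coalgebra.comul a))) =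
    (leftCoaction p).lTensor H (P.rTensor A (Coalgebra.comul a))
  rw [h1, h2, Coalgebra.coassoc_apply]

theorem counit_lTensor_leftCoaction (p : A →ₐc[k] H) (a : A) :
    TensorProduct.rid k H ((Coalgebra.counit (R := k)).lTensor H (leftCoaction p a)) = p a := by
  have h := congrArg (fun t => TensorProduct.rid k H ((p : A →ₗ[k] H).rTensor k t))
    (Coalgebra.lTensor_counit_comul (R := k) a)
  have h2 (t : A ⊗[k] A) : (Coalgebra.counit (R := k)).lTensor H
      ((p : A →ₗ[k] H).rTensor A t) =
      (p : A →ₗ[k] H).rTensor k ((Coalgebra.counit (R := k)).lTensor A t) := by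
    rw [← LinearMap.comp_apply, ← LinearMap.comp_apply, LinearMap.lTensor_comp_rTensor,
      LinearMap.rTensor_comp_lTensor]
  change TensorProduct.rid k H ((Coalgebra.counit (R := k)).lTensor H
    ((p : A →ₗ[k] H).rTensor A (Coalgebra.comul a))) = _
  rw [h2]
  refine h.trans ?_
  simp

theorem Points.mul_apply_of_leftCoaction {R : Type*} [CommRing R] [Algebra k R] (p : A →ₐc[k] H)
    {g y : Points k A R} {g' : H →ₐ[k] R} (hg : ∀ a, g a = g' (p a)) {b : A} {h : H}
    (hb : leftCoaction p b = h ⊗ₜ b) : (g * y) b = g' h * y b := by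
  have h1 (t : A ⊗[k] A) : Algebra.TensorProduct.lift g.ofConv y.ofConv (fun _ _ => .all _ _) t =
      Algebra.TensorProduct.lift g' y.ofConv (fun _ _ => .all _ _)
        ((p : A →ₗ[k] H).rTensor A t) := by
    induction t with
    | zero => simp
    | add x y hx hy => simp only [map_add, hx, hy]
    | tmul x y =>
      rw [LinearMap.rTensor_tmul, Algebra.TensorProduct.lift_tmul, Algebra.TensorProduct.lift_tmul]
      exact congrArg (· * _) (hg x)
  rw [Points.mul_apply, h1]
  refine (congrArg _ hb).trans ?_
  exact Algebra.TensorProduct.lift_tmul _ _ _ _ _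

/-- Every character of a torus in `G` occurs in the regular representation, on a function that does
not vanish at the identity. -/
theorem exists_leftCoaction_eq {n : ℕ} (p : A →ₐc[k] AddMonoidAlgebra k (Fin n → ℤ))
    (hp : Function.Surjective p) (v : Fin n → ℤ) :
    ∃ b, Coalgebra.counit (R := k) b = 1 ∧ leftCoaction p b = .single v 1 ⊗ₜ b := by
  classical
  obtain ⟨a, ha⟩ := hp (.single v 1)
  let B := AddMonoidAlgebra.basis (Fin n → ℤ) k
  -- The `c i` are the isotypic components of a lift `a` of the character `v`. Coassociativity makes
  -- each an eigenvector, and comparing `p a = ∑ ε(c i) B i` with `B v` gives `ε(c v) = 1`.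
  let c : (Fin n → ℤ) →₀ A := TensorProduct.equivFinsuppOfBasisLeft B (leftCoaction p a)
  have hc : leftCoaction p a = ∑ i : c.support, B i ⊗ₜ[k] c i := by
    rw [Finset.sum_coe_sort c.support fun i => B i ⊗ₜ[k] c i,
      ← (TensorProduct.equivFinsuppOfBasisLeft B).symm_apply_apply (leftCoaction p a)]
    exact TensorProduct.equivFinsuppOfBasisLeft_symm_apply B c
  have hli : LinearIndependent k fun i : c.support => B i :=
    B.linearIndependent.comp _ Subtype.val_injective
  have h1 := leftCoaction_coassoc p a
  have h2 := counit_lTensor_leftCoaction p a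
  rw [hc] at h1 h2
  have hB (i) : Coalgebra.comul (R := k) (B i) = B i ⊗ₜ[k] B i := by simp [B]
  simp only [map_sum, LinearMap.rTensor_tmul, LinearMap.lTensor_tmul, TensorProduct.rid_tmul,
    TensorProduct.assoc_tmul, hB] at h1 h2
  have h3 := congrFun (eq_of_sum_tmul_eq hli h1)
  have h4 := congrArg (B.coord v) (h2.trans ha)
  have hv : B.coord v (.single v 1) = 1 := by
    have : B v = .single v 1 := rfl
    simp [← this]
  rw [hv, map_sum] at h4
  simp only [map_smul, Module.Basis.coord_apply, Module.Basis.repr_self] at h4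
  by_cases hvc : v ∈ c.support
  · rw [Finset.sum_eq_single ⟨v, hvc⟩ (fun w _ hw => by
      rw [Finsupp.single_eq_of_ne' fun h => hw (Subtype.ext h), smul_zero]) (by simp)] at h4
    refine ⟨c v, by simpa using h4, (h3 ⟨v, hvc⟩).symm⟩
  · rw [Finset.sum_eq_zero fun w _ => by
      have hw : (w : Fin n → ℤ) ≠ v := fun h => hvc (h ▸ w.2)
      rw [Finsupp.single_eq_of_ne' hw, smul_zero]] at h4
    exact absurd h4 zero_ne_one

end Isotypic

/-! ### Exponents of cocharacters and the vanishing of central discrepancies -/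

section Rigidity

variable {A : Type u} [CommRing A] [HopfAlgebra ℚ A]

/-- Clearing denominators in `u` and its inverse gives polynomials with product a power of the prime
`X`, so each is a monomial. -/
theorem laurent_eq_C_mul_T_of_isUnit {u : ℂ[T;T⁻¹]} (hu : IsUnit u) :
    ∃ (c : ℂ) (k : ℤ), u = LaurentPolynomial.C c * LaurentPolynomial.T k := by
  obtain ⟨w, hw⟩ := hu.exists_right_inv
  obtain ⟨n, f, hf⟩ := u.exists_T_pow
  obtain ⟨m, h, hh⟩ := w.exists_T_pow
  have hfh : f * h = Polynomial.X ^ (n + m) := by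
    apply Polynomial.toLaurent_injective
    rw [map_mul, hf, hh, map_pow, Polynomial.toLaurent_X, LaurentPolynomial.T_pow, mul_mul_mul_comm,
      hw, one_mul, ← LaurentPolynomial.T_add]
    simp
  obtain ⟨i, -, v, hv⟩ := (dvd_prime_pow Polynomial.prime_X _).mp ⟨h, hfh.symm⟩
  obtain ⟨c, -, hc⟩ := Polynomial.isUnit_iff.mp v⁻¹.isUnit
  have hf' : f = Polynomial.C c * Polynomial.X ^ i := by
    rw [← hv, hc, mul_comm, mul_assoc, ← Units.val_mul, mul_inv_cancel, Units.val_one, mul_one]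
  refine ⟨c, i + -n, ?_⟩
  rw [LaurentPolynomial.T_add, ← mul_assoc, ← Polynomial.toLaurent_C_mul_T,
    Polynomial.C_mul_X_pow_eq_monomial.symm, ← hf', hf, mul_assoc, ← LaurentPolynomial.T_add]
  simp

/-- The exponents which occur in the functions `b (x ν y)`, for `x` and `y` in `G(ℂ)`. -/
def exponents (b : A) (ν : Points ℚ A ℂ[T;T⁻¹]) : Set ℤ :=
  {m | ∃ x y : Points ℚ A ℂ, laurentCoeff m
    ((Points.map (laurentScalar ℂ[T;T⁻¹]) x * (ν * Points.map (laurentScalar ℂ[T;T⁻¹]) y)) b) ≠ 0}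

/-- Comultiplying `b` twice writes `b(xνy)` as a fixed finite sum in which `x` and `y` contribute
only scalars, so the exponents come from finitely many Laurent polynomials. -/
theorem exponents_finite (b : A) (ν : Points ℚ A ℂ[T;T⁻¹]) : (exponents b ν).Finite := by
  have hb := (Coalgebra.Repr.arbitrary ℚ b).eq.symm
  have hc (i) := (Coalgebra.Repr.arbitrary ℚ ((Coalgebra.Repr.arbitrary ℚ b).right i)).eq.symm
  refine Set.Finite.subset (Set.Finite.biUnion (Coalgebra.Repr.arbitrary ℚ b).index.finite_toSet
    fun i _ => Set.Finite.biUnion (Coalgebra.Repr.arbitrary ℚ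
      ((Coalgebra.Repr.arbitrary ℚ b).right i)).index.finite_toSet fun j _ =>
        (ν ((Coalgebra.Repr.arbitrary ℚ ((Coalgebra.Repr.arbitrary ℚ b).right i)).left
          j)).coeff.support.finite_toSet) ?_
  rintro m ⟨x, y, hm⟩
  by_contra hn
  simp only [Set.mem_iUnion, not_exists] at hn
  refine hm ?_
  rw [Points.mul_apply_of_comul _ hb, map_sum]
  refine Finset.sum_eq_zero fun i hi => ?_
  rw [Points.mul_apply_of_comul _ (hc i), Finset.mul_sum, map_sum]
  refine Finset.sum_eq_zero fun j hj => ?_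
  have h0 := hn i hi j hj
  rw [Finset.mem_coe, Finsupp.mem_support_iff, not_not] at h0
  rw [Points.map_apply, Points.map_apply, laurentScalar_apply, laurentScalar_apply,
    mul_comm (ν _), ← mul_assoc, ← map_mul, ← LaurentPolynomial.smul_eq_C_mul, map_smul,
    laurentCoeff_apply, h0, smul_zero]

theorem exponents_nonempty {b : A} (hb : Coalgebra.counit (R := ℚ) b = 1) (μ : Cocharacter A) :
    (exponents b μ.point).Nonempty := by
  by_contra hn
  have h0 : μ.point b = 0 := by
    ext m
    by_contra hm
    refine hn ⟨m, 1, 1, ?_⟩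
    rw [Points.map_one, mul_one, one_mul]
    exact hm
  have h1 := congrArg (fun x : Points ℚ A ℂ => x b) μ.eval_one
  have h2 : laurentHom 1 (μ.point b) = algebraMap ℚ ℂ (Coalgebra.counit b) := h1
  rw [h0, hb, map_zero, map_one] at h2
  exact zero_ne_one h2

theorem laurentCoeff_laurentMap (σ : ℂ ≃ₐ[ℚ] ℂ) (m : ℤ) (p : ℂ[T;T⁻¹]) :
    laurentCoeff m (laurentMap σ p) = σ (laurentCoeff m p) := by
  induction p using LaurentPolynomial.induction_on' with
  | add p q hp hq => simp only [map_add, hp, hq]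
  | C_mul_T n c =>
    rw [map_mul, laurentMap_C, laurentMap_T, laurentCoeff_C_mul_T, laurentCoeff_C_mul_T]
    split_ifs <;> simp

theorem map_laurentMap_laurentScalar (σ : ℂ ≃ₐ[ℚ] ℂ) (x : Points ℚ A ℂ) :
    Points.map (laurentMap σ) (Points.map (laurentScalar ℂ[T;T⁻¹]) x) =
      Points.map (laurentScalar ℂ[T;T⁻¹]) (Points.map (σ : ℂ →ₐ[ℚ] ℂ) x) :=
  Points.ext fun _ => laurentMap_C σ _

/-- As `b` is defined over `ℚ`, the automorphism `σ` can be transferred to `x` and `y`, and it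
preserves nonvanishing of coefficients. -/
theorem exponents_smul_subset (σ : ℂ ≃ₐ[ℚ] ℂ) (b : A) (ν : Points ℚ A ℂ[T;T⁻¹]) :
    exponents b (Points.map (laurentMap σ) ν) ⊆ exponents b ν := by
  rintro m ⟨x, y, hm⟩
  have h (x : Points ℚ A ℂ) : x = Points.map (σ : ℂ →ₐ[ℚ] ℂ)
      (Points.map (σ.symm : ℂ →ₐ[ℚ] ℂ) x) :=
    Points.ext fun a => (σ.apply_symm_apply _).symm
  rw [h x, h y, ← map_laurentMap_laurentScalar σ, ← map_laurentMap_laurentScalar σ,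
    ← Points.map_mul, ← Points.map_mul, Points.map_apply, laurentCoeff_laurentMap] at hm
  exact ⟨_, _, fun h0 => hm (by rw [h0, map_zero])⟩

theorem exponents_conj (b : A) (ν : Points ℚ A ℂ[T;T⁻¹]) (g : Points ℚ A ℂ) :
    exponents b ν ⊆ exponents b (Points.map (laurentScalar ℂ[T;T⁻¹]) g * ν *
      (Points.map (laurentScalar ℂ[T;T⁻¹]) g)⁻¹) := by
  rintro m ⟨x, y, hm⟩
  refine ⟨x * g⁻¹, g * y, ?_⟩
  rw [Points.map_mul, Points.map_mul, Points.map_inv]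
  convert hm using 4
  group

theorem Set.Finite.eq_zero_of_add_mem {S : Set ℤ} (hS : S.Finite) (hne : S.Nonempty) {k : ℤ}
    (h : ∀ m ∈ S, m + k ∈ S) : k = 0 := by
  by_contra hk
  obtain ⟨m, hm⟩ := hne
  have h1 (i : ℕ) : m + i * k ∈ S := by
    induction i with
    | zero => simpa using hm
    | succ i ih =>
      have := h _ ih
      push_cast
      convert this using 1
      ring
  refine Set.infinite_of_injective_forall_mem (f := fun i : ℕ => m + i * k) (fun i j hij => ?_) h1 hS
  have h2 : (i : ℤ) * k = j * k := by simpa using hij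
  exact_mod_cast mul_right_cancel₀ hk h2

/-- Conjugate cocharacters that differ from each other by a point of a central torus, up to an
automorphism of `ℂ`, are equal. -/
theorem eq_one_of_central {n : ℕ} (p : A →ₐc[ℚ] AddMonoidAlgebra ℚ (Fin n → ℤ))
    (hp : Function.Surjective p) (μ : Cocharacter A) (σ : ℂ ≃ₐ[ℚ] ℂ) (g : Points ℚ A ℂ)
    {δ : Points ℚ A ℂ[T;T⁻¹]} (hδ : ∀ a, p a = 0 → δ a = 0)
    (hcomm : ∀ x : Points ℚ A ℂ[T;T⁻¹], Commute x δ)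
    (h : (σ • μ).point = δ * (Points.map (laurentScalar ℂ[T;T⁻¹]) g * μ.point *
      (Points.map (laurentScalar ℂ[T;T⁻¹]) g)⁻¹)) : δ = 1 := by
  obtain ⟨δ', hδ'⟩ := exists_comp_eq_of_surjective (p : A →ₐ[ℚ] AddMonoidAlgebra ℚ (Fin n → ℤ)) hp
    δ.ofConv hδ
  replace hδ' (a : A) : δ a = δ' (p a) := (hδ' a).symm
  have hδ1 : Points.map ((laurentHom (1 : ℂˣ)).restrictScalars ℚ) δ = 1 := by
    have h1 := congrArg (Points.map ((laurentHom (1 : ℂˣ)).restrictScalars ℚ)) h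
    simp only [Points.map_mul, Points.map_inv] at h1
    have h2 (μ : Cocharacter A) :
        Points.map ((laurentHom (1 : ℂˣ)).restrictScalars ℚ) μ.point = 1 := μ.eval_one
    rw [h2, h2, mul_one, mul_inv_cancel, mul_one] at h1
    exact h1.symm
  have key (v : Fin n → ℤ) : δ' (.single v 1) = 1 := by
    have hu : IsUnit (δ' (.single v 1)) := by
      refine IsUnit.map δ' (IsUnit.of_mul_eq_one (.single (-v) 1) ?_)
      rw [AddMonoidAlgebra.single_mul_single, add_neg_cancel, mul_one]
      rfl
    obtain ⟨c, k, hk⟩ := laurent_eq_C_mul_T_of_isUnit hu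
    obtain ⟨b, hb, hbv⟩ := exists_leftCoaction_eq p hp v
    -- Evaluate at `T = 1`, where `δ` is the identity.
    have hc : c = 1 := by
      obtain ⟨a, ha⟩ := hp (.single v 1)
      have hε : Coalgebra.counit (R := ℚ) a = 1 := by
        rw [← CoalgHomClass.counit_comp_apply p a, ha]
        simp
      have h2 : laurentHom 1 (δ a) = algebraMap ℚ ℂ (Coalgebra.counit a) :=
        congrArg (fun x : Points ℚ A ℂ => x a) hδ1
      rw [hδ', ha, hk, hε, map_mul, laurentHom_T, one_zpow, map_one, Units.val_one, mul_one] at h2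
      exact ((laurentHom 1).commutes c).symm.trans h2
    rw [hc, map_one, one_mul] at hk
    -- Pass from `μ` to `gμg⁻¹`, multiply by the central `δ`, which acts on `b` through the factor
    -- `T ^ k`, and return from `σμ` to `μ`.
    have hshift : ∀ m ∈ exponents b μ.point, m + k ∈ exponents b μ.point := by
      intro m hm
      refine exponents_smul_subset σ b _ ?_
      rw [← Cocharacter.point_smul, h]
      obtain ⟨x, y, hm⟩ := exponents_conj b _ g hm
      refine ⟨x, y, ?_⟩
      set ν := Points.map (laurentScalar ℂ[T;T⁻¹]) g * μ.point * (Points.map (laurentScalar ℂ[T;T⁻¹]) g)⁻¹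
      rw [mul_assoc δ, ← mul_assoc _ δ, (hcomm _).eq, mul_assoc δ,
        Points.mul_apply_of_leftCoaction p hδ' hbv, hk]
      have hT (q : ℂ[T;T⁻¹]) : laurentCoeff (m + k) (LaurentPolynomial.T k * q) =
          laurentCoeff m q := by
        induction q using LaurentPolynomial.induction_on' with
        | add p q hp hq => simp only [mul_add, map_add, hp, hq]
        | C_mul_T n c =>
          rw [mul_left_comm, ← LaurentPolynomial.T_add, laurentCoeff_C_mul_T, laurentCoeff_C_mul_T,
            add_comm m]
          simp
      rw [hT]
      exact hm
    have hk0 := (exponents_finite b μ.point).eq_zero_of_add_mem (exponents_nonempty hb μ) hshift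
    rw [hk, hk0, LaurentPolynomial.T_zero]
  have h2 : δ' = (Algebra.ofId ℚ _).comp (Bialgebra.counitAlgHom ℚ _) :=
    AddMonoidAlgebra.algHom_ext (fun v => by rw [key]; simp) (Subsingleton.elim _ _)
  refine Points.ext fun a => ?_
  rw [hδ', h2, Points.one_apply]
  simp [Algebra.ofId_apply]

end Rigidity

/-! ### Conjugacy classes of cocharacters -/

section Reflex

open scoped Pointwise

variable {A : Type u} [CommRing A] [HopfAlgebra ℚ A]

/-- A point of `G(ℂ)` as a point of `G(ℂ[T;T⁻¹])`. -/
abbrev Points.const (g : Points ℚ A ℂ) : Points ℚ A ℂ[T;T⁻¹] :=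
  Points.map (laurentScalar ℂ[T;T⁻¹]) g

theorem Cocharacter.isConjugateBy_iff (g : Points ℚ A ℂ) (μ ν : Cocharacter A) :
    IsConjugateBy (K := ℂ) g μ ν ↔ ν.point = g.const * μ.point * g.const⁻¹ := Iff.rfl

theorem RealHom.point_cocharacter (h : RealHom A) : h.cocharacter.point =
    Points.map (DeligneTorus.firstCocharacter.restrictScalars ℚ) (universalPoint h) :=
  Cocharacter.point_ofPoint _ _ _

theorem RealHom.point_cocharacter_push {A' : Type u'} [CommRing A'] [HopfAlgebra ℚ A']
    (f : A' →ₐc[ℚ] A) (h : RealHom A) :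
    (h.push f).cocharacter.point = Points.push f h.cocharacter.point := by
  rw [RealHom.point_cocharacter, RealHom.point_cocharacter]
  rfl

theorem RealHom.point_cocharacter_of_isConjugateBy {g : Points ℚ A ℝ} {h h' : RealHom A}
    (hg : IsConjugateBy g h h') :
    ∃ g : Points ℚ A ℂ, h'.cocharacter.point = g.const * h.cocharacter.point * g.const⁻¹ := by
  refine ⟨Points.map (Complex.ofRealAm.restrictScalars ℚ) g, ?_⟩
  have h1 : Points.map (DeligneTorus.firstCocharacter.restrictScalars ℚ)
      (Points.map (IsScalarTower.toAlgHom ℚ ℝ DeligneTorus) g) =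
      (Points.map (Complex.ofRealAm.restrictScalars ℚ) g).const :=
    Points.ext fun a => DeligneTorus.firstCocharacter.commutes (g a)
  rw [RealHom.point_cocharacter, RealHom.point_cocharacter, show universalPoint h' = _ from hg,
    Points.map_mul, Points.map_mul, Points.map_inv, h1]

namespace ShimuraDatum

variable (D : ShimuraDatum A)

/-- Elements of `X` are conjugate under `G(ℝ)`, so their cocharacters are conjugate under `G(ℂ)` and
one base point `h` suffices. -/
theorem mem_cocharacterClass {h : RealHom A} (hh : h ∈ D.X) (ν : Cocharacter A) :
    ν ∈ D.cocharacterClass ↔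
      ∃ g : Points ℚ A ℂ, ν.point = g.const * h.cocharacter.point * g.const⁻¹ := by
  constructor
  · rintro ⟨h', hh', g, hg⟩
    rw [Cocharacter.isConjugateBy_iff] at hg
    obtain ⟨h₀, hX⟩ := D.isConjugacyClass
    rw [hX] at hh hh'
    obtain ⟨x, hx⟩ := hh
    obtain ⟨y, hy⟩ := hh'
    obtain ⟨x', hx'⟩ := RealHom.point_cocharacter_of_isConjugateBy hx
    obtain ⟨y', hy'⟩ := RealHom.point_cocharacter_of_isConjugateBy hy
    refine ⟨g * y' * x'⁻¹, ?_⟩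
    rw [hg, hy', hx']
    simp only [Points.const, Points.map_mul, Points.map_inv]
    group
  · rintro ⟨g, hg⟩
    exact ⟨h, hh, g, hg⟩

theorem smul_mem_cocharacterClass {h : RealHom A} (hh : h ∈ D.X) {σ : ℂ ≃ₐ[ℚ] ℂ}
    (hσ : σ • h.cocharacter ∈ D.cocharacterClass) {ν : Cocharacter A}
    (hν : ν ∈ D.cocharacterClass) : σ • ν ∈ D.cocharacterClass := by
  rw [D.mem_cocharacterClass hh] at hσ hν ⊢
  obtain ⟨g, hg⟩ := hσ
  obtain ⟨x, hx⟩ := hν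
  refine ⟨Points.map (σ : ℂ →ₐ[ℚ] ℂ) x * g, ?_⟩
  rw [Cocharacter.point_smul] at hg ⊢
  rw [hx, Points.map_mul, Points.map_mul, Points.map_inv, hg, map_laurentMap_laurentScalar]
  simp only [Points.const, Points.map_mul]
  group

theorem mem_isotropyGroup {h : RealHom A} (hh : h ∈ D.X) (σ : ℂ ≃ₐ[ℚ] ℂ) :
    σ ∈ D.isotropyGroup ↔ ∃ g : Points ℚ A ℂ,
      (σ • h.cocharacter).point = g.const * h.cocharacter.point * g.const⁻¹ := by
  have hself : h.cocharacter ∈ D.cocharacterClass :=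
    (D.mem_cocharacterClass hh _).mpr ⟨1, by simp [Points.const, Points.map_one]⟩
  rw [← D.mem_cocharacterClass hh, isotropyGroup, MulAction.mem_stabilizer_iff]
  constructor
  · intro hσ
    rw [← hσ]
    exact Set.smul_mem_smul_set hself
  · intro hσ
    -- Stabilizing the class means equality of sets, so `σ⁻¹` must preserve it too; its conjugator
    -- is obtained by applying `σ⁻¹` to the relation for `σ`.
    have hσ' : σ⁻¹ • h.cocharacter ∈ D.cocharacterClass := by
      rw [D.mem_cocharacterClass hh] at hσ ⊢
      obtain ⟨g, hg⟩ := hσ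
      refine ⟨Points.map ((σ⁻¹ : ℂ ≃ₐ[ℚ] ℂ) : ℂ →ₐ[ℚ] ℂ) g⁻¹, ?_⟩
      have h1 := congrArg (Points.map (laurentMap σ⁻¹)) hg
      rw [← Cocharacter.point_smul, inv_smul_smul, Points.map_mul, Points.map_mul, Points.map_inv,
        ← Cocharacter.point_smul, map_laurentMap_laurentScalar] at h1
      rw [h1]
      simp only [Points.const, Points.map_inv]
      group
    refine Set.Subset.antisymm ?_ fun ν hν => ?_
    · rintro _ ⟨ν, hν, rfl⟩
      exact D.smul_mem_cocharacterClass hh hσ hν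
    · exact ⟨σ⁻¹ • ν, D.smul_mem_cocharacterClass hh hσ' hν, smul_inv_smul σ ν⟩

end ShimuraDatum

variable {A' : Type u'} [CommRing A'] [HopfAlgebra ℚ A'] {f : A' →ₐc[ℚ] A}

/-- Cocharacters of `G` whose images in `G'` are conjugate are conjugate in `G'` by a point of
`f(G)`, if the cokernel of `f` is a split torus. -/
theorem exists_push_conj [Algebra.FiniteType ℚ A] [Algebra.FiniteType ℚ A'] [IsReduced A']
    [ConnectedSpace (PrimeSpectrum A')] (hnormal : IsNormalIdeal ℚ (RingHom.ker f))
    (hcok : CokernelIsSplitTorus f) (μ : Cocharacter A') (g' : Points ℚ A' ℂ) :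
    ∃ g : Points ℚ A ℂ, g'.const * μ.point * g'.const⁻¹ =
      (Points.push f g).const * μ.point * (Points.push f g).const⁻¹ := by
  have : IsNoetherianRing A' := Algebra.FiniteType.isNoetherianRing ℚ A'
  obtain ⟨n, j, hj, hjr⟩ := exists_torus_of_cokernelIsSplitTorus hcok
  -- `z` centralizes `μ` and has the image of `g'` in the torus. So `g' z⁻¹` conjugates `μ` as `g'`
  -- does and is trivial in the cokernel.
  obtain ⟨z, hz, hzj⟩ := exists_commute_apply_eq μ j hj g'
  have hpush : Points.push j (g' * z⁻¹) = 1 := by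
    rw [_root_.map_mul, _root_.map_inv, mul_inv_eq_one]
    exact Points.ext fun b => (hzj b).symm
  have h0 : ∀ c ∈ coinvariants f, (g' * z⁻¹) c = algebraMap ℚ ℂ (Coalgebra.counit c) := by
    intro c hc
    obtain ⟨b, rfl⟩ := hjr c hc
    refine (congrArg (fun x : Points ℚ _ ℂ => x b) hpush).trans ?_
    rw [CoalgHomClass.counit_comp_apply]
    rfl
  obtain ⟨g, hg⟩ := exists_push_eq f (g' * z⁻¹) (apply_eq_zero_of_coinvariants f hnormal _ h0)
  refine ⟨g, ?_⟩
  have hgz : g' = Points.push f g * z := by rw [hg, inv_mul_cancel_right]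
  rw [hgz, Points.const, Points.map_mul, mul_assoc _ _ μ.point, hz.eq, mul_inv_rev]
  group

/-- A cocharacter `μ` of `G` is conjugate to `σ μ` if this is so in `G / Ker f`, by a point of `G`,
and if the neutral component of `Ker f` is a split torus. -/
theorem point_smul_eq_of_push [IsReduced A] [ConnectedSpace (PrimeSpectrum A)]
    (hker : NeutralComponentIsSplitTorus ℚ (A ⧸ kerIdeal f)) (μ : Cocharacter A)
    (σ : ℂ ≃ₐ[ℚ] ℂ) (g : Points ℚ A ℂ)
    (h : Points.push f (σ • μ).point =
      Points.push f (g.const * μ.point * g.const⁻¹)) :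
    (σ • μ).point = g.const * μ.point * g.const⁻¹ := by
  obtain ⟨n, φ, hφ, hφk⟩ := hker
  let p : A →ₐc[ℚ] AddMonoidAlgebra ℚ (Fin n → ℤ) :=
    φ.comp (Bialgebra.Quotient.mkBialgHom (R := ℚ) (kerIdeal f))
  have hpφ (a : A) : p a = φ (Ideal.Quotient.mk _ a) := rfl
  have hp : Function.Surjective p := hφ.comp Ideal.Quotient.mk_surjective
  let δ := (σ • μ).point * (g.const * μ.point * g.const⁻¹)⁻¹
  have hδf : Points.push f δ = 1 := by
    rw [_root_.map_mul, h, ← _root_.map_mul, mul_inv_cancel, _root_.map_one]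
  have hδ1 : Points.map ((laurentHom (1 : ℂˣ)).restrictScalars ℚ) δ = 1 := by
    have h2 (μ : Cocharacter A) :
        Points.map ((laurentHom (1 : ℂˣ)).restrictScalars ℚ) μ.point = 1 := μ.eval_one
    simp only [δ, Points.map_mul, Points.map_inv, h2, mul_one, mul_inv_cancel, inv_one]
  -- `δ` is the identity at `T = 1`, and idempotents of the domain `ℂ[T;T⁻¹]` are `0` or `1`, so `δ`
  -- stays in the neutral component of `Ker f`.
  have hδ : ∀ a, p a = 0 → δ a = 0 := fun a ha =>
    Points.apply_eq_zero_of_neutralIdeal hφk hδf (fun a h0 he => by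
      have h1 : laurentHom 1 (δ a) = algebraMap ℚ ℂ (Coalgebra.counit a) :=
        congrArg (fun x : Points ℚ A ℂ => x a) hδ1
      rcases IsIdempotentElem.iff_eq_zero_or_one.mp he with h | h
      · exact h
      · rw [h, h0, map_one, map_zero] at h1
        exact absurd h1 one_ne_zero) ha
  -- The neutral component of the kernel is normal: `x t x⁻¹` lies in `Ker f` and equals `1` at `t =
  -- 1`, and an idempotent on `G` times the torus that vanishes there is zero.
  have hcomm : ∀ x : Points ℚ A ℂ[T;T⁻¹], Commute x δ := fun x =>
    commute_of_normal_torus p hp (fun x t ht a ha => by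
      refine Points.apply_eq_zero_of_neutralIdeal hφk ?_ (fun a h0 he => ?_) ha
      · have htf : Points.push f t = 1 := Points.ext fun b => by
          rw [Points.push_apply, ht, hpφ, mk_kerIdeal, Points.one_apply,
            Algebra.TensorProduct.algebraMap_apply']
          congr 1
          exact AlgHomClass.commutes φ _
        rw [_root_.map_mul, _root_.map_mul, htf, mul_one, ← _root_.map_mul, mul_inv_cancel,
          _root_.map_one]
      · refine eq_zero_of_isIdempotentElem_tmul he ?_
        refine (congrArg (fun y : Points ℚ A _ => y a) (map_counit_conj p (x := x) ht)).trans ?_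
        rw [Points.one_apply, h0, map_zero]) x δ hδ
  have h1 := eq_one_of_central p hp μ σ g hδ hcomm (inv_mul_cancel_right _ _).symm
  exact mul_inv_eq_one.mp h1

end Reflex

end

theorem mainTheorem12 {A A' : Type*} [CommRing A] [HopfAlgebra ℚ A] [CommRing A']
    [HopfAlgebra ℚ A'] (D : ShimuraDatum A) (D' : ShimuraDatum A')
    (f : A' →ₐc[ℚ] A) (hf : D.IsMorphism D' f)
    (hnormal : IsNormalIdeal ℚ (RingHom.ker f))
    (hker : NeutralComponentIsSplitTorus ℚ (A ⧸ kerIdeal f))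
    (hcok : CokernelIsSplitTorus f) :
    D.reflexField = D'.reflexField := by
  have := D.reductive.smooth
  have := D'.reductive.smooth
  have := D.reductive.connected
  have := D'.reductive.connected
  have : IsReduced A := isReduced_of_smooth ℚ A
  have : IsReduced A' := isReduced_of_smooth ℚ A'
  suffices h : D.isotropyGroup = D'.isotropyGroup by
    rw [ShimuraDatum.reflexField, ShimuraDatum.reflexField, h]
  obtain ⟨h, hh⟩ : ∃ h, h ∈ D.X := by
    obtain ⟨h₀, hX⟩ := D.isConjugacyClass
    refine ⟨h₀, ?_⟩
    rw [hX]
    refine ⟨1, ?_⟩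
    change universalPoint h₀ = _
    rw [Points.map_one, one_mul, inv_one, mul_one]
  have hsmul (σ : ℂ ≃ₐ[ℚ] ℂ) : (σ • (h.push f).cocharacter).point =
      Points.push f (σ • h.cocharacter).point := by
    rw [Cocharacter.point_smul, Cocharacter.point_smul, RealHom.point_cocharacter_push]
    rfl
  ext σ
  rw [D.mem_isotropyGroup hh, D'.mem_isotropyGroup (hf h hh)]
  constructor
  · rintro ⟨g, hg⟩
    refine ⟨Points.push f g, ?_⟩
    rw [hsmul, hg, _root_.map_mul, _root_.map_mul, _root_.map_inv, RealHom.point_cocharacter_push]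
    rfl
  · rintro ⟨g', hg'⟩
    -- Once the conjugator comes from `G`, the relation compares two cocharacters of `G` modulo `Ker
    -- f`, and the central torus argument removes the ambiguity.
    obtain ⟨g, hg⟩ := exists_push_conj hnormal hcok (h.push f).cocharacter g'
    refine ⟨g, point_smul_eq_of_push hker _ σ g ?_⟩
    rw [← hsmul, hg', hg, RealHom.point_cocharacter_push, _root_.map_mul, _root_.map_mul,
      _root_.map_inv]
    rfl
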